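/- **Setting.** A Cartan datum is a pair $(B,\tau)$ with $B=(b_{ij})\in\mathbb C^{n\times n}$ and $\tau\in(\mathbb Z/2)^n$. Fix a minimal realization of $B$: a complex vector space $\mathfrak h$ of dimension $2n-\operatorname{rk}B$ with linearly independent $\alpha_i\in\mathfrak h^*$ and linearly independent $h_i\in\mathfrak h$ such that $\alpha_j(h_i)=b_{ij}$. Let $\tilde{\mathfrak g}(B,\tau)$ be the complex Lie superalgebra generated by the even space $\mathfrak h$ and by $e_i,f_i$ of parity $\tau_i$ subject to $[h,h']=0$, $[h,e_i]=\alpha_i(h)e_i$, $[h,f_i]=-\alpha_i(h)f_i$, $[e_i,f_j]=\delta_{ij}h_i$, and let $\mathfrak g=\mathfrak g(B,\tau)$ be its quotient by the maximal ideal meeting $\mathfrak h$ trivially. The datum $(B,\tau)$ is *regular* if $B$ has no zero row and is indecomposable, $b_{ij}=0\Leftrightarrow b_{ji}=0$, for $\tau_i=\bar0$ one has $b_{ii}\ne0$ and $2b_{ij}/b_{ii}\in\mathbb Z_{\le0}$ for $j\neq i$, and for $\tau_i=\bar1$, $b_{ii}\neq0$ one has $2b_{ij}/b_{ii}\in2\mathbb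 Z_{\le0}$ for $j\ne i$. Assume that $B$ is symmetrizable and that $\mathfrak g$ is regular, i.e. every Cartan datum $(B',\tau')$ with $\mathfrak g(B',\tau')\cong\mathfrak g$ is regular. An *ordered root base* is a sequence $(\beta_1,\dots,\beta_n)$ of linearly independent roots of $\mathfrak g$ for which there are $e_i'\in\mathfrak g_{\beta_i}$, $f_i'\in\mathfrak g_{-\beta_i}$ that together with $\mathfrak h$ generate $\mathfrak g$ and satisfy $[e'_i,f'_j]=0$ for $i\neq j$. With $h'_i=[e'_i,f'_i]\in\mathfrak h$ it has the Cartan datum $b'_{ij}=\beta_j(h'_i)$, $\tau'_i=|e'_i|$ (unique up to rescaling the rows of $B'$), and the Serre matrix $A$ with $a_{ii}=2$ and, for $i\ne j$, $a_{ij}=0$ if $b'_{ij}=0$, $a_{ij}=-1$ if $b'_{ij}\ne0=b'_{ii}$, and $a_{ij}=2b'_{ij}/b'_{ii}$ otherwise. The simple root $\beta_i$ is *odd isotropic* if $\tau'_i=\bar1$ and $b'_{ii}=0$, and *non-isotropic* if $b'_{ii}\neq0$. The odd reflection at an odd isotropic $\beta_i$ replaces $\beta_i$ by $-\beta_i$ and,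 for $j\neq i$, replaces $\beta_j$ by $\beta_j+\beta_i$ if $\beta_j(h_i')\ne0$ and keeps it otherwise. The *Cartan graph* of $\mathfrak g$ has the ordered root bases as vertices, labelled by their Serre matrices $A(x)$; an edge of colour $i$ joins $x$ to its odd reflection at the $i$-th simple root if this root is odd isotropic, and there is a loop of colour $i$ at $x$ otherwise. The *Weyl groupoid* $\mathcal W$ of $\mathfrak g$ has the vertices as objects; its morphisms are the linear maps between the lattices $\mathbb Z^n_x$ with basis $\alpha_1^x,\dots,\alpha_n^x$ that are generated by $s_i\colon\mathbb Z^n_x\to\mathbb Z^n_y$, $\alpha^x_j\mapsto\alpha^y_j-A(x)_{ij}\alpha^y_i$, for the edges of colour $i$ between $x$ and $y$. For an object $x$ let $W_x\subseteq\mathrm{GL}(\mathfrak h^*)$ be the Weyl group of its connected component: the group generated by the reflections at the non-isotropic roots that appear as simple roots in some ordered root base in the connected component of $x$ in the Cartan graph. An even root $\alpha$ of $\mathfrak g$ is *principal* if $\alpha$ or $\tfrac12\alpha$ appears as a simple root in some ordered root base of $\mathfrak g$ (in any component); the Weyl group $W$ of $\mathfrak g$ is the subgroup of $\mathrm{GL}(\mathfrak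 h^*)$ generated by the reflections at all principal even roots. **Proposition.** For every object $x$ of $\mathcal W$: 1. $\operatorname{Aut}_{\mathcal W}(x)\cong W_x$. 2. If for every even root $\alpha$ of $\mathfrak g$ either $\alpha$ or $\tfrac12\alpha$ appears as a simple root in an ordered root base in the connected component of $x$, then $\operatorname{Aut}_{\mathcal W}(x)\cong W$. 3. More generally, if for every principal even root $\alpha$ of $\mathfrak g$ there is $w\in W_x$ such that $w\alpha$ or $\tfrac12w\alpha$ appears as a simple root in an ordered root base in the connected component of $x$, then $\operatorname{Aut}_{\mathcal W}(x)\cong W$. -/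

import Mathlib

universe u v

noncomputable section

namespace ContragredientLSA

/-! ### Super algebras and Lie superalgebras over the complex numbers -/

/-- The sign `(-1)^s` of a parity `s`. -/
def sgn (s : ZMod 2) : ℂ := if s = 0 then 1 else -1

/-- The sign `(-1)^(s * t)` of two parities. -/
def koszul (s t : ZMod 2) : ℂ := if s = 1 ∧ t = 1 then -1 else 1

theorem sgn_add (s t : ZMod 2) : sgn (s + t) = sgn s * sgn t := by
  have key : ∀ s t : ZMod 2, s + t = 0 ↔ (s = 0 ↔ t = 0) := by decide
  unfold sgn
  simp only [key]
  by_cases hs : s = 0 <;> by_cases ht : t = 0 <;> simp [hs, ht]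

theorem sgn_mul_self (s : ZMod 2) : sgn s * sgn s = 1 := by
  unfold sgn; split_ifs <;> norm_num

/-- A complex superspace with a bilinear product (written as a bracket) that respects parity. -/
class SuperAlg (L : Type u) [AddCommGroup L] [Module ℂ L] where
  bracket : L →ₗ[ℂ] L →ₗ[ℂ] L
  part : ZMod 2 → Submodule ℂ L
  isCompl : IsCompl (part 0) (part 1)
  bracket_mem : ∀ {s t : ZMod 2} {x y : L}, x ∈ part s → y ∈ part t →
    bracket x y ∈ part (s + t)

open SuperAlg

/-- A Lie superalgebra over `ℂ`: super skew-symmetry and the super Jacobi identity hold. -/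
class LieSuperalgebra (L : Type u) [AddCommGroup L] [Module ℂ L] extends SuperAlg L where
  skew : ∀ {s t : ZMod 2} {x y : L}, x ∈ part s → y ∈ part t →
    bracket x y = -(koszul s t • bracket y x)
  jacobi : ∀ {s t r : ZMod 2} {x y z : L}, x ∈ part s → y ∈ part t → z ∈ part r →
    bracket x (bracket y z) = bracket (bracket x y) z + koszul s t • bracket y (bracket x z)

/-- Two Lie superalgebras are isomorphic: there is a linear bijection that preserves
brackets and parities. -/
def IsIsomorphic (L : Type u) (L' : Type v) [AddCommGroup L] [Module ℂ L] [LieSuperalgebra L]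
    [AddCommGroup L'] [Module ℂ L'] [LieSuperalgebra L'] : Prop :=
  ∃ φ : L ≃ₗ[ℂ] L', (∀ x y, φ (bracket x y) = bracket (φ x) (φ y)) ∧
    ∀ (s : ZMod 2) (x : L), x ∈ part (L := L) s → φ x ∈ part (L := L') s

section Ideals

variable {L : Type u} [AddCommGroup L] [Module ℂ L] [SuperAlg L]

/-- Two-sided, parity-homogeneous ideals of a super algebra. -/
structure IsIdeal (I : Submodule ℂ L) : Prop where
  left : ∀ (x : L) {y : L}, y ∈ I → bracket x y ∈ I
  right : ∀ {x : L} (y : L), x ∈ I → bracket x y ∈ I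
  graded : ∀ {x : L}, x ∈ I → ∃ y ∈ I, ∃ z ∈ I,
    y ∈ part (L := L) 0 ∧ z ∈ part (L := L) 1 ∧ x = y + z

theorem isIdeal_sSup {S : Set (Submodule ℂ L)} (hS : ∀ I ∈ S, IsIdeal I) :
    IsIdeal (sSup S) where
  left x {y} hy := by
    have h : sSup S ≤ (sSup S).comap (bracket x) :=
      sSup_le fun I hI z hz => (le_sSup hI : I ≤ _) ((hS I hI).left x hz)
    exact h hy
  right {x} y hx := by
    have h : sSup S ≤ (sSup S).comap ((bracket (L := L)).flip y) :=
      sSup_le fun I hI z hz => (le_sSup hI : I ≤ _) ((hS I hI).right y hz)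
    exact h hx
  graded {x} hx := by
    have h : sSup S ≤ (sSup S ⊓ part 0) ⊔ (sSup S ⊓ part 1) := by
      refine sSup_le fun I hI z hz => ?_
      obtain ⟨a, ha, b, hb, ha0, hb1, rfl⟩ := (hS I hI).graded hz
      exact Submodule.add_mem_sup ⟨(le_sSup hI : I ≤ _) ha, ha0⟩ ⟨(le_sSup hI : I ≤ _) hb, hb1⟩
    obtain ⟨a, ha, b, hb, hab⟩ := Submodule.mem_sup.1 (h hx)
    exact ⟨a, ha.1, b, hb.1, ha.2, hb.2, hab.symm⟩

/-- The product induced on the quotient by an ideal. -/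
def quotBracket (I : Submodule ℂ L) (hI : IsIdeal I) : (L ⧸ I) →ₗ[ℂ] (L ⧸ I) →ₗ[ℂ] (L ⧸ I) :=
  I.liftQ
    { toFun := fun x => I.mapQ I (bracket x) fun _ hy => hI.left x hy
      map_add' := fun x y => by
        apply Submodule.linearMap_qext; ext z; simp
      map_smul' := fun c x => by
        apply Submodule.linearMap_qext; ext z; simp }
    (fun x hx => by
      rw [LinearMap.mem_ker]
      apply Submodule.linearMap_qext
      ext z
      simpa using hI.right z hx)

theorem quotBracket_mk (I : Submodule ℂ L) (hI : IsIdeal I) (x y : L) :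
    quotBracket I hI (I.mkQ x) (I.mkQ y) = I.mkQ (bracket x y) := rfl

/-- The quotient of a super algebra by an ideal. -/
@[reducible] def quotSuperAlg (I : Submodule ℂ L) (hI : IsIdeal I) : SuperAlg (L ⧸ I) where
  bracket := quotBracket I hI
  part s := (part (L := L) s).map I.mkQ
  isCompl := by
    constructor
    · rw [Submodule.disjoint_def]
      rintro _ ⟨a, ha, rfl⟩ ⟨b, hb, hab⟩
      have hm : a - b ∈ I := (Submodule.Quotient.eq I).1 hab.symm
      obtain ⟨y, hyI, z, -, hy, hz, h⟩ := hI.graded hm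
      have h1 : a - y = b + z := by rw [sub_eq_iff_eq_add] at h ⊢; rw [h]; abel
      have h2 : a - y = 0 :=
        Submodule.disjoint_def.1 (isCompl (L := L)).disjoint _ (sub_mem ha hy)
          (h1 ▸ add_mem hb hz)
      rw [sub_eq_zero] at h2
      rw [h2]
      exact (Submodule.Quotient.mk_eq_zero I).2 hyI
    · rw [codisjoint_iff, ← Submodule.map_sup, (isCompl (L := L)).sup_eq_top,
        Submodule.map_top, Submodule.range_mkQ]
  bracket_mem := by
    rintro s t _ _ ⟨a, ha, rfl⟩ ⟨b, hb, rfl⟩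
    exact ⟨_, bracket_mem ha hb, (quotBracket_mk I hI a b).symm⟩

/-- A quotient in which the Lie superalgebra identities hold is a Lie superalgebra. -/
@[reducible] def quotLieSuperalgebra (I : Submodule ℂ L) (hI : IsIdeal I)
    (hskew : ∀ {s t : ZMod 2} {x y : L}, x ∈ part (L := L) s → y ∈ part (L := L) t →
      bracket x y + koszul s t • bracket y x ∈ I)
    (hjacobi : ∀ {s t r : ZMod 2} {x y z : L}, x ∈ part (L := L) s → y ∈ part (L := L) t →
      z ∈ part (L := L) r →
      bracket x (bracket y z) - bracket (bracket x y) z - koszul s t • bracket y (bracket x z)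
        ∈ I) :
    LieSuperalgebra (L ⧸ I) where
  toSuperAlg := quotSuperAlg I hI
  skew := by
    rintro s t _ _ ⟨a, ha, rfl⟩ ⟨b, hb, rfl⟩
    have h := (Submodule.Quotient.mk_eq_zero I).2 (hskew ha hb)
    exact eq_neg_of_add_eq_zero_left h
  jacobi := by
    rintro s t r _ _ _ ⟨a, ha, rfl⟩ ⟨b, hb, rfl⟩ ⟨c, hc, rfl⟩
    have h := (Submodule.Quotient.mk_eq_zero I).2 (hjacobi ha hb hc)
    rw [sub_sub] at h
    exact sub_eq_zero.1 h

end Ideals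

/-! ### Cartan data and contragredient Lie superalgebras -/

/-- A Cartan datum: a complex square matrix and a parity vector. -/
structure CartanDatum (n : ℕ) where
  B : Matrix (Fin n) (Fin n) ℂ
  τ : Fin n → ZMod 2

/-- A minimal realization of a matrix `B` on the vector space `h`. -/
structure MinimalRealization {n : ℕ} (B : Matrix (Fin n) (Fin n) ℂ) (h : Type u)
    [AddCommGroup h] [Module ℂ h] where
  root : Fin n → Module.Dual ℂ h
  coroot : Fin n → h
  finiteDimensional : FiniteDimensional ℂ h
  finrank_eq : Module.finrank ℂ h = 2 * n - B.rank
  root_linearIndependent : LinearIndependent ℂ root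
  coroot_linearIndependent : LinearIndependent ℂ coroot
  pairing : ∀ i j, root j (coroot i) = B i j

/-- The generators: all elements of `h` and the Chevalley generators `e i`, `f i`. -/
inductive Gen (n : ℕ) (h : Type u) : Type u
  | H (x : h)
  | E (i : Fin n)
  | F (i : Fin n)

section Construction

variable {n : ℕ} {h : Type u}

/-- The parity of a generator. -/
def Gen.parity (τ : Fin n → ZMod 2) : Gen n h → ZMod 2
  | .H _ => 0
  | .E i => τ i
  | .F i => τ i

/-- The free non-associative algebra on the generators, where the parities of the generators
are `τ`; the parities enter only its superalgebra structure. -/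
@[nolint unusedArguments]
def Free (_τ : Fin n → ZMod 2) (h : Type u) : Type u :=
  FreeNonUnitalNonAssocAlgebra ℂ (Gen n h)

variable (τ : Fin n → ZMod 2)

instance : NonUnitalNonAssocRing (Free τ h) :=
  inferInstanceAs (NonUnitalNonAssocRing (MonoidAlgebra ℂ (FreeMagma (Gen n h))))
instance : Module ℂ (Free τ h) :=
  inferInstanceAs (Module ℂ (MonoidAlgebra ℂ (FreeMagma (Gen n h))))
instance : IsScalarTower ℂ (Free τ h) (Free τ h) :=
  inferInstanceAs (IsScalarTower ℂ (MonoidAlgebra ℂ (FreeMagma (Gen n h)))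
    (MonoidAlgebra ℂ (FreeMagma (Gen n h))))
instance : SMulCommClass ℂ (Free τ h) (Free τ h) :=
  inferInstanceAs (SMulCommClass ℂ (MonoidAlgebra ℂ (FreeMagma (Gen n h)))
    (MonoidAlgebra ℂ (FreeMagma (Gen n h))))

/-- The inclusion of the generators in the free algebra. -/
def Free.of (g : Gen n h) : Free τ h := FreeNonUnitalNonAssocAlgebra.of ℂ g

/-- The parity automorphism of the free algebra, `x ↦ (-1)^|x| x` on homogeneous elements: the
algebra endomorphism that multiplies each generator by the sign of its parity. -/
def Free.θ : Free τ h →ₙₐ[ℂ] Free τ h :=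
  FreeNonUnitalNonAssocAlgebra.lift ℂ fun g => sgn (g.parity τ) • Free.of τ g

theorem Free.θ_of (g : Gen n h) : Free.θ τ (Free.of τ g) = sgn (g.parity τ) • Free.of τ g :=
  FreeNonUnitalNonAssocAlgebra.lift_of_apply ℂ _ g

theorem Free.θ_θ (x : Free τ h) : Free.θ τ (Free.θ τ x) = x := by
  have h1 : (Free.θ (h := h) τ).comp (Free.θ τ) = NonUnitalAlgHom.id ℂ (Free τ h) := by
    apply FreeNonUnitalNonAssocAlgebra.hom_ext ℂ
    intro g
    change Free.θ τ (Free.θ τ (Free.of τ g)) = Free.of τ g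
    rw [Free.θ_of, map_smul, Free.θ_of, smul_smul, sgn_mul_self, one_smul]
  exact DFunLike.congr_fun h1 x

/-- The even and odd parts of the free algebra. -/
def Free.part (s : ZMod 2) : Submodule ℂ (Free τ h) where
  carrier := {x | Free.θ τ x = sgn s • x}
  add_mem' {x y} hx hy := by
    simp only [Set.mem_ofPred_eq] at *
    rw [map_add, hx, hy, smul_add]
  zero_mem' := by simp
  smul_mem' c x hx := by
    simp only [Set.mem_ofPred_eq] at *
    rw [map_smul, hx, smul_comm]

theorem Free.decomp (x : Free τ h) :
    x = (1 / 2 : ℂ) • (x + Free.θ τ x) + (1 / 2 : ℂ) • (x - Free.θ τ x) := by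
  module

theorem Free.decomp_even (x : Free τ h) :
    (1 / 2 : ℂ) • (x + Free.θ τ x) ∈ Free.part (h := h) τ 0 := by
  change Free.θ τ _ = _
  rw [map_smul, map_add, Free.θ_θ, sgn, if_pos rfl]
  module

theorem Free.decomp_odd (x : Free τ h) :
    (1 / 2 : ℂ) • (x - Free.θ τ x) ∈ Free.part (h := h) τ 1 := by
  change Free.θ τ _ = _
  rw [map_smul, map_sub, Free.θ_θ, sgn, if_neg (by decide)]
  module

instance : SuperAlg (Free τ h) where
  bracket := LinearMap.mul ℂ (Free τ h)
  part := Free.part τ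
  isCompl := by
    constructor
    · rw [Submodule.disjoint_def]
      intro x h0 h1
      have h0' : Free.θ τ x = sgn 0 • x := h0
      have h1' : Free.θ τ x = sgn 1 • x := h1
      rw [h0', sgn, sgn, if_pos rfl, if_neg (by decide)] at h1'
      have h2 : (2 : ℂ) • x = 0 := by
        rw [two_smul]
        nth_rewrite 1 [← one_smul ℂ x]
        rw [h1']; module
      exact (smul_eq_zero.1 h2).resolve_left (by norm_num)
    · rw [codisjoint_iff, eq_top_iff]
      intro x _
      rw [Free.decomp τ x]
      exact Submodule.add_mem_sup (Free.decomp_even τ x) (Free.decomp_odd τ x)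
  bracket_mem := by
    intro s t x y hx hy
    have hx' : Free.θ τ x = sgn s • x := hx
    have hy' : Free.θ τ y = sgn t • y := hy
    change Free.θ τ (x * y) = sgn (s + t) • (x * y)
    rw [map_mul, hx', hy', smul_mul_smul_comm, sgn_add]

variable [AddCommGroup h] [Module ℂ h]
variable {B : Matrix (Fin n) (Fin n) ℂ} (R : MinimalRealization B h)

open Free in
/-- The elements of the free algebra that are set to zero: those which express that the product is
a Lie superbracket, that `h` is mapped linearly, and the Chevalley relations. -/
inductive Relator : Free τ h → Prop
  | skew {s t : ZMod 2} {x y : Free τ h} (hx : x ∈ Free.part τ s) (hy : y ∈ Free.part τ t) :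
      Relator (x * y + koszul s t • (y * x))
  | jacobi {s t r : ZMod 2} {x y z : Free τ h} (hx : x ∈ Free.part τ s)
      (hy : y ∈ Free.part τ t) (hz : z ∈ Free.part τ r) :
      Relator (x * (y * z) - (x * y) * z - koszul s t • (y * (x * z)))
  | add (x y : h) : Relator (of τ (.H (x + y)) - of τ (.H x) - of τ (.H y))
  | smul (c : ℂ) (x : h) : Relator (of τ (.H (c • x)) - c • of τ (.H x))
  | hh (x y : h) : Relator (of τ (.H x) * of τ (.H y))
  | he (x : h) (i : Fin n) : Relator (of τ (.H x) * of τ (.E i) - R.root i x • of τ (.E i))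
  | hf (x : h) (i : Fin n) : Relator (of τ (.H x) * of τ (.F i) + R.root i x • of τ (.F i))
  | ef (i : Fin n) : Relator (of τ (.E i) * of τ (.F i) - of τ (.H (R.coroot i)))
  | ef_ne {i j : Fin n} (hij : i ≠ j) : Relator (of τ (.E i) * of τ (.F j))

/-- The two-sided ideal generated by the relators. -/
def relIdeal : Submodule ℂ (Free τ h) :=
  sInf {I | (∀ x, Relator τ R x → x ∈ I) ∧ ∀ x y, y ∈ I → x * y ∈ I ∧ y * x ∈ I}

theorem Relator.mem {x : Free τ h} (hx : Relator τ R x) : x ∈ relIdeal τ R :=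
  Submodule.mem_sInf.2 fun _ hI => hI.1 x hx

theorem relIdeal_mul {x y : Free τ h} (hy : y ∈ relIdeal τ R) :
    x * y ∈ relIdeal τ R ∧ y * x ∈ relIdeal τ R :=
  ⟨Submodule.mem_sInf.2 fun I hI => (hI.2 x y (Submodule.mem_sInf.1 hy I hI)).1,
    Submodule.mem_sInf.2 fun I hI => (hI.2 x y (Submodule.mem_sInf.1 hy I hI)).2⟩

theorem Relator.θ {x : Free τ h} (hx : Relator τ R x) :
    ∃ c : ℂ, Free.θ τ x = c • x := by
  cases hx with
  | @skew s t x y hx hy =>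
    have hx' : Free.θ τ x = sgn s • x := hx
    have hy' : Free.θ τ y = sgn t • y := hy
    refine ⟨sgn s * sgn t, ?_⟩
    simp only [map_add, map_smul, map_mul, hx', hy', smul_mul_smul_comm, smul_add, smul_smul]
    congr 2; ring
  | @jacobi s t r x y z hx hy hz =>
    have hx' : Free.θ τ x = sgn s • x := hx
    have hy' : Free.θ τ y = sgn t • y := hy
    have hz' : Free.θ τ z = sgn r • z := hz
    refine ⟨sgn s * sgn t * sgn r, ?_⟩
    simp only [map_sub, map_smul, map_mul, hx', hy', hz', smul_mul_smul_comm, smul_sub, smul_smul]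
    congr 2
    · congr 1; ring
    · ring
  | add x y => exact ⟨1, by simp [Free.θ_of, Gen.parity, sgn]⟩
  | smul c x => exact ⟨1, by simp [Free.θ_of, Gen.parity, sgn]⟩
  | hh x y => exact ⟨1, by simp [Free.θ_of, Gen.parity, sgn]⟩
  | he x i =>
    refine ⟨sgn (τ i), ?_⟩
    simp only [map_sub, map_smul, map_mul, Free.θ_of, smul_mul_smul_comm, smul_sub, smul_smul]
    simp only [Gen.parity]
    rw [show sgn 0 = 1 from if_pos rfl, one_mul, mul_comm]
  | hf x i =>
    refine ⟨sgn (τ i), ?_⟩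
    simp only [map_add, map_smul, map_mul, Free.θ_of, smul_mul_smul_comm, smul_add, smul_smul]
    simp only [Gen.parity]
    rw [show sgn 0 = 1 from if_pos rfl, one_mul, mul_comm]
  | ef i =>
    refine ⟨1, ?_⟩
    simp only [map_sub, map_mul, Free.θ_of, smul_mul_smul_comm, Gen.parity, sgn_mul_self]
    simp [sgn]
  | ef_ne hij =>
    exact ⟨_, by simp only [map_mul, Free.θ_of, smul_mul_smul_comm]; rfl⟩

theorem relIdeal_θ {x : Free τ h} (hx : x ∈ relIdeal τ R) : Free.θ τ x ∈ relIdeal τ R := by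
  have hle : relIdeal τ R ≤ (relIdeal τ R).comap (Free.θ (h := h) τ : Free τ h →ₗ[ℂ] Free τ h) := by
    refine sInf_le ⟨fun y hy => ?_, fun a b hb => ?_⟩
    · obtain ⟨c, hc⟩ := hy.θ
      change Free.θ τ y ∈ relIdeal τ R
      rw [hc]
      exact Submodule.smul_mem _ _ hy.mem
    · have hb' : Free.θ τ b ∈ relIdeal τ R := hb
      constructor
      · change Free.θ τ (a * b) ∈ relIdeal τ R
        rw [map_mul]; exact (relIdeal_mul τ R hb').1
      · change Free.θ τ (b * a) ∈ relIdeal τ R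
        rw [map_mul]; exact (relIdeal_mul τ R hb').2
  exact hle hx

theorem relIdeal_isIdeal : IsIdeal (relIdeal τ R) where
  left _ _ hy := (relIdeal_mul τ R hy).1
  right _ hx := (relIdeal_mul τ R hx).2
  graded {x} hx :=
    ⟨_, Submodule.smul_mem _ _ (add_mem hx (relIdeal_θ τ R hx)),
      _, Submodule.smul_mem _ _ (sub_mem hx (relIdeal_θ τ R hx)),
      Free.decomp_even τ x, Free.decomp_odd τ x, Free.decomp τ x⟩

/-- The Lie superalgebra presented by the generators `h`, `e i`, `f i` and the Chevalley
relations, before the radical is divided out. -/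
def GTilde : Type u := Free τ h ⧸ relIdeal τ R

instance : AddCommGroup (GTilde τ R) := inferInstanceAs (AddCommGroup (Free τ h ⧸ relIdeal τ R))
instance : Module ℂ (GTilde τ R) := inferInstanceAs (Module ℂ (Free τ h ⧸ relIdeal τ R))

instance : LieSuperalgebra (GTilde τ R) :=
  quotLieSuperalgebra (relIdeal τ R) (relIdeal_isIdeal τ R)
    (fun hx hy => (Relator.skew hx hy).mem) (fun hx hy hz => (Relator.jacobi hx hy hz).mem)

/-- The linear map from the Cartan subalgebra `h` to the presented Lie superalgebra. -/
def GTilde.ofH : h →ₗ[ℂ] GTilde τ R where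
  toFun x := (relIdeal τ R).mkQ (Free.of τ (.H x))
  map_add' x y := by
    refine (Submodule.Quotient.eq (relIdeal τ R)).2 ?_
    rw [← sub_sub]
    exact (Relator.add x y).mem
  map_smul' c x := (Submodule.Quotient.eq (relIdeal τ R)).2 (Relator.smul c x).mem

/-- The maximal ideal that intersects the Cartan subalgebra trivially, as the sum of all ideals
with this property. -/
def radical : Submodule ℂ (GTilde τ R) :=
  sSup {I | IsIdeal I ∧ I ⊓ LinearMap.range (GTilde.ofH τ R) = ⊥}

theorem radical_isIdeal : IsIdeal (radical τ R) := isIdeal_sSup fun _ hI => hI.1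

/-- The contragredient Lie superalgebra `g(B, τ)`. -/
def G : Type u := GTilde τ R ⧸ radical τ R

instance : AddCommGroup (G τ R) := inferInstanceAs (AddCommGroup (GTilde τ R ⧸ radical τ R))
instance : Module ℂ (G τ R) := inferInstanceAs (Module ℂ (GTilde τ R ⧸ radical τ R))

instance : LieSuperalgebra (G τ R) :=
  quotLieSuperalgebra (radical τ R) (radical_isIdeal τ R)
    (fun hx hy => by
      rw [LieSuperalgebra.skew hx hy, neg_add_cancel]; exact zero_mem _)
    (fun hx hy hz => by
      rw [LieSuperalgebra.jacobi hx hy hz, add_sub_cancel_left, sub_self]; exact zero_mem _)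

/-- The inclusion of the Cartan subalgebra in `g(B, τ)`. -/
def G.ofH : h →ₗ[ℂ] G τ R := (radical τ R).mkQ ∘ₗ GTilde.ofH τ R

end Construction

/-! ### Regular and symmetrizable Cartan data -/

/-- Regular Cartan data. -/
structure CartanDatum.IsRegular {n : ℕ} (D : CartanDatum n) : Prop where
  no_zero_row : ∀ i, ∃ j, D.B i j ≠ 0
  indecomposable : ¬ ∃ S : Set (Fin n), S.Nonempty ∧ Sᶜ.Nonempty ∧
    ∀ i ∈ S, ∀ j ∈ Sᶜ, D.B i j = 0 ∧ D.B j i = 0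
  zero_iff : ∀ i j, D.B i j = 0 ↔ D.B j i = 0
  even_ne_zero : ∀ i, D.τ i = 0 → D.B i i ≠ 0
  even_int : ∀ i, D.τ i = 0 → ∀ j, j ≠ i →
    ∃ k : ℤ, k ≤ 0 ∧ 2 * D.B i j / D.B i i = (k : ℂ)
  odd_int : ∀ i, D.τ i = 1 → D.B i i ≠ 0 → ∀ j, j ≠ i →
    ∃ k : ℤ, k ≤ 0 ∧ 2 * D.B i j / D.B i i = 2 * (k : ℂ)

/-- Symmetrizable Cartan data: some rescaling of the rows of `B` by non-zero scalars is
symmetric. -/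
def CartanDatum.IsSymmetrizable {n : ℕ} (D : CartanDatum n) : Prop :=
  ∃ d : Fin n → ℂ, (∀ i, d i ≠ 0) ∧ (Matrix.diagonal d * D.B).IsSymm

/-- `g(B, τ)` is regular: every Cartan datum whose contragredient Lie superalgebra is isomorphic
to it is regular. -/
def IsRegularLSA {n : ℕ} {h : Type u} [AddCommGroup h] [Module ℂ h] (D : CartanDatum n)
    (R : MinimalRealization D.B h) : Prop :=
  ∀ (n' : ℕ) (D' : CartanDatum n') (h' : Type u) [AddCommGroup h'] [Module ℂ h']
    (R' : MinimalRealization D'.B h'), IsIsomorphic (G D'.τ R') (G D.τ R) → D'.IsRegular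

/-- The Serre matrix of a Cartan datum. For regular data the number in the last case is an
integer, so that the floor of its real part is this integer. -/
def CartanDatum.serre {n : ℕ} (D : CartanDatum n) : Matrix (Fin n) (Fin n) ℤ :=
  Matrix.of fun i j =>
    if i = j then 2
    else if D.B i j = 0 then 0
    else if D.B i i = 0 then -1
    else ⌊(2 * D.B i j / D.B i i).re⌋

/-! ### Roots and ordered root bases -/

section Roots

variable {n : ℕ} {h : Type u} [AddCommGroup h] [Module ℂ h] (D : CartanDatum n)
  (R : MinimalRealization D.B h)

/-- The weight space of `g(B, τ)` for a weight `α`. -/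
def rootSpace (α : Module.Dual ℂ h) : Submodule ℂ (G D.τ R) where
  carrier := {x | ∀ t : h, bracket (G.ofH D.τ R t) x = α t • x}
  add_mem' {x y} hx hy t := by rw [map_add, hx t, hy t, smul_add]
  zero_mem' t := by simp
  smul_mem' c x hx t := by rw [map_smul, hx t, smul_comm]

/-- Roots of `g(B, τ)`. -/
def IsRoot (α : Module.Dual ℂ h) : Prop := α ≠ 0 ∧ rootSpace D R α ≠ ⊥

/-- Even roots of `g(B, τ)`: those with a non-zero even root vector. -/
def IsEvenRoot (α : Module.Dual ℂ h) : Prop := α ≠ 0 ∧ rootSpace D R α ⊓ part 0 ≠ ⊥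

/-- Chevalley generators `e i`, `f i` for a sequence `β` of roots, with their parities and
with the coroots `[e i, f i]`, which are elements of the Cartan subalgebra. -/
structure ChevalleyGenerators (β : Fin n → Module.Dual ℂ h) where
  e : Fin n → G D.τ R
  f : Fin n → G D.τ R
  coroot : Fin n → h
  parity : Fin n → ZMod 2
  e_mem : ∀ i, e i ∈ rootSpace D R (β i)
  f_mem : ∀ i, f i ∈ rootSpace D R (-β i)
  e_parity : ∀ i, e i ∈ part (L := G D.τ R) (parity i)
  f_parity : ∀ i, f i ∈ part (L := G D.τ R) (parity i)
  bracket_ne : ∀ i j, i ≠ j → bracket (e i) (f j) = 0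
  bracket_self : ∀ i, bracket (e i) (f i) = G.ofH D.τ R (coroot i)
  generate : ∀ S : Submodule ℂ (G D.τ R), (∀ x ∈ S, ∀ y ∈ S, bracket x y ∈ S) →
    (∀ t, G.ofH D.τ R t ∈ S) → (∀ i, e i ∈ S) → (∀ i, f i ∈ S) → S = ⊤

/-- Ordered root bases of `g(B, τ)`. They are the vertices of the Cartan graph. -/
@[ext]
structure OrderedRootBase where
  root : Fin n → Module.Dual ℂ h
  linearIndependent : LinearIndependent ℂ root
  isRoot : ∀ i, IsRoot D R (root i)
  exists_generators : Nonempty (ChevalleyGenerators D R root)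

variable {D R}

/-- A choice of Chevalley generators for each ordered root base. They are unique up to scalars. -/
def OrderedRootBase.gens (x : OrderedRootBase D R) : ChevalleyGenerators D R x.root :=
  Classical.choice x.exists_generators

/-- The Cartan datum of an ordered root base. -/
def OrderedRootBase.datum (x : OrderedRootBase D R) : CartanDatum n where
  B := Matrix.of fun i j => x.root j (x.gens.coroot i)
  τ := x.gens.parity

/-- The simple root with index `i` is odd isotropic. -/
def OrderedRootBase.IsOddIsotropic (x : OrderedRootBase D R) (i : Fin n) : Prop :=
  x.datum.τ i = 1 ∧ x.datum.B i i = 0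

/-- The base `y` is obtained from `x` by the odd reflection at the odd isotropic simple root
with index `i`. -/
def OrderedRootBase.IsOddReflection (i : Fin n) (x y : OrderedRootBase D R) : Prop :=
  x.IsOddIsotropic i ∧ ∀ j, y.root j =
    if j = i then -x.root i
    else if x.root j (x.gens.coroot i) = 0 then x.root j
    else x.root j + x.root i

end Roots

/-! ### Labelled graphs and Weyl groupoids -/

/-- An undirected graph (loops allowed) with edges coloured by `I` and vertices labelled by `J`. -/
structure LabelledGraph (I : Type) (J : Type) where
  V : Type u
  Edge : I → V → V → Prop
  symm : ∀ i x y, Edge i x y → Edge i y x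
  label : V → J

/-- `x` and `y` lie in the same connected component. -/
def LabelledGraph.Connected {I J : Type} (Γ : LabelledGraph.{u} I J) (x y : Γ.V) : Prop :=
  Relation.ReflTransGen (fun a b => ∃ i, Γ.Edge i a b) x y

section WeylGroupoid

variable {I : Type} [Fintype I] [DecidableEq I]

/-- The morphisms of the Weyl groupoid. The lattice at each vertex is `I → ℤ` with its standard
basis. The morphisms are generated by the simple reflections along the `i`-coloured edges from
`x` to `y`, which send the basis vector `j` at `x` to the basis vector `j` at `y` minus
`A(x) i j` times the basis vector `i` at `y`. -/
inductive IsMorphism (Γ : LabelledGraph.{u} I (Matrix I I ℤ)) :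
    Γ.V → Γ.V → ((I → ℤ) ≃ₗ[ℤ] (I → ℤ)) → Prop
  | id (x : Γ.V) : IsMorphism Γ x x (LinearEquiv.refl ℤ (I → ℤ))
  | simple {x y : Γ.V} (i : I) (hxy : Γ.Edge i x y) (s : (I → ℤ) ≃ₗ[ℤ] (I → ℤ))
      (hs : ∀ j, s (Pi.single j 1) = Pi.single j 1 - Γ.label x i j • Pi.single i 1) :
      IsMorphism Γ x y s
  | comp {x y z : Γ.V} {v w : (I → ℤ) ≃ₗ[ℤ] (I → ℤ)} (hv : IsMorphism Γ x y v)
      (hw : IsMorphism Γ y z w) : IsMorphism Γ x z (v.trans w)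
  | inv {x y : Γ.V} {v : (I → ℤ) ≃ₗ[ℤ] (I → ℤ)} (hv : IsMorphism Γ x y v) :
      IsMorphism Γ y x v.symm

/-- The Weyl groupoid of a labelled graph; its objects are the vertices. -/
structure WeylGroupoid (Γ : LabelledGraph.{u} I (Matrix I I ℤ)) where
  vertex : Γ.V

/-- Two morphisms are equal if and only if they are equal as maps of lattices. -/
instance (Γ : LabelledGraph.{u} I (Matrix I I ℤ)) :
    CategoryTheory.Groupoid (WeylGroupoid Γ) where
  Hom x y := {w : (I → ℤ) ≃ₗ[ℤ] (I → ℤ) // IsMorphism Γ x.vertex y.vertex w}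
  id x := ⟨_, IsMorphism.id x.vertex⟩
  comp v w := ⟨_, v.2.comp w.2⟩
  inv v := ⟨_, v.2.inv⟩
  id_comp _ := rfl
  comp_id _ := rfl
  assoc _ _ _ := rfl
  inv_comp v := Subtype.ext (LinearEquiv.symm_trans_self v.1)
  comp_inv v := Subtype.ext (LinearEquiv.self_trans_symm v.1)

end WeylGroupoid

/-! ### The Cartan graph and the Weyl groups of a contragredient Lie superalgebra -/

section WeylGroups

variable {n : ℕ} {h : Type u} [AddCommGroup h] [Module ℂ h] (D : CartanDatum n)
  (R : MinimalRealization D.B h)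

/-- The Cartan graph of `g(B, τ)`: an undirected edge of colour `i` joins two ordered root bases
that are related by the odd reflection at the simple root `i`, and there is a loop of
colour `i` at each ordered root base whose simple root `i` is not odd isotropic. -/
def cartanGraph : LabelledGraph.{u} (Fin n) (Matrix (Fin n) (Fin n) ℤ) where
  V := OrderedRootBase D R
  Edge i x y := OrderedRootBase.IsOddReflection i x y ∨ OrderedRootBase.IsOddReflection i y x ∨
    (x = y ∧ ¬ x.IsOddIsotropic i)
  symm i x y hxy := by
    rcases hxy with hxy | hxy | ⟨rfl, hx⟩
    · exact Or.inr (Or.inl hxy)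
    · exact Or.inl hxy
    · exact Or.inr (Or.inr ⟨rfl, hx⟩)
  label x := x.datum.serre

/-- The ordered root bases in the connected component of `x`. -/
def component (x : OrderedRootBase D R) : Set (OrderedRootBase D R) :=
  {y | (cartanGraph D R).Connected x y}

/-- `w` is the reflection of the dual Cartan subalgebra at the non-isotropic root `α`, that is
`w λ = λ - λ(c) α`, where the coroot `c` of `α` lies in the span of the brackets of the root
spaces for `α` and `-α` and satisfies `α(c) = 2`. -/
def IsReflection (α : Module.Dual ℂ h) (w : Module.Dual ℂ h ≃ₗ[ℂ] Module.Dual ℂ h) : Prop :=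
  ∃ c : h, G.ofH D.τ R c ∈
      Submodule.span ℂ {z | ∃ a ∈ rootSpace D R α, ∃ b ∈ rootSpace D R (-α), z = bracket a b} ∧
    α c = 2 ∧ ∀ μ : Module.Dual ℂ h, w μ = μ - μ c • α

/-- The Weyl group of the connected component of `x`: it is generated by the reflections at the
non-isotropic roots that are simple in some ordered root base in this component. -/
def componentWeylGroup (x : OrderedRootBase D R) :
    Subgroup (Module.Dual ℂ h ≃ₗ[ℂ] Module.Dual ℂ h) :=
  Subgroup.closure {w | ∃ y ∈ component D R x, ∃ i, y.datum.B i i ≠ 0 ∧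
    IsReflection D R (y.root i) w}

/-- The root `α` or its half is a simple root of the ordered root base `y`. -/
def OccursIn (α : Module.Dual ℂ h) (y : OrderedRootBase D R) : Prop :=
  ∃ i, y.root i = α ∨ y.root i = (1 / 2 : ℂ) • α

/-- Principal even roots: even roots `α` such that `α` or its half occurs in some ordered root
base (in any connected component). -/
def IsPrincipalEvenRoot (α : Module.Dual ℂ h) : Prop :=
  IsEvenRoot D R α ∧ ∃ y : OrderedRootBase D R, OccursIn D R α y

/-- The Weyl group of `g(B, τ)`: it is generated by the reflections at all principal even roots. -/
def weylGroup : Subgroup (Module.Dual ℂ h ≃ₗ[ℂ] Module.Dual ℂ h) :=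
  Subgroup.closure {w | ∃ α, IsPrincipalEvenRoot D R α ∧ IsReflection D R α w}

end WeylGroups

end ContragredientLSA

end

noncomputable section

namespace ContragredientLSA

open SuperAlg

/-! ### Generalities on Lie superalgebras -/

section Basic

variable {L : Type v} [AddCommGroup L] [Module ℂ L]

/-! The lattices at all vertices are compared inside `Module.Dual ℂ h` through `OrderedRootBase.ev`,
which sends the basis vectors at `x` to the simple roots of `x`. There the generators of the
groupoid become simple. The Serre row of an odd isotropic simple root is made so that `s_i` is only
the change of basis of the odd reflection, hence the identity on weights (`IsOddReflection.ev_eq`).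
A loop becomes the reflection at a non-isotropic simple root, because regularity makes `2 b_ij /
b_ii` an integer (`ev_loop`). So every morphism is the restriction of an element of the Weyl group
of the component (`IsMorphism.exists_mem`). Conversely a generating reflection at a base `y` is
realised at `x` by travelling to `y` without moving weights, using the loop, and returning
(`exists_isMorphism`). This gives a surjection from `W_x` to `Aut x`.

Injectivity is the delicate point: if `B` is degenerate, the roots do not span the dual of `h`, and
it must be shown that an element of `W_x` that fixes the root lattice is trivial. The argument is of
Coxeter type. Call the `W_x`-images of non-isotropic simple roots of the component real. Every root
is positive or negative for every base, and a step along an edge alters only one coordinate. A real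
root proportional to a simple root is this root up to sign, and an isotropic simple root has no
reflection; so odd reflections never change the sign of a real root, and a simple reflection makes
only its own positive real root negative. This yields the exchange condition, and a word that fixes
the lattice can be shortened until it is empty (`eq_one_of_fixes_lattice`).

The argument needs `W_x` to permute roots and to conjugate reflections to reflections. Both follow
from lifting simple reflections to automorphisms `exp(ad a) exp(-ad b) exp(ad a)` of the
superalgebra. The exponentials exist because the Serre relations hold: a suitable power of `ad e_i`
sends `e_j` to an element of positive weight killed by all `f_k`, which generates an ideal missing
`h`, hence zero. The integers in these relations come from regularity of the datum of each base. To
apply that hypothesis, the algebra is identified with the contragredient algebra of that datum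
(`datum_isRegular`), which requires the rank to be independent of the base and `h` to embed; the
embedding is seen on Verma modules.

For the last two claims, a reflection at an odd non-isotropic `β` is also the reflection at the even
root `2β`, so `W_x ≤ W`. The reverse inclusion follows by conjugating the generators of `W` with the
given elements of `W_x`. -/

theorem koszul_comm (s t : ZMod 2) : koszul s t = koszul t s := by
  unfold koszul; simp only [and_comm]

theorem koszul_zero_left (t : ZMod 2) : koszul 0 t = 1 := by
  unfold koszul; simp

theorem koszul_zero_right (t : ZMod 2) : koszul t 0 = 1 := by
  unfold koszul; simp

theorem koszul_mul_self (s t : ZMod 2) : koszul s t * koszul s t = 1 := by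
  unfold koszul; split_ifs <;> norm_num

theorem koszul_ne_zero (s t : ZMod 2) : koszul s t ≠ 0 := by
  unfold koszul; split_ifs <;> norm_num

theorem exists_part_add [SuperAlg L] (x : L) :
    ∃ y ∈ part (L := L) 0, ∃ z ∈ part (L := L) 1, x = y + z := by
  have h : x ∈ part (L := L) 0 ⊔ part 1 := by
    rw [(isCompl (L := L)).sup_eq_top]; exact Submodule.mem_top
  obtain ⟨y, hy, z, hz, h⟩ := Submodule.mem_sup.1 h
  exact ⟨y, hy, z, hz, h.symm⟩

theorem eq_zero_of_mem_part [SuperAlg L] {x : L} (h0 : x ∈ part (L := L) 0)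
    (h1 : x ∈ part (L := L) 1) : x = 0 :=
  Submodule.disjoint_def.1 (isCompl (L := L)).disjoint x h0 h1

theorem parity_cases (s : ZMod 2) : s = 0 ∨ s = 1 := by
  revert s; decide

theorem parity_unique [SuperAlg L] {x : L} (hx : x ≠ 0) {s t : ZMod 2} (hs : x ∈ part (L := L) s)
    (ht : x ∈ part (L := L) t) : s = t := by
  rcases parity_cases s with rfl | rfl <;> rcases parity_cases t with rfl | rfl
  · rfl
  · exact absurd (eq_zero_of_mem_part hs ht) hx
  · exact absurd (eq_zero_of_mem_part ht hs) hx
  · rfl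

variable [LieSuperalgebra L]

theorem jacobi_of_mem {s t : ZMod 2} {x y : L} (hx : x ∈ part (L := L) s)
    (hy : y ∈ part (L := L) t) (z : L) :
    bracket x (bracket y z) = bracket (bracket x y) z + koszul s t • bracket y (bracket x z) := by
  obtain ⟨a, ha, b, hb, rfl⟩ := exists_part_add z
  simp only [map_add, smul_add]
  rw [LieSuperalgebra.jacobi hx hy ha, LieSuperalgebra.jacobi hx hy hb]
  abel

theorem skew_of_even {x : L} (hx : x ∈ part (L := L) 0) (y : L) :
    bracket x y = -bracket y x := by
  obtain ⟨a, ha, b, hb, rfl⟩ := exists_part_add y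
  simp only [map_add, LinearMap.add_apply]
  rw [LieSuperalgebra.skew hx ha, LieSuperalgebra.skew hx hb, koszul_zero_left, koszul_zero_left]
  simp only [one_smul]
  abel

theorem bracket_derivation {a : L} (ha : a ∈ part (L := L) 0) (x y : L) :
    bracket a (bracket x y) = bracket (bracket a x) y + bracket x (bracket a y) := by
  obtain ⟨b, hb, c, hc, rfl⟩ := exists_part_add x
  simp only [map_add, LinearMap.add_apply]
  rw [jacobi_of_mem ha hb, jacobi_of_mem ha hc, koszul_zero_left, koszul_zero_left]
  simp only [one_smul]
  abel

theorem bracket_self_even {x : L} (hx : x ∈ part (L := L) 0) : bracket x x = 0 := by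
  have h := skew_of_even hx x
  rw [← sub_eq_zero, sub_neg_eq_add, ← two_smul ℂ] at h
  exact (smul_eq_zero.1 h).resolve_left two_ne_zero

/-- The Jacobi identity with a repeated odd argument. Through it the even vector `[e_i, e_i]`
inherits local nilpotence from `e_i`. -/
theorem bracket_bracket_odd {x : L} (hx : x ∈ part (L := L) 1) (z : L) :
    bracket (bracket x x) z = (2 : ℂ) • bracket x (bracket x z) := by
  have h := jacobi_of_mem hx hx z
  have hk : koszul 1 1 = -1 := by simp [koszul]
  rw [hk, neg_one_smul] at h
  rw [two_smul]
  exact (eq_add_neg_iff_add_eq.1 h).symm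

theorem bracket_self_mem {s : ZMod 2} {x : L} (hx : x ∈ part (L := L) s) :
    bracket x x ∈ part (L := L) 0 := by
  have h := bracket_mem hx hx
  rwa [CharTwo.add_self_eq_zero] at h

theorem bracket_self_self {s : ZMod 2} {x : L} (hx : x ∈ part (L := L) s) :
    bracket x (bracket x x) = 0 := by
  rcases parity_cases s with rfl | rfl
  · rw [bracket_self_even hx, map_zero]
  · have h1 := bracket_bracket_odd hx x
    have h2 := skew_of_even (bracket_self_mem hx) x
    rw [h1] at h2
    -- For odd `x`, Jacobi gives `[[x,x],x] = 2 [x,[x,x]]`, and skew-symmetry gives `[[x,x],x] =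
    -- -[x,[x,x]]`.
    have h3 : (3 : ℂ) • bracket x (bracket x x) = 0 := by
      have : (3 : ℂ) • bracket x (bracket x x)
        = (2 : ℂ) • bracket x (bracket x x) + bracket x (bracket x x) := by module
      rw [this, h2, neg_add_cancel]
    exact (smul_eq_zero.1 h3).resolve_left (by norm_num)

end Basic

/-! ### Weight spaces -/

section Weights

variable {L : Type v} [AddCommGroup L] [Module ℂ L] {h : Type u} [AddCommGroup h] [Module ℂ h]

/-- The weight space for the weight `α` of the action of `h` through `H`. -/
def wtSpace [SuperAlg L] (H : h →ₗ[ℂ] L) (α : Module.Dual ℂ h) : Submodule ℂ L where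
  carrier := {x | ∀ t : h, bracket (H t) x = α t • x}
  add_mem' {x y} hx hy t := by rw [map_add, hx t, hy t, smul_add]
  zero_mem' t := by simp
  smul_mem' c x hx t := by rw [map_smul, hx t, smul_comm]

/-- The components of an element of an `h`-stable subspace lie in this subspace. -/
theorem mem_of_sum_mem [SuperAlg L] {H : h →ₗ[ℂ] L} {I : Submodule ℂ L}
    (hI : ∀ t, ∀ x ∈ I, bracket (H t) x ∈ I) (s : Finset (Module.Dual ℂ h)) :
    ∀ x : Module.Dual ℂ h → L, (∀ α ∈ s, x α ∈ wtSpace H α) → ∑ α ∈ s, x α ∈ I →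
      ∀ α ∈ s, x α ∈ I := by
  classical
  induction s using Finset.induction_on with
  | empty => simp
  | insert α' s hα' ih =>
    intro x hx hs
    have key : ∀ α ∈ s, x α ∈ I := by
      intro α hα
      have hne : α ≠ α' := fun hh => hα' (hh ▸ hα)
      obtain ⟨t, ht⟩ : ∃ t, α t ≠ α' t := by
        by_contra! hcon
        exact hne (LinearMap.ext hcon)
      -- The operator `ad (H t) - α' t` removes the component of weight `α'` and multiplies the one
      -- of weight `γ` by `γ t - α' t`, so the induction hypothesis applies to what remains.
      have h1 := ih (fun γ => (γ t - α' t) • x γ)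
        (fun γ hγ => Submodule.smul_mem _ _ (hx γ (Finset.mem_insert_of_mem hγ))) (by
          have h2 := sub_mem (hI t _ hs) (I.smul_mem (α' t) hs)
          rw [Finset.sum_insert hα', map_add, smul_add, map_sum, Finset.smul_sum,
            hx α' (Finset.mem_insert_self _ _) t, add_sub_add_left_eq_sub,
            ← Finset.sum_sub_distrib] at h2
          convert h2 using 2 with γ hγ
          rw [hx γ (Finset.mem_insert_of_mem hγ) t, sub_smul]) α hα
      exact (Submodule.smul_mem_iff _ (sub_ne_zero.2 ht)).1 h1
    intro α hα
    rcases Finset.mem_insert.1 hα with rfl | hα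
    · rw [Finset.sum_insert hα'] at hs
      exact (Submodule.add_mem_iff_left _ (Submodule.sum_mem _ key)).1 hs
    · exact key α hα

/-- Components of different weights are independent, so once subspaces of the weight spaces span
everything, no weight space can be larger than its given subspace. -/
theorem wtSpace_eq_of_iSup_eq_top [SuperAlg L] {H : h →ₗ[ℂ] L} (A : Module.Dual ℂ h → Submodule ℂ L)
    (hA : ∀ α, A α ≤ wtSpace H α) (htop : ⨆ α, A α = ⊤) (α : Module.Dual ℂ h) :
    wtSpace H α = A α := by
  classical
  refine le_antisymm (fun x hx => ?_) (hA α)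
  obtain ⟨f, hf, hfx⟩ := (Submodule.mem_iSup_iff_exists_finsupp A x).1
    (htop ▸ Submodule.mem_top)
  have h1 := mem_of_sum_mem (H := H) (I := ⊥) (by simp) (insert α f.support)
    (fun γ => f γ - if γ = α then x else 0) (fun γ _ => by
      refine sub_mem (hA γ (hf γ)) ?_
      split_ifs with hγ
      · exact hγ ▸ hx
      · exact zero_mem _) (by
      rw [Finset.sum_sub_distrib, Finset.sum_ite_eq', if_pos (Finset.mem_insert_self _ _),
        Finset.sum_subset (Finset.subset_insert α f.support) (by
          intro γ _ hγ; simpa using hγ) |>.symm, Submodule.mem_bot, sub_eq_zero]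
      exact hfx) α (Finset.mem_insert_self _ _)
  simp only [if_true, Submodule.mem_bot, sub_eq_zero] at h1
  exact h1 ▸ hf α

theorem bracket_mem_wtSpace [LieSuperalgebra L] {H : h →ₗ[ℂ] L} (hH : ∀ t, H t ∈ part (L := L) 0)
    {α γ : Module.Dual ℂ h} {x y : L} (hx : x ∈ wtSpace H α) (hy : y ∈ wtSpace H γ) :
    bracket x y ∈ wtSpace H (α + γ) := by
  intro t
  rw [bracket_derivation (hH t), hx t, hy t, map_smul, map_smul, LinearMap.smul_apply,
    ← add_smul]
  rfl

end Weights

/-! ### Triangular decomposition -/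

/-- Chevalley generators of a Lie superalgebra with respect to a space `h` of even commuting
elements. -/
structure ChevalleySystem {n : ℕ} {h : Type u} [AddCommGroup h] [Module ℂ h] {L : Type v}
    [AddCommGroup L] [Module ℂ L] [LieSuperalgebra L] (H : h →ₗ[ℂ] L)
    (β : Fin n → Module.Dual ℂ h) where
  e : Fin n → L
  f : Fin n → L
  coroot : Fin n → h
  parity : Fin n → ZMod 2
  H_even : ∀ t, H t ∈ part (L := L) 0
  H_comm : ∀ s t, bracket (H s) (H t) = 0
  e_mem : ∀ i, e i ∈ wtSpace H (β i)
  f_mem : ∀ i, f i ∈ wtSpace H (-β i)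
  e_parity : ∀ i, e i ∈ part (L := L) (parity i)
  f_parity : ∀ i, f i ∈ part (L := L) (parity i)
  bracket_ne : ∀ i j, i ≠ j → bracket (e i) (f j) = 0
  bracket_self : ∀ i, bracket (e i) (f i) = H (coroot i)
  generate : ∀ S : Submodule ℂ L, (∀ x ∈ S, ∀ y ∈ S, bracket x y ∈ S) →
    (∀ t, H t ∈ S) → (∀ i, e i ∈ S) → (∀ i, f i ∈ S) → S = ⊤

namespace ChevalleySystem

variable {n : ℕ} {h : Type u} [AddCommGroup h] [Module ℂ h] {L : Type v}
  [AddCommGroup L] [Module ℂ L] [LieSuperalgebra L] {H : h →ₗ[ℂ] L}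
  {β : Fin n → Module.Dual ℂ h} (C : ChevalleySystem H β)

/-- The coefficient of the coroot in `[f i, e i]`. -/
def oppSign (i : Fin n) : ℂ := -koszul (C.parity i) (C.parity i)

theorem oppSign_ne_zero (i : Fin n) : C.oppSign i ≠ 0 := neg_ne_zero.2 (koszul_ne_zero _ _)

theorem bracket_f_e (i : Fin n) : bracket (C.f i) (C.e i) = H (C.oppSign i • C.coroot i) := by
  rw [LieSuperalgebra.skew (C.f_parity i) (C.e_parity i), C.bracket_self, map_smul, oppSign,
    neg_smul]

theorem bracket_f_e_ne (i j : Fin n) (hij : i ≠ j) : bracket (C.f i) (C.e j) = 0 := by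
  rw [LieSuperalgebra.skew (C.f_parity i) (C.e_parity j), C.bracket_ne _ _ hij.symm, smul_zero,
    neg_zero]

/-- Exchange of the positive and the negative generators. -/
def swap : ChevalleySystem H (-β) where
  e := C.f
  f := C.e
  coroot i := C.oppSign i • C.coroot i
  parity := C.parity
  H_even := C.H_even
  H_comm := C.H_comm
  e_mem := C.f_mem
  f_mem i := by simpa using C.e_mem i
  e_parity := C.f_parity
  f_parity := C.e_parity
  bracket_ne := C.bracket_f_e_ne
  bracket_self := C.bracket_f_e
  generate S h1 h2 h3 h4 := C.generate S h1 h2 h4 h3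

theorem bracket_e_H (i : Fin n) (t : h) : bracket (C.e i) (H t) = -(β i t) • C.e i := by
  rw [LieSuperalgebra.skew (C.e_parity i) (C.H_even t), koszul_zero_right, one_smul,
    C.e_mem i t, neg_smul]

/-- The generators are homogeneous, so `generate` may be applied to the sum of the homogeneous parts
of `Z`. This matters because the Jacobi identity is an axiom for homogeneous elements only. -/
theorem eq_top_of_closed (Z : Submodule ℂ L)
    (hZ : ∀ {s t : ZMod 2} {x y : L}, x ∈ part (L := L) s → y ∈ part (L := L) t → x ∈ Z → y ∈ Z →
      bracket x y ∈ Z)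
    (hH : ∀ t, H t ∈ Z) (he : ∀ i, C.e i ∈ Z) (hf : ∀ i, C.f i ∈ Z) : Z = ⊤ := by
  have hle : ∀ s, Z ⊓ part (L := L) s ≤ (Z ⊓ part (L := L) 0) ⊔ (Z ⊓ part (L := L) 1) := by
    intro s
    rcases parity_cases s with rfl | rfl
    · exact le_sup_left
    · exact le_sup_right
  have h1 : (Z ⊓ part (L := L) 0) ⊔ (Z ⊓ part (L := L) 1) = ⊤ := by
    refine C.generate _ ?_ (fun t => hle 0 ⟨hH t, C.H_even t⟩) (fun i => hle _ ⟨he i, C.e_parity i⟩)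
      (fun i => hle _ ⟨hf i, C.f_parity i⟩)
    intro x hx y hy
    obtain ⟨a, ha, b, hb, rfl⟩ := Submodule.mem_sup.1 hx
    obtain ⟨c, hc, d, hd, rfl⟩ := Submodule.mem_sup.1 hy
    have key : ∀ {s t : ZMod 2} {x y : L}, x ∈ Z ⊓ part (L := L) s → y ∈ Z ⊓ part (L := L) t →
        bracket x y ∈ (Z ⊓ part (L := L) 0) ⊔ (Z ⊓ part (L := L) 1) :=
      fun hx hy => hle _ ⟨hZ hx.2 hy.2 hx.1 hy.1, bracket_mem hx.2 hy.2⟩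
    simp only [map_add, LinearMap.add_apply]
    exact add_mem (add_mem (key ha hc) (key hb hc)) (add_mem (key ha hd) (key hb hd))
  rw [eq_top_iff, ← h1]
  exact sup_le inf_le_left inf_le_left

/-- By the Jacobi identity and `P ≤ S`, the elements that bracket `S` into `P` are closed under
homogeneous brackets, so generators suffice. -/
theorem bracket_mem_of_generators {S P : Submodule ℂ L} (hPS : P ≤ S)
    (hH : ∀ t, ∀ x ∈ S, bracket (H t) x ∈ P) (he : ∀ i, ∀ x ∈ S, bracket (C.e i) x ∈ P)
    (hf : ∀ i, ∀ x ∈ S, bracket (C.f i) x ∈ P) (z : L) {x : L} (hx : x ∈ S) :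
    bracket z x ∈ P := by
  let Z : Submodule ℂ L :=
    { carrier := {z | ∀ x ∈ S, bracket z x ∈ P}
      add_mem' := fun ha hb x hx => by
        rw [map_add]; exact add_mem (ha x hx) (hb x hx)
      zero_mem' := fun x _ => by simp
      smul_mem' := fun c a ha x hx => by
        rw [map_smul]; exact P.smul_mem c (ha x hx) }
  have hZ : Z = ⊤ := by
    refine C.eq_top_of_closed Z (fun {s t a b} ha hb haZ hbZ x hx => ?_) hH he hf
    have h1 := jacobi_of_mem ha hb x
    rw [← sub_eq_iff_eq_add] at h1
    rw [← h1]
    exact sub_mem (haZ _ (hPS (hbZ x hx))) (P.smul_mem _ (hbZ _ (hPS (haZ x hx))))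
  exact (hZ ▸ Submodule.mem_top : z ∈ Z) x hx

/-- Iterated brackets of the positive generators. -/
def mono : List (Fin n) → L
  | [] => 0
  | [j] => C.e j
  | i :: j :: l => bracket (C.e i) (mono (j :: l))

/-- The weight of an iterated bracket. -/
def listWt (β : Fin n → Module.Dual ℂ h) (l : List (Fin n)) : Module.Dual ℂ h := (l.map β).sum

theorem bracket_e_mono (i : Fin n) (l : List (Fin n)) :
    bracket (C.e i) (C.mono l) ∈ Submodule.span ℂ (Set.range C.mono) := by
  cases l with
  | nil => simp [mono]
  | cons j l => exact Submodule.subset_span ⟨i :: j :: l, rfl⟩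

theorem mono_mem (l : List (Fin n)) : C.mono l ∈ wtSpace H (listWt β l) := by
  induction l with
  | nil => exact zero_mem _
  | cons i l ih =>
    cases l with
    | nil => simpa [mono, listWt] using C.e_mem i
    | cons j l =>
      have := bracket_mem_wtSpace C.H_even (C.e_mem i) ih
      simpa [mono, listWt] using this

/-- The subalgebra generated by the positive generators. -/
def nPos : Submodule ℂ L := Submodule.span ℂ (Set.range C.mono)

/-- A double swap is a system over `-(-β)` with rescaled coroots, but its positive generators are
the old ones. -/
theorem mono_swap_swap (l : List (Fin n)) : C.swap.swap.mono l = C.mono l := by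
  induction l with
  | nil => rfl
  | cons i l ih =>
    cases l with
    | nil => rfl
    | cons j l =>
      change bracket (C.e i) (C.swap.swap.mono (j :: l)) = _
      rw [ih]
      rfl

theorem nPos_swap_swap : C.swap.swap.nPos = C.nPos := by
  rw [nPos, nPos, funext C.mono_swap_swap]

/-- The image of the span of the coroots. -/
def corootSpan : Submodule ℂ L := (Submodule.span ℂ (Set.range C.coroot)).map H

theorem e_mem_nPos (i : Fin n) : C.e i ∈ C.nPos := Submodule.subset_span ⟨[i], rfl⟩

theorem bracket_e_nPos (i : Fin n) {x : L} (hx : x ∈ C.nPos) : bracket (C.e i) x ∈ C.nPos := by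
  have : C.nPos ≤ C.nPos.comap (bracket (C.e i)) := by
    rw [nPos, Submodule.span_le]
    rintro _ ⟨l, rfl⟩
    exact C.bracket_e_mono i l
  exact this hx

theorem bracket_H_nPos (t : h) {x : L} (hx : x ∈ C.nPos) : bracket (H t) x ∈ C.nPos := by
  have : C.nPos ≤ C.nPos.comap (bracket (H t)) := by
    rw [nPos, Submodule.span_le]
    rintro _ ⟨l, rfl⟩
    change bracket (H t) (C.mono l) ∈ Submodule.span ℂ (Set.range C.mono)
    rw [C.mono_mem l t]
    exact Submodule.smul_mem _ _ (Submodule.subset_span ⟨l, rfl⟩)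
  exact this hx

theorem bracket_e_range (i : Fin n) (t : h) : bracket (C.e i) (H t) ∈ C.nPos := by
  rw [C.bracket_e_H]
  exact Submodule.smul_mem _ _ (C.e_mem_nPos i)

theorem corootSpan_le : C.corootSpan ≤ LinearMap.range H := LinearMap.map_le_range

theorem H_coroot_mem (i : Fin n) : H (C.coroot i) ∈ C.corootSpan :=
  Submodule.mem_map_of_mem (Submodule.subset_span ⟨i, rfl⟩)

/-- Move `f i` through the word by the Jacobi identity. A Cartan element arises only where it meets
`e i`, and it survives only for a word of length one; in a longer word it is absorbed by the
remaining letters. -/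
theorem bracket_f_nPos (i : Fin n) {x : L} (hx : x ∈ C.nPos) :
    bracket (C.f i) x ∈ C.nPos ⊔ C.corootSpan := by
  have hmono : ∀ l, bracket (C.f i) (C.mono l) ∈ C.nPos ⊔ C.corootSpan := by
    intro l
    induction l with
    | nil => simp [mono]
    | cons j l ih =>
      cases l with
      | nil =>
        change bracket (C.f i) (C.e j) ∈ _
        by_cases hij : i = j
        · subst hij
          rw [C.bracket_f_e, map_smul]
          exact Submodule.mem_sup_right (Submodule.smul_mem _ _ (C.H_coroot_mem i))
        · rw [C.bracket_f_e_ne i j hij]; exact zero_mem _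
      | cons k l =>
        change bracket (C.f i) (bracket (C.e j) (C.mono (k :: l))) ∈ _
        rw [jacobi_of_mem (C.f_parity i) (C.e_parity j)]
        refine Submodule.mem_sup_left (add_mem ?_ (Submodule.smul_mem _ _ ?_))
        · by_cases hij : i = j
          · subst hij
            rw [C.bracket_f_e]
            exact C.bracket_H_nPos _ (Submodule.subset_span ⟨_, rfl⟩)
          · rw [C.bracket_f_e_ne i j hij, map_zero]; exact zero_mem _
        · obtain ⟨a, ha, b, hb, hab⟩ := Submodule.mem_sup.1 ih
          rw [← hab, map_add]
          obtain ⟨t, rfl⟩ := C.corootSpan_le hb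
          exact add_mem (C.bracket_e_nPos j ha) (C.bracket_e_range j t)
  have : C.nPos ≤ (C.nPos ⊔ C.corootSpan).comap (bracket (C.f i)) := by
    rw [nPos, Submodule.span_le]
    rintro _ ⟨l, rfl⟩
    exact hmono l
  exact this hx

theorem corootSpan_swap_le : C.swap.corootSpan ≤ C.corootSpan := by
  refine Submodule.map_mono (Submodule.span_le.2 ?_)
  rintro _ ⟨i, rfl⟩
  exact Submodule.smul_mem _ _ (Submodule.subset_span ⟨i, rfl⟩)

theorem corootSpan_swap : C.swap.corootSpan = C.corootSpan := by
  refine le_antisymm C.corootSpan_swap_le ?_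
  refine Submodule.map_mono (Submodule.span_le.2 ?_)
  rintro _ ⟨i, rfl⟩
  have : C.oppSign i • C.coroot i ∈ Submodule.span ℂ (Set.range C.swap.coroot) :=
    Submodule.subset_span ⟨i, rfl⟩
  exact (Submodule.smul_mem_iff _ (C.oppSign_ne_zero i)).1 this

theorem bracket_e_triangular (i : Fin n) {x : L}
    (hx : x ∈ C.nPos ⊔ LinearMap.range H ⊔ C.swap.nPos) :
    bracket (C.e i) x ∈ C.nPos ⊔ C.corootSpan ⊔ C.swap.nPos := by
  obtain ⟨y, hy, c, hc, rfl⟩ := Submodule.mem_sup.1 hx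
  obtain ⟨a, ha, _, ⟨t, rfl⟩, rfl⟩ := Submodule.mem_sup.1 hy
  simp only [map_add]
  refine add_mem (Submodule.mem_sup_left (Submodule.mem_sup_left (add_mem
    (C.bracket_e_nPos i ha) (C.bracket_e_range i t)))) ?_
  have := C.swap.bracket_f_nPos i hc
  rw [corootSpan_swap] at this
  exact (sup_le le_sup_right (le_sup_right.trans le_sup_left) :
    C.swap.nPos ⊔ C.corootSpan ≤ C.nPos ⊔ C.corootSpan ⊔ C.swap.nPos) this

/-- The target contains only the span of the coroots, not all of `h`: elements of `h` commute with
each other and act diagonally, so the Cartan part of a bracket can only come from the `[e i, f i]`.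
-/
theorem bracket_mem_triangular (z : L) {x : L}
    (hx : x ∈ C.nPos ⊔ LinearMap.range H ⊔ C.swap.nPos) :
    bracket z x ∈ C.nPos ⊔ C.corootSpan ⊔ C.swap.nPos := by
  refine C.bracket_mem_of_generators (sup_le_sup_right (sup_le_sup_left C.corootSpan_le _) _)
    ?_ (fun i x hx => C.bracket_e_triangular i hx) ?_ z hx
  · intro t x hx
    obtain ⟨y, hy, c, hc, rfl⟩ := Submodule.mem_sup.1 hx
    obtain ⟨a, ha, _, ⟨s, rfl⟩, rfl⟩ := Submodule.mem_sup.1 hy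
    simp only [map_add, C.H_comm, add_zero]
    exact add_mem (Submodule.mem_sup_left (Submodule.mem_sup_left (C.bracket_H_nPos t ha)))
      (Submodule.mem_sup_right (C.swap.bracket_H_nPos t hc))
  · intro i x hx
    -- The case of `f i` is the case of `e i` for the swapped system.
    have h1 : x ∈ C.swap.nPos ⊔ LinearMap.range H ⊔ C.nPos := by
      rwa [sup_assoc, sup_comm, sup_comm (LinearMap.range H)] at hx
    rw [← C.nPos_swap_swap] at h1
    have h2 := C.swap.bracket_e_triangular i h1
    rwa [nPos_swap_swap, corootSpan_swap, sup_assoc, sup_comm, sup_comm C.corootSpan] at h2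

theorem triangular : C.nPos ⊔ LinearMap.range H ⊔ C.swap.nPos = ⊤ := by
  refine C.generate _ (fun x _ y hy => ?_) (fun t => ?_) (fun i => ?_) (fun i => ?_)
  · exact sup_le_sup_right (sup_le_sup_left C.corootSpan_le _) _ (C.bracket_mem_triangular x hy)
  · exact Submodule.mem_sup_left (Submodule.mem_sup_right ⟨t, rfl⟩)
  · exact Submodule.mem_sup_left (Submodule.mem_sup_left (C.e_mem_nPos i))
  · exact Submodule.mem_sup_right (C.swap.e_mem_nPos i)

theorem bracket_mem_derived (x y : L) :
    bracket x y ∈ C.nPos ⊔ C.corootSpan ⊔ C.swap.nPos :=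
  C.bracket_mem_triangular x (C.triangular ▸ Submodule.mem_top)

end ChevalleySystem

namespace ChevalleySystem

/-! ### The weight spaces of a Lie superalgebra with Chevalley generators -/

section ListWeights

variable {n : ℕ} {h : Type u} [AddCommGroup h] [Module ℂ h] {β : Fin n → Module.Dual ℂ h}

theorem listWt_eq_sum (l : List (Fin n)) : listWt β l = ∑ j, (l.count j : ℂ) • β j := by
  induction l with
  | nil => simp [listWt]
  | cons i l ih =>
    have : listWt β (i :: l) = β i + listWt β l := by simp [listWt]
    rw [this, ih]
    simp only [List.count_cons, Nat.cast_add, add_smul, Finset.sum_add_distrib]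
    rw [add_comm]
    congr 1
    simp

theorem listWt_append (l l' : List (Fin n)) :
    listWt β (l ++ l') = listWt β l + listWt β l' := by
  simp [listWt]

theorem listWt_neg (l : List (Fin n)) : listWt (-β) l = -listWt β l := by
  simp [listWt_eq_sum]

theorem listWt_singleton (i : Fin n) : listWt β [i] = β i := by simp [listWt]

theorem listWt_pair (i : Fin n) : listWt β [i, i] = (2 : ℂ) • β i := by
  simp [listWt, two_smul]

variable (hβ : LinearIndependent ℂ β)
include hβ

/-- By independence of the simple roots, the multiplicity of each letter can be read off from the
weight. -/
theorem perm_of_listWt_eq {l l' : List (Fin n)} (hl : listWt β l = listWt β l') : l.Perm l' := by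
  rw [listWt_eq_sum, listWt_eq_sum, ← sub_eq_zero, ← Finset.sum_sub_distrib] at hl
  simp only [← sub_smul] at hl
  rw [List.perm_iff_count]
  intro i
  have := Fintype.linearIndependent_iff.1 hβ _ hl i
  exact_mod_cast sub_eq_zero.1 this

theorem eq_nil_of_listWt_add_eq_zero {l l' : List (Fin n)} (hl : listWt β l + listWt β l' = 0) :
    l = [] ∧ l' = [] := by
  rw [← listWt_append] at hl
  have := perm_of_listWt_eq (β := β) hβ (l' := []) (by rw [hl]; simp [listWt])
  simpa using this

end ListWeights

variable {n : ℕ} {h : Type u} [AddCommGroup h] [Module ℂ h] {L : Type v}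
  [AddCommGroup L] [Module ℂ L] [LieSuperalgebra L] {H : h →ₗ[ℂ] L}
  {β : Fin n → Module.Dual ℂ h} (C : ChevalleySystem H β)

/-- The span of the iterated brackets of weight `α`. -/
def posPiece (α : Module.Dual ℂ h) : Submodule ℂ L :=
  Submodule.span ℂ {x | ∃ l, l ≠ [] ∧ listWt β l = α ∧ x = C.mono l}

/-- The elements of weight `α` that are visible in the triangular decomposition. -/
def piece (α : Module.Dual ℂ h) : Submodule ℂ L :=
  C.posPiece α ⊔ C.swap.posPiece α ⊔ ⨆ _ : α = 0, LinearMap.range H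

theorem posPiece_le (α : Module.Dual ℂ h) : C.posPiece α ≤ wtSpace H α := by
  rw [posPiece, Submodule.span_le]
  rintro _ ⟨l, -, rfl, rfl⟩
  exact C.mono_mem l

theorem range_le_wtSpace_zero (C : ChevalleySystem H β) : LinearMap.range H ≤ wtSpace H 0 := by
  rintro _ ⟨t, rfl⟩ s
  rw [C.H_comm]
  simp

theorem wtSpace_eq_piece (α : Module.Dual ℂ h) : wtSpace H α = C.piece α := by
  refine wtSpace_eq_of_iSup_eq_top C.piece (fun α => ?_) ?_ α
  · refine sup_le (sup_le (C.posPiece_le α) (C.swap.posPiece_le α)) (iSup_le ?_)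
    rintro rfl
    exact C.range_le_wtSpace_zero
  · rw [eq_top_iff, ← C.triangular]
    refine sup_le (sup_le ?_ ?_) ?_
    · rw [nPos, Submodule.span_le]
      rintro _ ⟨l, rfl⟩
      rcases eq_or_ne l [] with rfl | hl
      · exact zero_mem _
      · exact (le_iSup C.piece (listWt β l)) (Submodule.mem_sup_left (Submodule.mem_sup_left
          (Submodule.subset_span ⟨l, hl, rfl, rfl⟩)))
    · refine le_trans ?_ (le_iSup C.piece 0)
      rw [piece, iSup_pos rfl]
      exact le_sup_right
    · rw [nPos, Submodule.span_le]
      rintro _ ⟨l, rfl⟩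
      rcases eq_or_ne l [] with rfl | hl
      · exact zero_mem _
      · exact (le_iSup C.piece (listWt (-β) l)) (Submodule.mem_sup_left (Submodule.mem_sup_right
          (Submodule.subset_span ⟨l, hl, rfl, rfl⟩)))

/-- This is the source of the sign of a root: by the triangular decomposition, weights come from
words in the `e i` alone, from words in the `f i` alone, or from `h`, which is the empty list. -/
theorem exists_list_of_ne_bot (C : ChevalleySystem H β) {α : Module.Dual ℂ h} (hα : wtSpace H α ≠ ⊥) :
    ∃ l, α = listWt β l ∨ α = -listWt β l := by
  by_contra! hcon
  apply hα
  rw [C.wtSpace_eq_piece, piece, eq_bot_iff]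
  refine sup_le (sup_le ?_ ?_) (iSup_le ?_)
  · rw [posPiece, Submodule.span_le]
    rintro _ ⟨l, -, h1, -⟩
    exact absurd h1.symm (hcon l).1
  · rw [posPiece, Submodule.span_le]
    rintro _ ⟨l, -, h1, -⟩
    rw [listWt_neg] at h1
    exact absurd h1.symm (hcon l).2
  · intro h1
    exact absurd h1 (by simpa [listWt] using (hcon []).1)

section Independent

variable (hβ : LinearIndependent ℂ β)
include hβ

theorem wtSpace_zero (C : ChevalleySystem H β) : wtSpace H 0 = LinearMap.range H := by
  have key : ∀ {l : List (Fin n)}, listWt β l = 0 → l = [] := fun {l} hl =>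
    (eq_nil_of_listWt_add_eq_zero hβ (l := l) (l' := []) (by rw [hl]; simp [listWt])).1
  rw [C.wtSpace_eq_piece, piece, iSup_pos rfl]
  refine le_antisymm (sup_le (sup_le ?_ ?_) le_rfl) le_sup_right
  · rw [posPiece, Submodule.span_le]
    rintro _ ⟨l, hl, h1, -⟩
    exact absurd (key h1) hl
  · rw [posPiece, Submodule.span_le]
    rintro _ ⟨l, hl, h1, -⟩
    rw [listWt_neg, neg_eq_zero] at h1
    exact absurd (key h1) hl

theorem wtSpace_listWt_le {l : List (Fin n)} (hl : l ≠ []) :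
    wtSpace H (listWt β l) ≤ Submodule.span ℂ {x | ∃ l', l'.Perm l ∧ x = C.mono l'} := by
  rw [C.wtSpace_eq_piece, piece]
  refine sup_le (sup_le ?_ ?_) (iSup_le fun h1 => ?_)
  · refine Submodule.span_mono ?_
    rintro _ ⟨l', -, h1, rfl⟩
    exact ⟨l', perm_of_listWt_eq hβ h1, rfl⟩
  · rw [posPiece, Submodule.span_le]
    rintro _ ⟨l', hl', h1, -⟩
    rw [listWt_neg, eq_comm, eq_neg_iff_add_eq_zero] at h1
    exact absurd (eq_nil_of_listWt_add_eq_zero hβ h1).2 hl'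
  · exact absurd (eq_nil_of_listWt_add_eq_zero hβ (l := l) (l' := [])
      (by rw [h1]; simp [listWt])).1 hl

theorem wtSpace_simple (i : Fin n) : wtSpace H (β i) = Submodule.span ℂ {C.e i} := by
  refine le_antisymm ?_ ?_
  · have := C.wtSpace_listWt_le hβ (l := [i]) (by simp)
    rw [listWt_singleton] at this
    refine this.trans (Submodule.span_mono ?_)
    rintro _ ⟨l', h1, rfl⟩
    rw [List.perm_singleton.1 h1]
    rfl
  · rw [Submodule.span_singleton_le_iff_mem]
    exact C.e_mem i

/-- The only word with this weight is `[i, i]`. The bound later determines the coroot of a doubled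
simple root. -/
theorem wtSpace_double_le (i : Fin n) :
    wtSpace H ((2 : ℂ) • β i) ≤ Submodule.span ℂ {bracket (C.e i) (C.e i)} := by
  have := C.wtSpace_listWt_le hβ (l := [i, i]) (by simp)
  rw [listWt_pair] at this
  refine this.trans (Submodule.span_mono ?_)
  rintro _ ⟨l', h1, rfl⟩
  have : l' = [i, i] := (List.perm_replicate (n := 2)).1 h1
  rw [this]
  rfl

theorem wtSpace_neg_simple (i : Fin n) : wtSpace H (-β i) = Submodule.span ℂ {C.f i} :=
  C.swap.wtSpace_simple (linearIndependent_neg_iff.2 hβ) i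

theorem wtSpace_neg_double_le (i : Fin n) :
    wtSpace H (-((2 : ℂ) • β i)) ≤ Submodule.span ℂ {bracket (C.f i) (C.f i)} := by
  rw [← smul_neg]
  exact C.swap.wtSpace_double_le (linearIndependent_neg_iff.2 hβ) i

theorem nPos_le : C.nPos ≤ ⨆ (α : Module.Dual ℂ h) (_ : α ≠ 0), wtSpace H α := by
  rw [nPos, Submodule.span_le]
  rintro _ ⟨l, rfl⟩
  rcases eq_or_ne l [] with rfl | hl
  · exact zero_mem _
  · refine Submodule.mem_iSup_of_mem (listWt β l) (Submodule.mem_iSup_of_mem (fun h1 => hl ?_)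
      (C.mono_mem l))
    exact (eq_nil_of_listWt_add_eq_zero hβ (l := l) (l' := []) (by rw [h1]; simp [listWt])).1

end Independent

theorem disjoint_wtSpace_zero (H : h →ₗ[ℂ] L) :
    Disjoint (⨆ (α : Module.Dual ℂ h) (_ : α ≠ 0), wtSpace H α) (wtSpace H 0) := by
  classical
  rw [Submodule.disjoint_def]
  intro x hx hx0
  obtain ⟨f, hf, hfx⟩ := (Submodule.mem_iSup_iff_exists_finsupp _ x).1 hx
  have hf' : ∀ α, f α ∈ wtSpace H α := fun α => (iSup_le fun _ => le_rfl :
    (⨆ (_ : α ≠ 0), wtSpace H α) ≤ wtSpace H α) (hf α)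
  have h0 : f 0 = 0 := by simpa using hf 0
  have h1 := mem_of_sum_mem (H := H) (I := ⊥) (by simp) (insert 0 f.support)
    (fun γ => f γ - if γ = 0 then x else 0) (fun γ _ => by
      refine sub_mem (hf' γ) ?_
      split_ifs with hγ
      · exact hγ ▸ hx0
      · exact zero_mem _) (by
      rw [Finset.sum_sub_distrib, Finset.sum_ite_eq', if_pos (Finset.mem_insert_self _ _),
        Finset.sum_subset (Finset.subset_insert 0 f.support) (by
          intro γ _ hγ; simpa using hγ) |>.symm, Submodule.mem_bot, sub_eq_zero]
      exact hfx) 0 (Finset.mem_insert_self _ _)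
  simpa [h0] using h1

theorem iSup_wtSpace (C : ChevalleySystem H β) : ⨆ α : Module.Dual ℂ h, wtSpace H α = ⊤ := by
  rw [eq_top_iff, ← C.triangular]
  have key : ∀ {γ : Fin n → Module.Dual ℂ h} (C' : ChevalleySystem H γ),
      C'.nPos ≤ ⨆ α : Module.Dual ℂ h, wtSpace H α := by
    intro γ C'
    rw [nPos, Submodule.span_le]
    rintro _ ⟨l, rfl⟩
    exact Submodule.mem_iSup_of_mem _ (C'.mono_mem l)
  exact sup_le (sup_le (key C) (C.range_le_wtSpace_zero.trans (le_iSup (wtSpace H) 0))) (key C.swap)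

section Independent

variable (hβ : LinearIndependent ℂ β)
include hβ

/-- An ideal is stable under `h`, so it contains the weight components of its elements. The
component of weight zero lies in the image of `h`, hence vanishes. -/
theorem le_iSup_of_inf_range_eq_bot (C : ChevalleySystem H β) {I : Submodule ℂ L} (hI : IsIdeal I)
    (hIH : I ⊓ LinearMap.range H = ⊥) :
    I ≤ ⨆ (α : Module.Dual ℂ h) (_ : α ≠ 0), wtSpace H α := by
  intro x hx
  obtain ⟨f, hf, rfl⟩ := (Submodule.mem_iSup_iff_exists_finsupp _ x).1
    (C.iSup_wtSpace ▸ Submodule.mem_top)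
  have h1 := mem_of_sum_mem (H := H) (fun t x hx => hI.left (H t) hx) f.support f
    (fun α _ => hf α) hx
  refine Submodule.sum_mem _ fun α hα => ?_
  by_cases h0 : α = 0
  · subst h0
    have h2 := hf 0
    rw [C.wtSpace_zero hβ] at h2
    have h3 : f 0 ∈ I ⊓ LinearMap.range H := ⟨h1 0 hα, h2⟩
    rw [hIH, Submodule.mem_bot] at h3
    rw [h3]
    exact zero_mem _
  · exact Submodule.mem_iSup_of_mem α (Submodule.mem_iSup_of_mem h0 (hf α))

/-- All these ideals lie in the sum of the nonzero weight spaces, which meets the weight space of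
zero trivially; so their sum still misses `h`. -/
theorem sSup_inf_range (C : ChevalleySystem H β) :
    sSup {I | IsIdeal I ∧ I ⊓ LinearMap.range H = ⊥} ⊓ LinearMap.range H = ⊥ := by
  rw [← disjoint_iff]
  refine (disjoint_wtSpace_zero H).mono (sSup_le fun I hI => ?_) C.range_le_wtSpace_zero
  exact C.le_iSup_of_inf_range_eq_bot hβ hI.1 hI.2

/-- Compare the components of weight zero in the description of brackets. The span of the coroots is
thereby tied to the derived algebra and does not depend on the base. -/
theorem mem_span_coroot (C : ChevalleySystem H β) (hH : Function.Injective H) {x y : L} {t : h} (hxy : bracket x y = H t) :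
    t ∈ Submodule.span ℂ (Set.range C.coroot) := by
  have h1 := C.bracket_mem_derived x y
  obtain ⟨a, ha, b, hb, hab⟩ := Submodule.mem_sup.1 h1
  obtain ⟨c, hc, _, ⟨s, hs, rfl⟩, rfl⟩ := Submodule.mem_sup.1 ha
  have h2 : H (t - s) = c + b := by rw [map_sub, ← hxy, ← hab]; abel
  have h3 : H (t - s) ∈ ⨆ (α : Module.Dual ℂ h) (_ : α ≠ 0), wtSpace H α := by
    rw [h2]
    exact add_mem (C.nPos_le hβ hc) (C.swap.nPos_le (linearIndependent_neg_iff.2 hβ) hb)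
  have h4 := Submodule.disjoint_def.1 (disjoint_wtSpace_zero H) _ h3
    (C.range_le_wtSpace_zero ⟨_, rfl⟩)
  rw [(map_eq_zero_iff H hH), sub_eq_zero] at h4
  rw [h4]
  exact hs

/-- If no ideal meets the Cartan subalgebra trivially, an element of positive weight that is
annihilated by all negative generators vanishes. -/
theorem eq_zero_of_bracket_f_eq_zero
    (hrad : ∀ I : Submodule ℂ L, IsIdeal I → I ⊓ LinearMap.range H = ⊥ → I = ⊥)
    {l : List (Fin n)} (hl : l ≠ []) {x : L} (hx : x ∈ wtSpace H (listWt β l)) {s : ZMod 2}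
    (hs : x ∈ part (L := L) s) (hfx : ∀ k, bracket (C.f k) x = 0) : x = 0 := by
  -- The ideal generated by `x` is spanned by words in the `e i` applied to `x`: each `f k` moves
  -- through such a word and dies on `x`. All weights that occur are nonempty sums of simple roots,
  -- so this ideal misses `h`.
  let word : List (Fin n) → L := fun w => w.foldr (fun i z => bracket (C.e i) z) x
  have hword : ∀ i w, bracket (C.e i) (word w) = word (i :: w) := fun _ _ => rfl
  have hwt : ∀ w, word w ∈ wtSpace H (listWt β (w ++ l)) := by
    intro w
    induction w with
    | nil => exact hx
    | cons i w ih =>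
      have := bracket_mem_wtSpace C.H_even (C.e_mem i) ih
      rw [hword] at this
      simpa [listWt] using this
  have hpar : ∀ w, ∃ s, word w ∈ part (L := L) s := by
    intro w
    induction w with
    | nil => exact ⟨s, hs⟩
    | cons i w ih =>
      obtain ⟨t, ht⟩ := ih
      exact ⟨_, bracket_mem (C.e_parity i) ht⟩
  let J : Submodule ℂ L := Submodule.span ℂ (Set.range word)
  have hgen : ∀ (z : L), (∀ w, bracket z (word w) ∈ J) → ∀ y ∈ J, bracket z y ∈ J := by
    intro z hz y hy
    have : J ≤ J.comap (bracket z) := by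
      refine Submodule.span_le.2 ?_
      rintro _ ⟨w, rfl⟩
      exact hz w
    exact this hy
  have hJH : ∀ t w, bracket (H t) (word w) ∈ J := fun t w => by
    rw [hwt w t]; exact J.smul_mem _ (Submodule.subset_span ⟨w, rfl⟩)
  have hJe : ∀ i w, bracket (C.e i) (word w) ∈ J := fun i w =>
    Submodule.subset_span ⟨i :: w, rfl⟩
  have hJf : ∀ k w, bracket (C.f k) (word w) ∈ J := by
    intro k w
    induction w with
    | nil => change bracket (C.f k) x ∈ J; rw [hfx]; exact zero_mem _
    | cons i w ih =>
      rw [← hword, jacobi_of_mem (C.f_parity k) (C.e_parity i)]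
      refine add_mem ?_ (J.smul_mem _ (hgen _ (hJe i) _ ih))
      by_cases hki : k = i
      · subst hki; rw [C.bracket_f_e]; exact hJH _ _
      · rw [C.bracket_f_e_ne k i hki, map_zero]; exact zero_mem _
  have hleft : ∀ (z : L) {y : L}, y ∈ J → bracket z y ∈ J := fun z y hy =>
    C.bracket_mem_of_generators le_rfl (fun t => hgen _ (hJH t)) (fun i => hgen _ (hJe i))
      (fun k => hgen _ (hJf k)) z hy
  have hJ : IsIdeal J := by
    refine ⟨hleft, fun {y} z hy => ?_, fun {y} hy => ?_⟩
    · have : J ≤ J.comap ((bracket (L := L)).flip z) := by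
        refine Submodule.span_le.2 ?_
        rintro _ ⟨w, rfl⟩
        obtain ⟨t, ht⟩ := hpar w
        obtain ⟨a, ha, b, hb, rfl⟩ := exists_part_add z
        change bracket (word w) (a + b) ∈ J
        have hw : word w ∈ J := Submodule.subset_span ⟨w, rfl⟩
        rw [map_add, LieSuperalgebra.skew ht ha, LieSuperalgebra.skew ht hb]
        exact add_mem (neg_mem (J.smul_mem _ (hleft a hw))) (neg_mem (J.smul_mem _ (hleft b hw)))
      exact this hy
    · have : J ≤ (J ⊓ part 0) ⊔ (J ⊓ part 1) := by
        refine Submodule.span_le.2 ?_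
        rintro _ ⟨w, rfl⟩
        have hw : word w ∈ J := Submodule.subset_span ⟨w, rfl⟩
        obtain ⟨t, ht⟩ := hpar w
        rcases parity_cases t with rfl | rfl
        · exact Submodule.mem_sup_left ⟨hw, ht⟩
        · exact Submodule.mem_sup_right ⟨hw, ht⟩
      obtain ⟨a, ha, b, hb, hab⟩ := Submodule.mem_sup.1 (this hy)
      exact ⟨a, ha.1, b, hb.1, ha.2, hb.2, hab.symm⟩
  have hJ0 : J ⊓ LinearMap.range H = ⊥ := by
    rw [← disjoint_iff]
    refine (disjoint_wtSpace_zero H).mono (Submodule.span_le.2 ?_) C.range_le_wtSpace_zero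
    rintro _ ⟨w, rfl⟩
    refine Submodule.mem_iSup_of_mem _ (Submodule.mem_iSup_of_mem (fun h1 => hl ?_) (hwt w))
    have := (eq_nil_of_listWt_add_eq_zero hβ (l := w ++ l) (l' := [])
      (by rw [h1]; simp [listWt])).1
    exact (List.append_eq_nil_iff.1 this).2
  have hxJ : x ∈ J := Submodule.subset_span ⟨[], rfl⟩
  rw [hrad J hJ hJ0] at hxJ
  exact hxJ

end Independent
end ChevalleySystem

/-! ### The supercommutator of an algebra with an inner involution -/

section SuperCommutator

variable {A : Type v} [Ring A]

theorem conj_mul {P : A} (hP : P * P = 1) (a b : A) :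
    P * (a * b) * P = (P * a * P) * (P * b * P) := by
  have : (P * a * P) * (P * b * P) = P * a * (P * P) * b * P := by noncomm_ring
  rw [this, hP]
  noncomm_ring

variable [Algebra ℂ A]

/-- The supercommutator for the grading by the conjugation with `P`. -/
def superMul (P a b : A) : A :=
  a * b - b * a + (1 / 2 : ℂ) • ((b - P * b * P) * (a - P * a * P))

theorem superMul_add_left (P a b c : A) :
    superMul P (a + b) c = superMul P a c + superMul P b c := by
  simp only [superMul, mul_add, add_mul, mul_sub, sub_mul, smul_sub, smul_add]
  abel

theorem superMul_add_right (P a b c : A) :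
    superMul P a (b + c) = superMul P a b + superMul P a c := by
  simp only [superMul, mul_add, add_mul, mul_sub, sub_mul, smul_sub, smul_add]
  abel

theorem superMul_smul_left (P : A) (c : ℂ) (a b : A) :
    superMul P (c • a) b = c • superMul P a b := by
  simp only [superMul, smul_mul_assoc, mul_smul_comm, ← smul_sub, smul_add, smul_comm c]

theorem superMul_smul_right (P : A) (c : ℂ) (a b : A) :
    superMul P a (c • b) = c • superMul P a b := by
  simp only [superMul, smul_mul_assoc, mul_smul_comm, ← smul_sub, smul_add, smul_comm c]

theorem superMul_zero_left (P a : A) : superMul P 0 a = 0 := by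
  simp [superMul]

theorem superMul_zero_right (P a : A) : superMul P a 0 = 0 := by
  simp [superMul]

/-- An algebra with the supercommutator as product. -/
@[nolint unusedArguments]
def SuperComm (_P : A) : Type v := A

namespace SuperComm

variable (P : A)

instance : AddCommGroup (SuperComm P) := inferInstanceAs (AddCommGroup A)
instance : Module ℂ (SuperComm P) := inferInstanceAs (Module ℂ A)

instance : NonUnitalNonAssocRing (SuperComm P) where
  mul a b := superMul (A := A) P a b
  left_distrib := superMul_add_right P
  right_distrib := superMul_add_left P
  zero_mul := superMul_zero_left P
  mul_zero := superMul_zero_right P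

instance : IsScalarTower ℂ (SuperComm P) (SuperComm P) where
  smul_assoc := superMul_smul_left P

instance : SMulCommClass ℂ (SuperComm P) (SuperComm P) where
  smul_comm c a b := (superMul_smul_right P c a b).symm

variable {P}

/-- Homogeneous elements. -/
def IsHom (P : A) (s : ZMod 2) (a : A) : Prop := P * a * P = sgn s • a

/-- The factor `b - P b P` is twice the odd part of `b`. The correction term in `superMul` thus adds
twice the product of the odd parts, which turns a commutator of odd elements into an anticommutator.
-/
theorem superMul_of_isHom {s t : ZMod 2} {a b : A} (ha : IsHom P s a) (hb : IsHom P t b) :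
    superMul P a b = a * b - koszul s t • (b * a) := by
  unfold IsHom at ha hb
  rw [superMul, ha, hb]
  rcases parity_cases s with rfl | rfl <;> rcases parity_cases t with rfl | rfl
  · simp [sgn, koszul]
  · simp [sgn, koszul]
  · simp [sgn, koszul]
  · simp only [sgn, koszul, one_ne_zero, if_false, and_self, if_true, neg_smul, one_smul,
      sub_neg_eq_add]
    rw [← two_smul ℂ b, ← two_smul ℂ a, smul_mul_smul_comm, smul_smul, ← sub_eq_zero]
    module

theorem conj_superMul (hP : P * P = 1) (a b : A) :
    P * superMul P a b * P = superMul P (P * a * P) (P * b * P) := by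
  simp only [superMul, mul_add, add_mul, mul_smul_comm, smul_mul_assoc, conj_mul hP, mul_sub P,
    sub_mul _ _ P]

theorem IsHom.superMul (hP : P * P = 1) {s t : ZMod 2} {a b : A} (ha : IsHom P s a)
    (hb : IsHom P t b) : IsHom P (s + t) (superMul P a b) := by
  rw [superMul_of_isHom ha hb]
  unfold IsHom at *
  rw [mul_sub, sub_mul, mul_smul_comm, smul_mul_assoc, conj_mul hP, conj_mul hP, ha, hb,
    smul_mul_smul_comm, smul_mul_smul_comm, sgn_add, mul_comm (sgn t), smul_sub,
    smul_comm (koszul s t)]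

theorem superMul_skew {s t : ZMod 2} {a b : A} (ha : IsHom P s a) (hb : IsHom P t b) :
    superMul P a b + koszul s t • superMul P b a = 0 := by
  rw [superMul_of_isHom ha hb, superMul_of_isHom hb ha, smul_sub, smul_smul, koszul_comm t s,
    koszul_mul_self, one_smul]
  abel

theorem superMul_jacobi (hP : P * P = 1) {s t r : ZMod 2} {a b c : A} (ha : IsHom P s a)
    (hb : IsHom P t b) (hc : IsHom P r c) :
    superMul P a (superMul P b c) - superMul P (superMul P a b) c
      - koszul s t • superMul P b (superMul P a c) = 0 := by
  rw [superMul_of_isHom ha (hb.superMul hP hc), superMul_of_isHom (ha.superMul hP hb) hc,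
    superMul_of_isHom hb (ha.superMul hP hc), superMul_of_isHom ha hb, superMul_of_isHom hb hc,
    superMul_of_isHom ha hc]
  have h11 : (1 + 1 : ZMod 2) = 0 := by decide
  have hk : koszul 1 1 = -1 := by simp [koszul]
  rcases parity_cases s with rfl | rfl <;> rcases parity_cases t with rfl | rfl <;>
    rcases parity_cases r with rfl | rfl <;>
    simp only [add_zero, zero_add, h11, hk, koszul_zero_left, koszul_zero_right, one_smul,
      neg_smul] <;> noncomm_ring

/-- Conjugation by the involution is an automorphism for the supercommutator. -/
def conj (hP : P * P = 1) : SuperComm P →ₙₐ[ℂ] SuperComm P where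
  toFun a := P * (show A from a) * P
  map_smul' c a := by
    change P * (c • (show A from a)) * P = c • (P * (show A from a) * P)
    rw [mul_smul_comm, smul_mul_assoc]
  map_zero' := by
    change P * (0 : A) * P = 0
    simp
  map_add' a b := by
    change P * ((show A from a) + (show A from b)) * P = P * (show A from a) * P + P * _ * P
    rw [mul_add, add_mul]
  map_mul' a b := conj_superMul hP a b

end SuperComm
end SuperCommutator

/-! ### Verma modules -/

namespace Verma

open ChevalleySystem

variable {n : ℕ} {h : Type u} [AddCommGroup h] [Module ℂ h] (τ : Fin n → ZMod 2)
  {B : Matrix (Fin n) (Fin n) ℂ} (R : MinimalRealization B h) (lam : Module.Dual ℂ h)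

/-- The underlying space of a Verma module of the presented Lie superalgebra: words in the
negative generators. -/
abbrev Words (n : ℕ) : Type := List (Fin n) →₀ ℂ

/-- The parity of a word. -/
def wordParity (w : List (Fin n)) : ZMod 2 := (w.map τ).sum

/-- The parity involution. -/
def opP : Module.End ℂ (Words n) :=
  Finsupp.linearCombination ℂ fun w => Finsupp.single w (sgn (wordParity τ w))

/-- The action of the Cartan subalgebra. -/
def opH (t : h) : Module.End ℂ (Words n) :=
  Finsupp.linearCombination ℂ fun w => Finsupp.single w (lam t - listWt R.root w t)

/-- The action of the negative generators. -/
def opF (i : Fin n) : Module.End ℂ (Words n) :=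
  Finsupp.linearCombination ℂ fun w => Finsupp.single (i :: w) 1

/-- The action of the positive generators on words. -/
def actE (j : Fin n) : List (Fin n) → Words n
  | [] => 0
  | i :: w => (if j = i then Finsupp.single w (lam (R.coroot i) - listWt R.root w (R.coroot i))
      else 0) + koszul (τ j) (τ i) • opF i (actE j w)

/-- The action of the positive generators. -/
def opE (j : Fin n) : Module.End ℂ (Words n) := Finsupp.linearCombination ℂ (actE τ R lam j)

/-- A word as an element of the module. -/
abbrev wd (w : List (Fin n)) : Words n := Finsupp.single w 1

theorem opP_wd (w : List (Fin n)) : opP τ (wd w) = sgn (wordParity τ w) • wd w := by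
  simp [opP, wd]

theorem opH_wd (t : h) (w : List (Fin n)) :
    opH R lam t (wd w) = (lam t - listWt R.root w t) • wd w := by
  simp [opH, wd]

theorem opF_wd (i : Fin n) (w : List (Fin n)) : opF i (wd w) = wd (i :: w) := by
  simp [opF, wd]

theorem opE_wd (j : Fin n) (w : List (Fin n)) : opE τ R lam j (wd w) = actE τ R lam j w := by
  simp [opE, wd]

theorem opE_cons (j i : Fin n) (w : List (Fin n)) : opE τ R lam j (wd (i :: w)) =
    (if j = i then opH R lam (R.coroot i) (wd w) else 0)
      + koszul (τ j) (τ i) • opF i (opE τ R lam j (wd w)) := by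
  rw [opE_wd, actE, opE_wd, opH_wd]
  simp [wd]

theorem ext_wd {a b : Module.End ℂ (Words n)} (hab : ∀ w, a (wd w) = b (wd w)) : a = b :=
  Finsupp.lhom_ext' fun w => LinearMap.ext_ring (hab w)

theorem opP_sq : opP τ * opP τ = 1 := by
  refine ext_wd fun w => ?_
  rw [Module.End.mul_apply, opP_wd, map_smul, opP_wd, smul_smul, sgn_mul_self, one_smul]
  rfl

theorem opP_opF (i : Fin n) (x : Words n) : opP τ (opF i x) = sgn (τ i) • opF i (opP τ x) := by
  have : opP τ * opF i = sgn (τ i) • (opF i * opP τ) := by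
    refine ext_wd fun w => ?_
    simp only [Module.End.mul_apply, LinearMap.smul_apply]
    rw [opF_wd, opP_wd, opP_wd, map_smul, opF_wd, smul_smul, ← sgn_add]
    simp [wordParity]
  exact LinearMap.congr_fun this x

theorem opP_opH (t : h) (x : Words n) : opP τ (opH R lam t x) = opH R lam t (opP τ x) := by
  have : opP τ * opH R lam t = opH R lam t * opP τ := by
    refine ext_wd fun w => ?_
    simp only [Module.End.mul_apply]
    rw [opH_wd, opP_wd, map_smul, map_smul, opH_wd, opP_wd, smul_comm]
  exact LinearMap.congr_fun this x

theorem opP_opE (j : Fin n) (x : Words n) :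
    opP τ (opE τ R lam j x) = sgn (τ j) • opE τ R lam j (opP τ x) := by
  have : opP τ * opE τ R lam j = sgn (τ j) • (opE τ R lam j * opP τ) := by
    refine ext_wd fun w => ?_
    simp only [Module.End.mul_apply, LinearMap.smul_apply]
    induction w with
    | nil => rw [opE_wd, opP_wd, map_smul, opE_wd]; simp [actE]
    | cons i w ih =>
      have hp : sgn (wordParity τ (i :: w)) = sgn (τ i) * sgn (wordParity τ w) := by
        rw [← sgn_add]; simp [wordParity]
      rw [opE_cons, map_add, map_smul, opP_opF, ih, opP_wd, opP_wd, map_smul, map_smul, map_smul,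
        map_smul, opE_cons, hp]
      by_cases hji : j = i
      · subst hji
        rw [if_pos rfl, opP_opH, opP_wd, map_smul]
        simp only [smul_add, smul_smul]
        congr 2
        · rw [← mul_assoc, sgn_mul_self, one_mul]
        · ring
      · rw [if_neg hji, map_zero]
        simp only [zero_add, smul_smul]
        congr 1
        ring
  exact LinearMap.congr_fun this x

theorem opH_opF (t : h) (i : Fin n) (x : Words n) :
    opH R lam t (opF i x) = opF i (opH R lam t x) - R.root i t • opF i x := by
  have : opH R lam t * opF i = opF i * opH R lam t - R.root i t • opF i := by
    refine ext_wd fun w => ?_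
    simp only [Module.End.mul_apply, LinearMap.smul_apply, LinearMap.sub_apply]
    rw [opF_wd, opH_wd, opH_wd, map_smul, opF_wd, ← sub_smul]
    congr 1
    simp [listWt]
    ring
  exact LinearMap.congr_fun this x

theorem opH_opH (s t : h) : opH R lam s * opH R lam t = opH R lam t * opH R lam s := by
  refine ext_wd fun w => ?_
  simp only [Module.End.mul_apply]
  rw [opH_wd, opH_wd, map_smul, map_smul, opH_wd, opH_wd, smul_comm]

theorem opH_opE (t : h) (j : Fin n) (x : Words n) :
    opH R lam t (opE τ R lam j x) = opE τ R lam j (opH R lam t x) + R.root j t • opE τ R lam j x := by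
  have : opH R lam t * opE τ R lam j = opE τ R lam j * opH R lam t + R.root j t • opE τ R lam j := by
    refine ext_wd fun w => ?_
    simp only [Module.End.mul_apply, LinearMap.smul_apply, LinearMap.add_apply]
    induction w with
    | nil => rw [opH_wd, map_smul, opE_wd]; simp [actE]
    | cons i w ih =>
      have hw : opH R lam t (wd (i :: w))
          = (lam t - listWt R.root w t) • wd (i :: w) - R.root i t • wd (i :: w) := by
        rw [← opF_wd, opH_opF, opH_wd, map_smul]
      have hE : opH R lam t (opE τ R lam j (wd w)) =
          (lam t - listWt R.root w t + R.root j t) • opE τ R lam j (wd w) := by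
        rw [ih, opH_wd, map_smul, add_smul]
      rw [hw, map_sub, map_smul, map_smul, opE_cons, map_add, map_smul, opH_opF, hE, map_smul]
      by_cases hji : j = i
      · subst hji
        rw [if_pos rfl, opH_wd, map_smul, opH_wd]
        module
      · rw [if_neg hji, map_zero]
        module
  exact LinearMap.congr_fun this x

/-- The relation for `[e j, f i]` is the recursion that defines `actE`. Since the presentation
imposes no relations among the `e j` alone, nothing else about them has to be checked beyond parity
and weight. -/
theorem opE_opF (j i : Fin n) : opE τ R lam j * opF i =
    (if j = i then opH R lam (R.coroot i) else 0)
      + koszul (τ j) (τ i) • (opF i * opE τ R lam j) := by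
  refine ext_wd fun w => ?_
  simp only [Module.End.mul_apply, LinearMap.smul_apply, LinearMap.add_apply]
  rw [opF_wd, opE_cons]
  split_ifs <;> rfl

end Verma

/-! ### Verma modules as representations of the presented superalgebra -/

namespace Verma

open ChevalleySystem

variable {n : ℕ} {h : Type u} [AddCommGroup h] [Module ℂ h] (τ : Fin n → ZMod 2)
  {B : Matrix (Fin n) (Fin n) ℂ} (R : MinimalRealization B h) (lam : Module.Dual ℂ h)

/-- The action of the generators on the Verma module. -/
def genAct : Gen n h → Module.End ℂ (Words n)
  | .H t => opH R lam t
  | .E i => opE τ R lam i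
  | .F i => opF i

/-- The action of the free algebra on the Verma module. -/
def act : Free τ h →ₙₐ[ℂ] SuperComm (opP τ) :=
  FreeNonUnitalNonAssocAlgebra.lift ℂ (A := SuperComm (opP τ)) (genAct τ R lam)

/-- The action of the free algebra by endomorphisms. -/
def toEnd : Free τ h →ₗ[ℂ] Module.End ℂ (Words n) where
  toFun x := act τ R lam x
  map_add' := map_add (act τ R lam)
  map_smul' := map_smul (act τ R lam)

theorem act_of (g : Gen n h) : act τ R lam (Free.of τ g) = genAct τ R lam g :=
  FreeNonUnitalNonAssocAlgebra.lift_of_apply ℂ _ g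

theorem toEnd_of (g : Gen n h) : toEnd τ R lam (Free.of τ g) = genAct τ R lam g :=
  act_of τ R lam g

theorem toEnd_mul (x y : Free τ h) :
    toEnd τ R lam (x * y) = superMul (opP τ) (toEnd τ R lam x) (toEnd τ R lam y) :=
  map_mul (act τ R lam) x y

theorem genAct_isHom (g : Gen n h) :
    SuperComm.IsHom (opP τ) (g.parity τ) (genAct τ R lam g) := by
  have hsq : ∀ x, opP τ (opP τ x) = x := fun x => LinearMap.congr_fun (opP_sq τ) x
  refine LinearMap.ext fun x => ?_
  cases g with
  | H t =>
    change opP τ (opH R lam t (opP τ x)) = sgn 0 • opH R lam t x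
    rw [opP_opH, hsq, sgn, if_pos rfl, one_smul]
  | E i =>
    change opP τ (opE τ R lam i (opP τ x)) = sgn (τ i) • opE τ R lam i x
    rw [opP_opE, hsq]
  | F i =>
    change opP τ (opF i (opP τ x)) = sgn (τ i) • opF i x
    rw [opP_opF, hsq]

/-- Both sides are homomorphisms from the free algebra that agree on generators. Hence homogeneous
elements act by homogeneous operators. -/
theorem toEnd_θ (x : Free τ h) :
    toEnd τ R lam (Free.θ τ x) = opP τ * toEnd τ R lam x * opP τ := by
  have h1 : (act τ R lam).comp (Free.θ τ) = (SuperComm.conj (opP_sq τ)).comp (act τ R lam) := by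
    apply FreeNonUnitalNonAssocAlgebra.hom_ext ℂ
    intro g
    change toEnd τ R lam (Free.θ τ (Free.of τ g)) = opP τ * toEnd τ R lam (Free.of τ g) * opP τ
    rw [Free.θ_of, map_smul, toEnd_of]
    exact (genAct_isHom τ R lam g).symm
  exact DFunLike.congr_fun h1 x

theorem toEnd_isHom {s : ZMod 2} {x : Free τ h} (hx : x ∈ Free.part τ s) :
    SuperComm.IsHom (opP τ) s (toEnd τ R lam x) := by
  have h1 := toEnd_θ τ R lam x
  rw [show Free.θ τ x = sgn s • x from hx, map_smul] at h1
  exact h1.symm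

theorem superMul_gen (g g' : Gen n h) : superMul (opP τ) (genAct τ R lam g) (genAct τ R lam g') =
    genAct τ R lam g * genAct τ R lam g' -
      koszul (g.parity τ) (g'.parity τ) • (genAct τ R lam g' * genAct τ R lam g) :=
  SuperComm.superMul_of_isHom (genAct_isHom τ R lam g) (genAct_isHom τ R lam g')

theorem superMul_E_F (i j : Fin n) : superMul (opP τ) (opE τ R lam i) (opF j) =
    if i = j then opH R lam (R.coroot j) else 0 := by
  have h1 := superMul_gen τ R lam (.E i) (.F j)
  simp only [genAct, Gen.parity] at h1
  rw [h1, opE_opF]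
  refine LinearMap.ext fun w => ?_
  simp only [LinearMap.sub_apply, LinearMap.add_apply, add_sub_cancel_right]

theorem opH_add (s t : h) : opH R lam (s + t) = opH R lam s + opH R lam t := by
  refine ext_wd fun w => ?_
  simp only [LinearMap.add_apply, opH_wd, map_add]
  module

theorem opH_smul (c : ℂ) (t : h) : opH R lam (c • t) = c • opH R lam t := by
  refine ext_wd fun w => ?_
  simp only [LinearMap.smul_apply, opH_wd, map_smul, smul_eq_mul]
  module

theorem toEnd_relator {x : Free τ h} (hx : Relator τ R x) : toEnd τ R lam x = 0 := by
  cases hx with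
  | @skew s t x y hx hy =>
    rw [map_add, map_smul, toEnd_mul, toEnd_mul]
    exact SuperComm.superMul_skew (toEnd_isHom τ R lam hx) (toEnd_isHom τ R lam hy)
  | @jacobi s t r x y z hx hy hz =>
    rw [map_sub, map_sub, map_smul, toEnd_mul, toEnd_mul, toEnd_mul, toEnd_mul, toEnd_mul,
      toEnd_mul]
    exact SuperComm.superMul_jacobi (opP_sq τ) (toEnd_isHom τ R lam hx) (toEnd_isHom τ R lam hy)
      (toEnd_isHom τ R lam hz)
  | add x y =>
    rw [map_sub, map_sub, toEnd_of, toEnd_of, toEnd_of, sub_sub, sub_eq_zero]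
    exact opH_add R lam x y
  | smul c x =>
    rw [map_sub, map_smul, toEnd_of, toEnd_of, sub_eq_zero]
    exact opH_smul R lam c x
  | hh x y =>
    rw [toEnd_mul, toEnd_of, toEnd_of, superMul_gen]
    simp only [genAct, Gen.parity, koszul_zero_left, one_smul]
    rw [opH_opH]
    exact LinearMap.ext fun w => sub_self _
  | he x i =>
    rw [map_sub, map_smul, toEnd_mul, toEnd_of, toEnd_of, superMul_gen, sub_eq_zero]
    simp only [genAct, Gen.parity, koszul_zero_left, one_smul]
    refine LinearMap.ext fun w => ?_
    simp only [LinearMap.sub_apply, Module.End.mul_apply]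
    rw [opH_opE, add_sub_cancel_left]
    rfl
  | hf x i =>
    rw [map_add, map_smul, toEnd_mul, toEnd_of, toEnd_of, superMul_gen]
    simp only [genAct, Gen.parity, koszul_zero_left, one_smul]
    refine LinearMap.ext fun w => ?_
    rw [LinearMap.add_apply, LinearMap.sub_apply, Module.End.mul_apply, Module.End.mul_apply,
      opH_opF, sub_sub_cancel_left]
    exact neg_add_cancel _
  | ef i =>
    rw [map_sub, toEnd_mul, toEnd_of, toEnd_of, toEnd_of, sub_eq_zero]
    exact (superMul_E_F τ R lam i i).trans (if_pos rfl)
  | @ef_ne i j hij =>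
    rw [toEnd_mul, toEnd_of, toEnd_of]
    exact (superMul_E_F τ R lam i j).trans (if_neg hij)

theorem toEnd_relIdeal {x : Free τ h} (hx : x ∈ relIdeal τ R) : toEnd τ R lam x = 0 := by
  have hle : relIdeal τ R ≤ LinearMap.ker (toEnd τ R lam) := by
    refine sInf_le ⟨fun y hy => toEnd_relator τ R lam hy, fun a b hb => ?_⟩
    have hb' : toEnd τ R lam b = 0 := hb
    constructor
    · change toEnd τ R lam (a * b) = 0
      rw [toEnd_mul, hb', superMul_zero_right]
    · change toEnd τ R lam (b * a) = 0
      rw [toEnd_mul, hb', superMul_zero_left]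
  exact hle hx

end Verma

/-! ### The Cartan subalgebra embeds in the presented superalgebra -/

section Cartan

variable {n : ℕ} {h : Type u} [AddCommGroup h] [Module ℂ h] (τ : Fin n → ZMod 2)
  {B : Matrix (Fin n) (Fin n) ℂ} (R : MinimalRealization B h)

/-- On the empty word of the Verma module with highest weight `lam`, the element `t` acts by `lam
t`, and `lam` is arbitrary. -/
theorem GTilde.ofH_injective : Function.Injective (GTilde.ofH τ R) := by
  rw [injective_iff_map_eq_zero]
  intro t ht
  have h1 : Free.of τ (.H t) ∈ relIdeal τ R := (Submodule.Quotient.mk_eq_zero _).1 ht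
  rw [← Module.forall_dual_apply_eq_zero_iff ℂ]
  intro lam
  have h2 : Verma.opH R lam t = 0 := by
    have := Verma.toEnd_relIdeal τ R lam h1
    rwa [Verma.toEnd_of] at this
  have h3 := LinearMap.congr_fun h2 (Verma.wd [])
  rw [Verma.opH_wd] at h3
  have h4 := DFunLike.congr_fun h3 []
  simpa [Verma.wd, ChevalleySystem.listWt] using h4

end Cartan

/-! ### Chevalley systems of the presented Lie superalgebra and of its quotient -/

section Presented

variable {n : ℕ} {h : Type u}

/-- By the universal property the identity factors through the subalgebra `S`. -/
theorem Free.eq_top_of_closed (τ : Fin n → ZMod 2) (S : Submodule ℂ (Free τ h))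
    (hS : ∀ x ∈ S, ∀ y ∈ S, x * y ∈ S) (hg : ∀ g, Free.of τ g ∈ S) : S = ⊤ := by
  let S' : NonUnitalSubalgebra ℂ (Free τ h) :=
    { S with mul_mem' := fun {a b} ha hb => hS a ha b hb }
  let j : Free τ h →ₙₐ[ℂ] S' :=
    FreeNonUnitalNonAssocAlgebra.lift ℂ (A := S') fun g => ⟨Free.of τ g, hg g⟩
  have h1 : (NonUnitalSubalgebraClass.subtype S').comp j = NonUnitalAlgHom.id ℂ (Free τ h) := by
    apply FreeNonUnitalNonAssocAlgebra.hom_ext ℂ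
    intro g
    have h2 : j (Free.of τ g) = ⟨Free.of τ g, hg g⟩ :=
      FreeNonUnitalNonAssocAlgebra.lift_of_apply ℂ _ g
    exact congrArg Subtype.val h2
  rw [eq_top_iff]
  intro x _
  have h3 : ((j x : S') : Free τ h) = x := DFunLike.congr_fun h1 x
  rw [← h3]
  exact (j x).2

theorem Free.of_mem_part (τ : Fin n → ZMod 2) (g : Gen n h) :
    Free.of τ g ∈ Free.part τ (g.parity τ) := Free.θ_of τ g

variable [AddCommGroup h] [Module ℂ h] (τ : Fin n → ZMod 2)
  {B : Matrix (Fin n) (Fin n) ℂ} (R : MinimalRealization B h)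

/-- The quotient map from the free algebra. -/
def GTilde.mk : Free τ h →ₗ[ℂ] GTilde τ R := (relIdeal τ R).mkQ

theorem GTilde.mk_surjective : Function.Surjective (GTilde.mk τ R) := Submodule.mkQ_surjective _

theorem GTilde.mk_mul (x y : Free τ h) :
    GTilde.mk τ R (x * y) = bracket (GTilde.mk τ R x) (GTilde.mk τ R y) := rfl

theorem GTilde.mk_relator {x : Free τ h} (hx : Relator τ R x) : GTilde.mk τ R x = 0 :=
  (Submodule.Quotient.mk_eq_zero _).2 hx.mem

theorem GTilde.mk_mem_part {s : ZMod 2} {x : Free τ h} (hx : x ∈ Free.part τ s) :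
    GTilde.mk τ R x ∈ part (L := GTilde τ R) s := ⟨x, hx, rfl⟩

/-- The Chevalley generators of the presented Lie superalgebra. -/
def GTilde.chevalley : ChevalleySystem (GTilde.ofH τ R) R.root where
  e i := GTilde.mk τ R (Free.of τ (.E i))
  f i := GTilde.mk τ R (Free.of τ (.F i))
  coroot := R.coroot
  parity := τ
  H_even t := GTilde.mk_mem_part τ R (Free.of_mem_part τ (.H t))
  H_comm s t := GTilde.mk_relator τ R (.hh s t)
  e_mem i t := by
    have := GTilde.mk_relator τ R (.he t i)
    rwa [map_sub, map_smul, sub_eq_zero] at this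
  f_mem i t := by
    have := GTilde.mk_relator τ R (.hf t i)
    rw [map_add, map_smul, add_eq_zero_iff_eq_neg, ← neg_smul] at this
    exact this
  e_parity i := GTilde.mk_mem_part τ R (Free.of_mem_part τ (.E i))
  f_parity i := GTilde.mk_mem_part τ R (Free.of_mem_part τ (.F i))
  bracket_ne i j hij := GTilde.mk_relator τ R (.ef_ne hij)
  bracket_self i := by
    have := GTilde.mk_relator τ R (.ef i)
    rwa [map_sub, sub_eq_zero] at this
  generate S hS hH he hf := by
    have h1 := Free.eq_top_of_closed τ (S.comap (GTilde.mk τ R))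
      (fun x hx y hy => hS _ hx _ hy) (fun g => by
        cases g with
        | H t => exact hH t
        | E i => exact he i
        | F i => exact hf i)
    rw [eq_top_iff]
    intro x _
    obtain ⟨y, rfl⟩ := GTilde.mk_surjective τ R x
    exact (h1 ▸ Submodule.mem_top : y ∈ S.comap (GTilde.mk τ R))

theorem radical_inf_range : radical τ R ⊓ LinearMap.range (GTilde.ofH τ R) = ⊥ :=
  (GTilde.chevalley τ R).sSup_inf_range R.root_linearIndependent

/-- The quotient map from the presented Lie superalgebra. -/
def G.mk : GTilde τ R →ₗ[ℂ] G τ R := (radical τ R).mkQ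

theorem G.mk_surjective : Function.Surjective (G.mk τ R) := Submodule.mkQ_surjective _

theorem G.mk_bracket (x y : GTilde τ R) :
    G.mk τ R (bracket x y) = bracket (G.mk τ R x) (G.mk τ R y) := rfl

theorem G.mk_eq_zero {x : GTilde τ R} : G.mk τ R x = 0 ↔ x ∈ radical τ R :=
  Submodule.Quotient.mk_eq_zero _

theorem G.mem_part {s : ZMod 2} {x : G τ R} :
    x ∈ part (L := G τ R) s ↔ ∃ y ∈ part (L := GTilde τ R) s, G.mk τ R y = x := Iff.rfl

theorem G.mk_mem_part {s : ZMod 2} {x : GTilde τ R} (hx : x ∈ part (L := GTilde τ R) s) :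
    G.mk τ R x ∈ part (L := G τ R) s := ⟨x, hx, rfl⟩

theorem G.mk_ofH (t : h) : G.mk τ R (GTilde.ofH τ R t) = G.ofH τ R t := rfl

theorem GTilde.eq_zero_of_mem_radical {t : h} (ht : GTilde.ofH τ R t ∈ radical τ R) : t = 0 := by
  have h1 : GTilde.ofH τ R t ∈ radical τ R ⊓ LinearMap.range (GTilde.ofH τ R) := ⟨ht, t, rfl⟩
  rw [radical_inf_range, Submodule.mem_bot] at h1
  exact (map_eq_zero_iff _ (GTilde.ofH_injective τ R)).1 h1

theorem G.ofH_injective : Function.Injective (G.ofH τ R) := by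
  rw [injective_iff_map_eq_zero]
  intro t ht
  rw [← G.mk_ofH, G.mk_eq_zero] at ht
  exact GTilde.eq_zero_of_mem_radical τ R ht

/-- The Chevalley generators of a contragredient Lie superalgebra. -/
def G.chevalley : ChevalleySystem (G.ofH τ R) R.root where
  e i := G.mk τ R ((GTilde.chevalley τ R).e i)
  f i := G.mk τ R ((GTilde.chevalley τ R).f i)
  coroot := R.coroot
  parity := τ
  H_even t := G.mk_mem_part τ R ((GTilde.chevalley τ R).H_even t)
  H_comm s t := by
    rw [← G.mk_ofH, ← G.mk_ofH, ← G.mk_bracket, (GTilde.chevalley τ R).H_comm, map_zero]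
  e_mem i t := by
    rw [← G.mk_ofH, ← G.mk_bracket, (GTilde.chevalley τ R).e_mem, map_smul]
  f_mem i t := by
    rw [← G.mk_ofH, ← G.mk_bracket, (GTilde.chevalley τ R).f_mem, map_smul]
  e_parity i := G.mk_mem_part τ R ((GTilde.chevalley τ R).e_parity i)
  f_parity i := G.mk_mem_part τ R ((GTilde.chevalley τ R).f_parity i)
  bracket_ne i j hij := by
    rw [← G.mk_bracket, (GTilde.chevalley τ R).bracket_ne i j hij, map_zero]
  bracket_self i := by
    rw [← G.mk_bracket, (GTilde.chevalley τ R).bracket_self i]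
    rfl
  generate S hS hH he hf := by
    have h1 := (GTilde.chevalley τ R).generate (S.comap (G.mk τ R))
      (fun x hx y hy => hS _ hx _ hy) hH he hf
    rw [eq_top_iff]
    intro x _
    obtain ⟨y, rfl⟩ := G.mk_surjective τ R x
    exact (h1 ▸ Submodule.mem_top : y ∈ S.comap (G.mk τ R))

/-- The preimage of the ideal in the presented superalgebra still misses `h`, so it is contained in
the radical. -/
theorem G.eq_bot_of_isIdeal (I : Submodule ℂ (G τ R)) (hI : IsIdeal I)
    (hIH : I ⊓ LinearMap.range (G.ofH τ R) = ⊥) : I = ⊥ := by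
  have hJ : IsIdeal (I.comap (G.mk τ R)) := by
    refine ⟨fun x y hy => hI.left (G.mk τ R x) hy, fun y hx => hI.right (G.mk τ R y) hx, fun {x} hx => ?_⟩
    obtain ⟨y, hy, z, hz, hy0, hz1, hxyz⟩ := hI.graded hx
    obtain ⟨a, ha, rfl⟩ := (G.mem_part τ R).1 hy0
    obtain ⟨b, hb, rfl⟩ := (G.mem_part τ R).1 hz1
    -- Lifts of the homogeneous parts add up to `x` only modulo the radical; the defect is split by
    -- the grading of the radical and distributed over the two lifts.
    have h1 : x - (a + b) ∈ radical τ R := by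
      rw [← G.mk_eq_zero, map_sub, map_add, hxyz, sub_self]
    obtain ⟨c, hc, d, hd, hc0, hd1, hcd⟩ := (radical_isIdeal τ R).graded h1
    have hc' := (G.mk_eq_zero τ R).2 hc
    have hd' := (G.mk_eq_zero τ R).2 hd
    refine ⟨a + c, ?_, b + d, ?_, add_mem ha hc0, add_mem hb hd1, ?_⟩
    · change G.mk τ R (a + c) ∈ I
      rwa [map_add, hc', add_zero]
    · change G.mk τ R (b + d) ∈ I
      rwa [map_add, hd', add_zero]
    · rw [sub_eq_iff_eq_add] at hcd
      rw [hcd]; abel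
  have hJH : I.comap (G.mk τ R) ⊓ LinearMap.range (GTilde.ofH τ R) = ⊥ := by
    rw [eq_bot_iff]
    rintro _ ⟨h1, t, rfl⟩
    have h2 : G.ofH τ R t ∈ I ⊓ LinearMap.range (G.ofH τ R) := ⟨h1, t, rfl⟩
    rw [hIH, Submodule.mem_bot] at h2
    rw [(map_eq_zero_iff _ (G.ofH_injective τ R)).1 h2, map_zero]
    exact zero_mem _
  have hle : I.comap (G.mk τ R) ≤ radical τ R := le_sSup ⟨hJ, hJH⟩
  rw [eq_bot_iff]
  intro x hx
  obtain ⟨y, rfl⟩ := G.mk_surjective τ R x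
  exact (G.mk_eq_zero τ R).2 (hle hx)

end Presented

/-! ### The isomorphism with the contragredient Lie superalgebra of a Chevalley system -/

section Lift

variable {L : Type v} [AddCommGroup L] [Module ℂ L] [LieSuperalgebra L]

/-- A Lie superalgebra with the bracket as multiplication. -/
def BracketAlg (L : Type v) : Type v := L

instance : AddCommGroup (BracketAlg L) := inferInstanceAs (AddCommGroup L)
instance : Module ℂ (BracketAlg L) := inferInstanceAs (Module ℂ L)

instance : NonUnitalNonAssocRing (BracketAlg L) where
  mul x y := (bracket (L := L) x y : L)
  left_distrib x y z := map_add (bracket (L := L) x) y z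
  right_distrib x y z := LinearMap.map_add₂ (bracket (L := L)) x y z
  zero_mul x := LinearMap.map_zero₂ (bracket (L := L)) x
  mul_zero x := map_zero (bracket (L := L) x)

instance : IsScalarTower ℂ (BracketAlg L) (BracketAlg L) where
  smul_assoc c x y := LinearMap.map_smul₂ (bracket (L := L)) c x y

instance : SMulCommClass ℂ (BracketAlg L) (BracketAlg L) where
  smul_comm c x y := (map_smul (bracket (L := L) x) c y).symm

variable {n : ℕ} {h : Type u} [AddCommGroup h] [Module ℂ h] {H : h →ₗ[ℂ] L}
  {β : Fin n → Module.Dual ℂ h} (C : ChevalleySystem H β)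

namespace ChevalleySystem

/-- The images of the generators. -/
def ofGen : Gen n h → L
  | .H t => H t
  | .E i => C.e i
  | .F i => C.f i

/-- The homomorphism from the free algebra. -/
def freeHom : Free C.parity h →ₙₐ[ℂ] BracketAlg L :=
  FreeNonUnitalNonAssocAlgebra.lift ℂ (A := BracketAlg L) C.ofGen

theorem freeHom_of (g : Gen n h) : C.freeHom (Free.of C.parity g) = C.ofGen g :=
  FreeNonUnitalNonAssocAlgebra.lift_of_apply ℂ _ g

/-- The linear map underlying the homomorphism from the free algebra. -/
def freeMap : Free C.parity h →ₗ[ℂ] L where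
  toFun x := C.freeHom x
  map_add' := map_add C.freeHom
  map_smul' := map_smul C.freeHom

theorem freeMap_of (g : Gen n h) : C.freeMap (Free.of C.parity g) = C.ofGen g := C.freeHom_of g

theorem freeMap_mul (x y : Free C.parity h) :
    C.freeMap (x * y) = bracket (C.freeMap x) (C.freeMap y) := map_mul C.freeHom x y

/-- The homogeneous elements whose images have the right parity span a subalgebra that contains the
generators. -/
theorem freeMap_mem_part {s : ZMod 2} {x : Free C.parity h} (hx : x ∈ Free.part C.parity s) :
    C.freeMap x ∈ part (L := L) s := by
  let T : ZMod 2 → Submodule ℂ (Free C.parity h) := fun s =>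
    Free.part C.parity s ⊓ (part (L := L) s).comap C.freeMap
  have hle : ∀ s, T s ≤ T 0 ⊔ T 1 := by
    intro s
    rcases parity_cases s with rfl | rfl
    · exact le_sup_left
    · exact le_sup_right
  have hT : T 0 ⊔ T 1 = ⊤ := by
    refine Free.eq_top_of_closed _ _ (fun x hx y hy => ?_) (fun g => hle (g.parity C.parity) ?_)
    · obtain ⟨a, ha, b, hb, rfl⟩ := Submodule.mem_sup.1 hx
      obtain ⟨c, hc, d, hd, rfl⟩ := Submodule.mem_sup.1 hy
      have key : ∀ {s t : ZMod 2} {x y : Free C.parity h}, x ∈ T s → y ∈ T t →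
          x * y ∈ T 0 ⊔ T 1 := by
        intro s t x y hx hy
        refine hle (s + t) ⟨bracket_mem (L := Free C.parity h) hx.1 hy.1, ?_⟩
        change C.freeMap (x * y) ∈ part (L := L) (s + t)
        rw [freeMap_mul]
        exact bracket_mem hx.2 hy.2
      rw [mul_add, add_mul, add_mul]
      exact add_mem (add_mem (key ha hc) (key hb hc)) (add_mem (key ha hd) (key hb hd))
    · refine ⟨Free.of_mem_part _ g, ?_⟩
      change C.freeMap (Free.of C.parity g) ∈ part (L := L) (g.parity C.parity)
      rw [freeMap_of]
      cases g with
      | H t => exact C.H_even t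
      | E i => exact C.e_parity i
      | F i => exact C.f_parity i
  obtain ⟨a, ha, b, hb, rfl⟩ := Submodule.mem_sup.1 (hT ▸ Submodule.mem_top : x ∈ T 0 ⊔ T 1)
  rcases parity_cases s with rfl | rfl
  · have h1 : b ∈ Free.part C.parity 0 := by
      have := sub_mem hx ha.1
      rwa [add_sub_cancel_left] at this
    have h2 : b = 0 := eq_zero_of_mem_part (L := Free C.parity h) h1 hb.1
    rw [h2, add_zero]
    exact ha.2
  · have h1 : a ∈ Free.part C.parity 1 := by
      have := sub_mem hx hb.1
      rwa [add_sub_cancel_right] at this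
    have h2 : a = 0 := eq_zero_of_mem_part (L := Free C.parity h) ha.1 h1
    rw [h2, zero_add]
    exact hb.2

variable {B : Matrix (Fin n) (Fin n) ℂ} (R : MinimalRealization B h)

theorem freeMap_relator (hroot : R.root = β) (hcoroot : R.coroot = C.coroot)
    {x : Free C.parity h} (hx : Relator C.parity R x) : C.freeMap x = 0 := by
  cases hx with
  | @skew s t x y hx hy =>
    rw [map_add, map_smul, freeMap_mul, freeMap_mul,
      LieSuperalgebra.skew (C.freeMap_mem_part hx) (C.freeMap_mem_part hy), neg_add_cancel]
  | @jacobi s t r x y z hx hy hz =>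
    rw [map_sub, map_sub, map_smul, freeMap_mul, freeMap_mul, freeMap_mul, freeMap_mul,
      freeMap_mul, freeMap_mul, LieSuperalgebra.jacobi (C.freeMap_mem_part hx)
      (C.freeMap_mem_part hy) (C.freeMap_mem_part hz), add_sub_cancel_left, sub_self]
  | add x y =>
    rw [map_sub, map_sub, freeMap_of, freeMap_of, freeMap_of, sub_sub, sub_eq_zero]
    exact map_add H x y
  | smul c x =>
    rw [map_sub, map_smul, freeMap_of, freeMap_of, sub_eq_zero]
    exact map_smul H c x
  | hh x y =>
    rw [freeMap_mul, freeMap_of, freeMap_of]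
    exact C.H_comm x y
  | he x i =>
    rw [map_sub, map_smul, freeMap_mul, freeMap_of, freeMap_of, sub_eq_zero, hroot]
    exact C.e_mem i x
  | hf x i =>
    rw [map_add, map_smul, freeMap_mul, freeMap_of, freeMap_of, add_eq_zero_iff_eq_neg, hroot,
      ← neg_smul]
    exact C.f_mem i x
  | ef i =>
    rw [map_sub, freeMap_mul, freeMap_of, freeMap_of, freeMap_of, sub_eq_zero, hcoroot]
    exact C.bracket_self i
  | @ef_ne i j hij =>
    rw [freeMap_mul, freeMap_of, freeMap_of]
    exact C.bracket_ne i j hij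

/-- A Lie superalgebra with Chevalley generators in which no ideal meets the Cartan subalgebra
trivially is the contragredient Lie superalgebra of its Cartan datum. -/
theorem isIsomorphic (hroot : R.root = β) (hcoroot : R.coroot = C.coroot)
    (hH : Function.Injective H)
    (hrad : ∀ I : Submodule ℂ L, IsIdeal I → I ⊓ LinearMap.range H = ⊥ → I = ⊥) :
    IsIsomorphic (G C.parity R) L := by
  have hker : relIdeal C.parity R ≤ LinearMap.ker C.freeMap := by
    refine sInf_le ⟨fun y hy => C.freeMap_relator R hroot hcoroot hy, fun a b hb => ?_⟩
    have hb' : C.freeMap b = 0 := hb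
    constructor
    · change C.freeMap (a * b) = 0
      rw [freeMap_mul, hb', map_zero]
    · change C.freeMap (b * a) = 0
      rw [freeMap_mul, hb', map_zero, LinearMap.zero_apply]
  let φ : GTilde C.parity R →ₗ[ℂ] L := (relIdeal C.parity R).liftQ C.freeMap hker
  have hφmk : ∀ x, φ (GTilde.mk C.parity R x) = C.freeMap x := fun x => rfl
  have hφ : ∀ x y, φ (bracket x y) = bracket (φ x) (φ y) := by
    intro x y
    obtain ⟨x, rfl⟩ := GTilde.mk_surjective _ _ x
    obtain ⟨y, rfl⟩ := GTilde.mk_surjective _ _ y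
    rw [← GTilde.mk_mul, hφmk, hφmk, hφmk, freeMap_mul]
  have hφH : ∀ t, φ (GTilde.ofH C.parity R t) = H t := fun t => C.freeMap_of (.H t)
  have hφpart : ∀ {s : ZMod 2} {x}, x ∈ part (L := GTilde C.parity R) s → φ x ∈ part (L := L) s := by
    rintro s _ ⟨x, hx, rfl⟩
    exact C.freeMap_mem_part hx
  have hsurj : Function.Surjective φ := by
    rw [← LinearMap.range_eq_top]
    refine C.generate _ ?_ (fun t => ⟨_, hφH t⟩) (fun i => ⟨GTilde.mk _ _ (Free.of _ (.E i)), C.freeMap_of (.E i)⟩)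
      (fun i => ⟨GTilde.mk _ _ (Free.of _ (.F i)), C.freeMap_of (.F i)⟩)
    rintro _ ⟨x, rfl⟩ _ ⟨y, rfl⟩
    exact ⟨_, hφ x y⟩
  -- The kernel is an ideal that misses `h`, because `H` is injective.
  have hker_le : LinearMap.ker φ ≤ radical C.parity R := by
    refine le_sSup ⟨⟨fun x y hy => ?_, fun {x} y hx => ?_, fun {x} hx => ?_⟩, ?_⟩
    · rw [LinearMap.mem_ker] at *; rw [hφ, hy, map_zero]
    · rw [LinearMap.mem_ker] at *; rw [hφ, hx, map_zero, LinearMap.zero_apply]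
    · obtain ⟨a, ha, b, hb, rfl⟩ := exists_part_add x
      rw [LinearMap.mem_ker, map_add, add_eq_zero_iff_eq_neg] at hx
      have ha0 : φ a = 0 := eq_zero_of_mem_part (hφpart ha) (hx ▸ neg_mem (hφpart hb))
      rw [ha0, eq_comm, neg_eq_zero] at hx
      exact ⟨a, ha0, b, hx, ha, hb, rfl⟩
    · rw [eq_bot_iff]
      rintro _ ⟨h1, t, rfl⟩
      have h2 : φ (GTilde.ofH C.parity R t) = 0 := h1
      rw [hφH, map_eq_zero_iff H hH] at h2
      rw [h2, map_zero]
      exact zero_mem _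
  -- By surjectivity the radical maps onto an ideal. If `φ z = H t` with `z` in the radical, then
  -- `t` differs from `z` by an element of the kernel, hence lies in the radical and is zero; so
  -- `hrad` applies to the image.
  have hrad_le : radical C.parity R ≤ LinearMap.ker φ := by
    have h1 : (radical C.parity R).map φ = ⊥ := by
      refine hrad _ ⟨fun x y hy => ?_, fun {x} y hx => ?_, fun {x} hx => ?_⟩ ?_
      · obtain ⟨z, hz, rfl⟩ := hy
        obtain ⟨w, rfl⟩ := hsurj x
        exact ⟨_, (radical_isIdeal C.parity R).left w hz, hφ w z⟩
      · obtain ⟨z, hz, rfl⟩ := hx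
        obtain ⟨w, rfl⟩ := hsurj y
        exact ⟨_, (radical_isIdeal C.parity R).right w hz, hφ z w⟩
      · obtain ⟨z, hz, rfl⟩ := hx
        obtain ⟨a, ha, b, hb, ha0, hb1, rfl⟩ := (radical_isIdeal C.parity R).graded hz
        exact ⟨φ a, ⟨a, ha, rfl⟩, φ b, ⟨b, hb, rfl⟩, hφpart ha0, hφpart hb1, map_add φ a b⟩
      · rw [eq_bot_iff]
        rintro _ ⟨⟨z, hz, hzt⟩, t, rfl⟩
        have h2 : z - GTilde.ofH C.parity R t ∈ LinearMap.ker φ := by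
          rw [LinearMap.mem_ker, map_sub, hφH, hzt, sub_self]
        have h3 := sub_mem hz (hker_le h2)
        rw [sub_sub_cancel] at h3
        rw [GTilde.eq_zero_of_mem_radical _ _ h3, map_zero]
        exact zero_mem _
    intro x hx
    have h2 : φ x ∈ (radical C.parity R).map φ := ⟨x, hx, rfl⟩
    rw [h1] at h2
    exact h2
  let ψ : G C.parity R →ₗ[ℂ] L := (radical C.parity R).liftQ φ hrad_le
  have hψmk : ∀ x, ψ (G.mk C.parity R x) = φ x := fun x => rfl
  have hψ : Function.Bijective ψ := by
    constructor
    · rw [injective_iff_map_eq_zero]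
      intro x hx
      obtain ⟨x, rfl⟩ := G.mk_surjective _ _ x
      exact (G.mk_eq_zero _ _).2 (hker_le hx)
    · intro y
      obtain ⟨x, rfl⟩ := hsurj y
      exact ⟨G.mk C.parity R x, rfl⟩
  refine ⟨LinearEquiv.ofBijective ψ hψ, fun x y => ?_, ?_⟩
  · obtain ⟨x, rfl⟩ := G.mk_surjective _ _ x
    obtain ⟨y, rfl⟩ := G.mk_surjective _ _ y
    exact hφ x y
  · rintro s _ ⟨x, hx, rfl⟩
    exact hφpart hx

end ChevalleySystem
end Lift

/-! ### Comparison of two Chevalley systems -/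

section Compare

variable {n : ℕ} {h : Type u} [AddCommGroup h] [Module ℂ h]

/-- Expanding both families in terms of the old ones writes the new pairing matrix as `P * M * Qᵀ`,
where `M` is the old one. -/
theorem rank_pairing_le {c c' : Fin n → h} {β β' : Fin n → Module.Dual ℂ h}
    (hc : ∀ i, c' i ∈ Submodule.span ℂ (Set.range c))
    (hβ : ∀ i, β' i ∈ Submodule.span ℂ (Set.range β)) :
    (Matrix.of fun i j => β' j (c' i)).rank ≤ (Matrix.of fun i j => β j (c i)).rank := by
  choose P hP using fun i => (Submodule.mem_span_range_iff_exists_fun ℂ).1 (hc i)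
  choose Q hQ using fun i => (Submodule.mem_span_range_iff_exists_fun ℂ).1 (hβ i)
  have h1 : (Matrix.of fun i j => β' j (c' i)) =
      Matrix.of P * (Matrix.of fun i j => β j (c i)) * (Matrix.of Q).transpose := by
    ext i j
    simp only [Matrix.mul_apply, Matrix.of_apply, Matrix.transpose_apply]
    rw [← hP i, ← hQ j]
    simp only [LinearMap.sum_apply, LinearMap.smul_apply, map_sum, map_smul, smul_eq_mul,
      Finset.sum_mul, Finset.mul_sum]
    rw [Finset.sum_comm]
    refine Finset.sum_congr rfl fun k _ => Finset.sum_congr rfl fun l _ => by ring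
  rw [h1]
  exact (Matrix.rank_mul_le_left _ _).trans (Matrix.rank_mul_le_right _ _)

variable {L : Type v} [AddCommGroup L] [Module ℂ L] [LieSuperalgebra L] {H : h →ₗ[ℂ] L}
  {β β' : Fin n → Module.Dual ℂ h}

namespace ChevalleySystem

theorem coroot_mem_span (C : ChevalleySystem H β) (C' : ChevalleySystem H β')
    (hβ : LinearIndependent ℂ β) (hH : Function.Injective H) (i : Fin n) :
    C'.coroot i ∈ Submodule.span ℂ (Set.range C.coroot) :=
  C.mem_span_coroot hβ hH (C'.bracket_self i)

/-- An element of `h` killed by all `β i` centralises the generators, hence everything, in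
particular `C'.e j`. This vector is nonzero because its coroot is, so `β' j` vanishes there too;
duality gives the claim. -/
theorem root_mem_span (C : ChevalleySystem H β) (C' : ChevalleySystem H β')
    (hH : Function.Injective H) {j : Fin n} (hj : C'.coroot j ≠ 0) :
    β' j ∈ Submodule.span ℂ (Set.range β) := by
  refine mem_span_of_iInf_ker_le_ker fun c hc => ?_
  simp only [Submodule.mem_iInf, LinearMap.mem_ker] at hc ⊢
  have h1 : LinearMap.ker (bracket (H c)) = ⊤ := by
    refine C.generate _ (fun x hx y hy => ?_) (fun t => ?_) (fun i => ?_) (fun i => ?_)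
    · rw [LinearMap.mem_ker] at *
      rw [bracket_derivation (C.H_even c), hx, hy, map_zero, map_zero, LinearMap.zero_apply,
        add_zero]
    · exact C.H_comm c t
    · rw [LinearMap.mem_ker, C.e_mem i c, hc i, zero_smul]
    · rw [LinearMap.mem_ker, C.f_mem i c, LinearMap.neg_apply, hc i, neg_zero, zero_smul]
  have h2 : bracket (H c) (C'.e j) = 0 := (h1 ▸ Submodule.mem_top : C'.e j ∈ LinearMap.ker _)
  rw [C'.e_mem j c, smul_eq_zero] at h2
  refine h2.resolve_right fun he => hj ?_
  have h3 := C'.bracket_self j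
  rw [he, map_zero, LinearMap.zero_apply] at h3
  exact (map_eq_zero_iff H hH).1 h3.symm

/-- The `n` independent coroots of `C` lie in the span of the `n` coroots of `C'`. -/
theorem coroot_linearIndependent (C : ChevalleySystem H β) (C' : ChevalleySystem H β')
    [FiniteDimensional ℂ h] (hβ' : LinearIndependent ℂ β') (hH : Function.Injective H)
    (hC : LinearIndependent ℂ C.coroot) : LinearIndependent ℂ C'.coroot := by
  rw [linearIndependent_iff_card_le_finrank_span]
  rw [linearIndependent_iff_card_le_finrank_span] at hC
  refine hC.trans (Submodule.finrank_mono (Submodule.span_le.2 ?_))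
  rintro _ ⟨i, rfl⟩
  exact C'.coroot_mem_span C hβ' hH i

end ChevalleySystem
end Compare

/-! ### The Cartan data of ordered root bases -/

section Bases

variable {n : ℕ} {h : Type u} [AddCommGroup h] [Module ℂ h] {D : CartanDatum n}
  {R : MinimalRealization D.B h}

theorem G.ofH_even (t : h) : G.ofH D.τ R t ∈ part (L := G D.τ R) 0 :=
  (G.chevalley D.τ R).H_even t

namespace OrderedRootBase

variable (x : OrderedRootBase D R)

/-- The Chevalley generators of an ordered root base. -/
def system : ChevalleySystem (G.ofH D.τ R) x.root where
  e := x.gens.e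
  f := x.gens.f
  coroot := x.gens.coroot
  parity := x.gens.parity
  H_even := G.ofH_even
  H_comm := (G.chevalley D.τ R).H_comm
  e_mem := x.gens.e_mem
  f_mem := x.gens.f_mem
  e_parity := x.gens.e_parity
  f_parity := x.gens.f_parity
  bracket_ne := x.gens.bracket_ne
  bracket_self := x.gens.bracket_self
  generate := x.gens.generate

theorem coroot_linearIndependent : LinearIndependent ℂ x.gens.coroot := by
  have := R.finiteDimensional
  exact (G.chevalley D.τ R).coroot_linearIndependent x.system x.linearIndependent
    (G.ofH_injective D.τ R) R.coroot_linearIndependent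

/-- The simple roots of any two bases have the same span, and so do the coroots. The equality of
ranks is what makes `h` a minimal realization for the new datum as well. -/
theorem rank_datum : x.datum.B.rank = D.B.rank := by
  have hB : D.B = Matrix.of fun i j => R.root j (R.coroot i) := by
    ext i j
    exact (R.pairing i j).symm
  have hH := G.ofH_injective D.τ R
  rw [hB]
  apply le_antisymm
  · exact rank_pairing_le
      ((G.chevalley D.τ R).coroot_mem_span x.system R.root_linearIndependent hH)
      (fun i => (G.chevalley D.τ R).root_mem_span x.system hH (x.coroot_linearIndependent.ne_zero i))
  · exact rank_pairing_le
      (x.system.coroot_mem_span (G.chevalley D.τ R) x.linearIndependent hH)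
      (fun i => x.system.root_mem_span (G.chevalley D.τ R) hH (R.coroot_linearIndependent.ne_zero i))

/-- The minimal realization given by an ordered root base. -/
def realization : MinimalRealization x.datum.B h where
  root := x.root
  coroot := x.gens.coroot
  finiteDimensional := R.finiteDimensional
  finrank_eq := by rw [x.rank_datum, R.finrank_eq]
  root_linearIndependent := x.linearIndependent
  coroot_linearIndependent := x.coroot_linearIndependent
  pairing _ _ := rfl

/-- The superalgebra is itself the contragredient superalgebra of the datum of `x`, realized on the
same `h`, so the regularity hypothesis covers this datum. -/
theorem datum_isRegular (hreg : IsRegularLSA D R) : x.datum.IsRegular :=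
  hreg n x.datum h x.realization (x.system.isIsomorphic x.realization rfl rfl
    (G.ofH_injective D.τ R) (G.eq_bot_of_isIdeal D.τ R))

end OrderedRootBase
end Bases

namespace ChevalleySystem

/-! ### Serre relations and local nilpotence -/

variable {n : ℕ} {h : Type u} [AddCommGroup h] [Module ℂ h] {L : Type v}
  [AddCommGroup L] [Module ℂ L] [LieSuperalgebra L] {H : h →ₗ[ℂ] L}
  {β : Fin n → Module.Dual ℂ h} (C : ChevalleySystem H β)

/-- The conditions on the row `i` of the Cartan datum that make `e i` act locally nilpotently. -/
structure IsIntegrableAt (i : Fin n) : Prop where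
  self_ne_zero : β i (C.coroot i) ≠ 0
  zero_of_zero : ∀ j, j ≠ i → β j (C.coroot i) = 0 → β i (C.coroot j) = 0
  even_int : C.parity i = 0 → ∀ j, j ≠ i →
    ∃ k : ℕ, 2 * β j (C.coroot i) = -(k : ℂ) * β i (C.coroot i)
  odd_int : C.parity i = 1 → ∀ j, j ≠ i →
    ∃ k : ℕ, β j (C.coroot i) = -(k : ℂ) * β i (C.coroot i)

theorem IsIntegrableAt.swap {C : ChevalleySystem H β} {i : Fin n} (hi : C.IsIntegrableAt i) :
    C.swap.IsIntegrableAt i := by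
  have key : ∀ j k, (-β) j (C.swap.coroot k) = -C.oppSign k * β j (C.coroot k) := by
    intro j k
    change -(β j) (C.oppSign k • C.coroot k) = _
    rw [map_smul, smul_eq_mul]
    ring
  refine ⟨?_, fun j hj => ?_, fun hp j hj => ?_, fun hp j hj => ?_⟩
  · rw [key]
    exact mul_ne_zero (neg_ne_zero.2 (C.oppSign_ne_zero i)) hi.self_ne_zero
  · rw [key, key]
    intro h0
    rw [hi.zero_of_zero j hj
      ((mul_eq_zero.1 h0).resolve_left (neg_ne_zero.2 (C.oppSign_ne_zero i))), mul_zero]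
  · obtain ⟨k, hk⟩ := hi.even_int hp j hj
    exact ⟨k, by rw [key, key]; linear_combination -C.oppSign i * hk⟩
  · obtain ⟨k, hk⟩ := hi.odd_int hp j hj
    exact ⟨k, by rw [key, key]; linear_combination -C.oppSign i * hk⟩

/-- The adjoint action of a positive generator. -/
def adE (i : Fin n) : Module.End ℂ L := bracket (C.e i)

theorem adE_apply (i : Fin n) (x : L) : C.adE i x = bracket (C.e i) x := rfl

theorem adE_pow_succ (i : Fin n) (m : ℕ) (x : L) :
    (C.adE i ^ (m + 1)) x = bracket (C.e i) ((C.adE i ^ m) x) := by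
  rw [pow_succ', Module.End.mul_apply, adE_apply]

theorem adE_pow_mem_part (i : Fin n) (m : ℕ) {s : ZMod 2} {x : L} (hx : x ∈ part (L := L) s) :
    ∃ t, (C.adE i ^ m) x ∈ part (L := L) t := by
  induction m with
  | zero => exact ⟨s, hx⟩
  | succ m ih =>
    obtain ⟨t, ht⟩ := ih
    exact ⟨_, by rw [adE_pow_succ]; exact bracket_mem (C.e_parity i) ht⟩

theorem adE_pow_mem_wtSpace (i : Fin n) (m : ℕ) {γ : Module.Dual ℂ h} {x : L}
    (hx : x ∈ wtSpace H γ) : (C.adE i ^ m) x ∈ wtSpace H ((m : ℂ) • β i + γ) := by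
  induction m with
  | zero => simpa using hx
  | succ m ih =>
    rw [adE_pow_succ]
    have := bracket_mem_wtSpace C.H_even (C.e_mem i) ih
    convert this using 2
    push_cast
    module

theorem adE_pow_zero (i : Fin n) {m m' : ℕ} (hm : m ≤ m') {x : L} (hx : (C.adE i ^ m) x = 0) :
    (C.adE i ^ m') x = 0 := by
  obtain ⟨k, rfl⟩ := Nat.exists_eq_add_of_le hm
  rw [add_comm, pow_add, Module.End.mul_apply, hx, map_zero]

theorem bracket_f_adE_pow (i k : Fin n) (hki : k ≠ i) (m : ℕ) (x : L) :
    bracket (C.f k) ((C.adE i ^ m) x) =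
      koszul (C.parity k) (C.parity i) ^ m • (C.adE i ^ m) (bracket (C.f k) x) := by
  induction m with
  | zero => simp
  | succ m ih =>
    rw [adE_pow_succ, jacobi_of_mem (C.f_parity k) (C.e_parity i), C.bracket_f_e_ne k i hki,
      map_zero, LinearMap.zero_apply, zero_add, ih, map_smul, adE_pow_succ, smul_smul, pow_succ']

theorem adE_sq_e (i : Fin n) : (C.adE i ^ 2) (C.e i) = 0 := by
  rw [adE_pow_succ, adE_pow_succ, pow_zero, Module.End.one_apply]
  exact bracket_self_self (C.e_parity i)

theorem adE_e_of_even {i : Fin n} (hp : C.parity i = 0) : C.adE i (C.e i) = 0 :=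
  bracket_self_even (hp ▸ C.e_parity i)

theorem adE_H (i : Fin n) (t : h) : C.adE i (H t) = -(β i t) • C.e i := C.bracket_e_H i t

theorem adE_cube_H (i : Fin n) (t : h) : (C.adE i ^ 3) (H t) = 0 := by
  rw [pow_succ, Module.End.mul_apply, adE_H, map_smul, adE_sq_e, smul_zero]

theorem bracket_coroot_adE_pow (i j : Fin n) (m : ℕ) :
    bracket (H (C.coroot i)) ((C.adE i ^ m) (C.e j)) =
      ((m : ℂ) * β i (C.coroot i) + β j (C.coroot i)) • (C.adE i ^ m) (C.e j) := by
  rw [C.adE_pow_mem_wtSpace i m (C.e_mem j) (C.coroot i)]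
  simp

/-- The `sl(2)` computation along the `e i`-string through `e j`. The coefficient vanishes at `m =
-2 b_ij / b_ii`. -/
theorem bracket_f_adE_pow_even {i j : Fin n} (hij : j ≠ i) (hp : C.parity i = 0) (m : ℕ) :
    bracket (C.f i) ((C.adE i ^ (m + 1)) (C.e j)) =
      -((m + 1) * (β j (C.coroot i) + m * β i (C.coroot i) / 2)) • (C.adE i ^ m) (C.e j) := by
  have hs : C.oppSign i = -1 := by rw [oppSign, hp, koszul_zero_left]
  have step : ∀ z, bracket (C.f i) (bracket (C.e i) z) =
      -bracket (H (C.coroot i)) z + bracket (C.e i) (bracket (C.f i) z) := by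
    intro z
    rw [jacobi_of_mem (C.f_parity i) (C.e_parity i), C.bracket_f_e, hs, hp, koszul_zero_left,
      map_smul, map_smul]
    simp
  induction m with
  | zero =>
    rw [adE_pow_succ, step, bracket_coroot_adE_pow, pow_zero, Module.End.one_apply,
      C.bracket_f_e_ne i j hij.symm, map_zero]
    simp
  | succ m ih =>
    rw [adE_pow_succ, step, ih, bracket_coroot_adE_pow, map_smul, ← adE_pow_succ]
    push_cast
    module

/-- The analogue for `osp(1|2)`, where odd and even powers alternate. The first coefficient vanishes
at `m = -b_ij / b_ii`, which is why the odd integrality condition has an extra factor two. -/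
theorem bracket_f_adE_pow_odd {i j : Fin n} (hij : j ≠ i) (hp : C.parity i = 1) (m : ℕ) :
    bracket (C.f i) ((C.adE i ^ (2 * m + 1)) (C.e j)) =
      (β j (C.coroot i) + m * β i (C.coroot i)) • (C.adE i ^ (2 * m)) (C.e j) ∧
    bracket (C.f i) ((C.adE i ^ (2 * m + 2)) (C.e j)) =
      ((m + 1) * β i (C.coroot i)) • (C.adE i ^ (2 * m + 1)) (C.e j) := by
  have hk : koszul 1 1 = -1 := by simp [koszul]
  have hs : C.oppSign i = 1 := by rw [oppSign, hp, hk, neg_neg]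
  have step : ∀ z, bracket (C.f i) (bracket (C.e i) z) =
      bracket (H (C.coroot i)) z - bracket (C.e i) (bracket (C.f i) z) := by
    intro z
    rw [jacobi_of_mem (C.f_parity i) (C.e_parity i), C.bracket_f_e, hs, hp, hk, one_smul,
      neg_one_smul, sub_eq_add_neg]
  have next : ∀ m : ℕ, bracket (C.f i) ((C.adE i ^ (2 * m + 1)) (C.e j)) =
      (β j (C.coroot i) + m * β i (C.coroot i)) • (C.adE i ^ (2 * m)) (C.e j) →
      bracket (C.f i) ((C.adE i ^ (2 * m + 2)) (C.e j)) =
      ((m + 1) * β i (C.coroot i)) • (C.adE i ^ (2 * m + 1)) (C.e j) := by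
    intro m hm
    rw [adE_pow_succ, step, hm, bracket_coroot_adE_pow, map_smul, ← adE_pow_succ]
    push_cast
    module
  have first : ∀ m : ℕ, bracket (C.f i) ((C.adE i ^ (2 * m + 1)) (C.e j)) =
      (β j (C.coroot i) + m * β i (C.coroot i)) • (C.adE i ^ (2 * m)) (C.e j) := by
    intro m
    induction m with
    | zero =>
      rw [adE_pow_succ, step, bracket_coroot_adE_pow, Nat.mul_zero, pow_zero,
        Module.End.one_apply, C.bracket_f_e_ne i j hij.symm, map_zero]
      simp
    | succ m ih =>
      have h2 := next m ih
      rw [show 2 * (m + 1) = 2 * m + 2 from rfl, adE_pow_succ, step, h2, bracket_coroot_adE_pow,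
        map_smul, ← adE_pow_succ]
      push_cast
      module
  exact ⟨first m, next m (first m)⟩

section Serre

variable (hβ : LinearIndependent ℂ β)
  (hrad : ∀ I : Submodule ℂ L, IsIdeal I → I ⊓ LinearMap.range H = ⊥ → I = ⊥)
include hβ hrad

/-- The vector has positive weight, so it vanishes once every `f k` kills it. Those with `k ≠ i, j`
do so automatically, and `f j` replaces the inner `e j` by a multiple of its coroot; this leaves the
two hypotheses. -/
theorem adE_pow_eq_zero {i j : Fin n} (hij : j ≠ i) {m : ℕ}
    (hi : bracket (C.f i) ((C.adE i ^ m) (C.e j)) = 0)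
    (hj : (C.adE i ^ m) (H (C.coroot j)) = 0) : (C.adE i ^ m) (C.e j) = 0 := by
  obtain ⟨s, hs⟩ := C.adE_pow_mem_part i m (C.e_parity j)
  refine C.eq_zero_of_bracket_f_eq_zero hβ hrad (l := List.replicate m i ++ [j]) (by simp) ?_ hs
    fun k => ?_
  · have := C.adE_pow_mem_wtSpace i m (C.e_mem j)
    convert this using 2
    rw [listWt_append, listWt_singleton]
    simp [listWt, Nat.cast_smul_eq_nsmul]
  · by_cases hki : k = i
    · rw [hki, hi]
    · rw [C.bracket_f_adE_pow i k hki]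
      by_cases hkj : k = j
      · subst hkj
        rw [C.bracket_f_e, map_smul, map_smul, hj, smul_zero, smul_zero]
      · rw [C.bracket_f_e_ne k j hkj, map_zero, smul_zero]

/-- The Serre relations, in the form of the nilpotence of `ad (e i)` on the generators. -/
theorem exists_adE_pow_e {i : Fin n} (hint : C.IsIntegrableAt i) (j : Fin n) :
    ∃ m, (C.adE i ^ m) (C.e j) = 0 := by
  by_cases hij : j = i
  · subst hij
    exact ⟨2, C.adE_sq_e j⟩
  rcases parity_cases (C.parity i) with hp | hp
  · obtain ⟨k, hk⟩ := hint.even_int hp j hij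
    refine ⟨k + 1, C.adE_pow_eq_zero hβ hrad hij ?_ ?_⟩
    · rw [C.bracket_f_adE_pow_even hij hp]
      have : β j (C.coroot i) + k * β i (C.coroot i) / 2 = 0 := by linear_combination hk / 2
      rw [this, mul_zero, neg_zero, zero_smul]
    · rw [pow_succ, Module.End.mul_apply, adE_H]
      -- For exponent one, `b_ij = 0` forces `b_ji = 0`, so `e i` already commutes with the coroot.
      -- For larger exponents `[e i, e i] = 0` suffices.
      cases k with
      | zero =>
        have h0 : β j (C.coroot i) = 0 := by
          have : 2 * β j (C.coroot i) = 0 := by rw [hk]; simp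
          simpa using this
        rw [hint.zero_of_zero j hij h0, neg_zero, zero_smul, map_zero]
      | succ k =>
        rw [pow_succ, Module.End.mul_apply, map_smul, C.adE_e_of_even hp, smul_zero, map_zero]
  · obtain ⟨k, hk⟩ := hint.odd_int hp j hij
    refine ⟨2 * k + 1, C.adE_pow_eq_zero hβ hrad hij ?_ ?_⟩
    · rw [(C.bracket_f_adE_pow_odd hij hp k).1]
      have : β j (C.coroot i) + k * β i (C.coroot i) = 0 := by linear_combination hk
      rw [this, zero_smul]
    · cases k with
      | zero =>
        have h0 : β j (C.coroot i) = 0 := by rw [hk]; simp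
        rw [Nat.mul_zero, zero_add, pow_one, adE_H, hint.zero_of_zero j hij h0, neg_zero, zero_smul]
      | succ k => exact C.adE_pow_zero i (by omega) (C.adE_cube_H i _)

end Serre

theorem exists_adE_pow_f (i j : Fin n) : ∃ m, (C.adE i ^ m) (C.f j) = 0 := by
  by_cases hij : i = j
  · subst hij
    refine ⟨4, ?_⟩
    rw [pow_succ, Module.End.mul_apply, adE_apply, C.bracket_self, adE_cube_H]
  · exact ⟨1, by rw [pow_one, adE_apply, C.bracket_ne i j hij]⟩

end ChevalleySystem

/-! ### Locally nilpotent derivations -/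

section LocallyNilpotent

variable {L : Type v} [AddCommGroup L] [Module ℂ L]

/-- Locally nilpotent endomorphisms. -/
def IsLocNilpotent (X : Module.End ℂ L) : Prop := ∀ x, ∃ m, (X ^ m) x = 0

theorem pow_apply_eq_zero_of_le {X : Module.End ℂ L} {m m' : ℕ} (hm : m ≤ m') {x : L}
    (hx : (X ^ m) x = 0) : (X ^ m') x = 0 := by
  obtain ⟨k, rfl⟩ := Nat.exists_eq_add_of_le hm
  rw [add_comm, pow_add, Module.End.mul_apply, hx, map_zero]

/-- In the Leibniz expansion of the power `m + k`, every term has at least `m` factors on `x` or at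
least `k` on `y`. -/
theorem pow_bracket_eq_zero [SuperAlg L] {X : Module.End ℂ L}
    (hX : ∀ x y, X (bracket x y) = bracket (X x) y + bracket x (X y)) (N : ℕ) :
    ∀ (m k : ℕ) (x y : L), m + k = N → (X ^ m) x = 0 → (X ^ k) y = 0 →
      (X ^ N) (bracket x y) = 0 := by
  induction N with
  | zero =>
    intro m k x y hmk hx _
    obtain rfl : m = 0 := by omega
    rw [pow_zero, Module.End.one_apply] at hx
    rw [hx]; simp
  | succ N ih =>
    intro m k x y hmk hx hy
    rw [pow_succ, Module.End.mul_apply, hX, map_add]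
    have h1 : (X ^ N) (bracket (X x) y) = 0 := by
      cases m with
      | zero =>
        rw [pow_zero, Module.End.one_apply] at hx
        rw [hx]; simp
      | succ m =>
        rw [pow_succ, Module.End.mul_apply] at hx
        exact ih m k _ _ (by omega) hx hy
    have h2 : (X ^ N) (bracket x (X y)) = 0 := by
      cases k with
      | zero =>
        rw [pow_zero, Module.End.one_apply] at hy
        rw [hy]; simp
      | succ k =>
        rw [pow_succ, Module.End.mul_apply] at hy
        exact ih m k _ _ (by omega) hx hy
    rw [h1, h2, add_zero]

variable [LieSuperalgebra L]

/-- For a derivation, the elements killed by some power form a subalgebra, so only generators need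
to be tested. -/
theorem ChevalleySystem.isLocNilpotent {n : ℕ} {h : Type u} [AddCommGroup h] [Module ℂ h]
    {H : h →ₗ[ℂ] L} {β : Fin n → Module.Dual ℂ h} (C : ChevalleySystem H β) {X : Module.End ℂ L}
    (hX : ∀ x y, X (bracket x y) = bracket (X x) y + bracket x (X y))
    (hH : ∀ t, ∃ m, (X ^ m) (H t) = 0) (he : ∀ i, ∃ m, (X ^ m) (C.e i) = 0)
    (hf : ∀ i, ∃ m, (X ^ m) (C.f i) = 0) : IsLocNilpotent X := by
  let Z : Submodule ℂ L :=
    { carrier := {x | ∃ m, (X ^ m) x = 0}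
      add_mem' := by
        rintro x y ⟨m, hm⟩ ⟨k, hk⟩
        refine ⟨m + k, ?_⟩
        rw [map_add, pow_apply_eq_zero_of_le (Nat.le_add_right m k) hm,
          pow_apply_eq_zero_of_le (Nat.le_add_left k m) hk, add_zero]
      zero_mem' := ⟨0, map_zero _⟩
      smul_mem' := by
        rintro c x ⟨m, hm⟩
        exact ⟨m, by rw [map_smul, hm, smul_zero]⟩ }
  have hZ : Z = ⊤ := by
    refine C.generate Z ?_ hH he hf
    rintro x ⟨m, hm⟩ y ⟨k, hk⟩
    exact ⟨m + k, pow_bracket_eq_zero hX _ m k x y rfl hm hk⟩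
  intro x
  exact (hZ ▸ Submodule.mem_top : x ∈ Z)

end LocallyNilpotent

namespace ChevalleySystem

variable {n : ℕ} {h : Type u} [AddCommGroup h] [Module ℂ h] {L : Type v}
  [AddCommGroup L] [Module ℂ L] [LieSuperalgebra L] {H : h →ₗ[ℂ] L}
  {β : Fin n → Module.Dual ℂ h} (C : ChevalleySystem H β)

/-- The even positive root vector that belongs to the simple root `i`. -/
def evenE (i : Fin n) : L := if C.parity i = 0 then C.e i else bracket (C.e i) (C.e i)

theorem evenE_mem_part (i : Fin n) : C.evenE i ∈ part (L := L) 0 := by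
  unfold evenE
  split_ifs with hp
  · exact hp ▸ C.e_parity i
  · exact bracket_self_mem (C.e_parity i)

theorem exists_evenE_pow (i : Fin n) {x : L} (hx : ∃ m, (C.adE i ^ m) x = 0) :
    ∃ m, ((bracket (C.evenE i) : Module.End ℂ L) ^ m) x = 0 := by
  obtain ⟨m, hm⟩ := hx
  refine ⟨m, ?_⟩
  unfold evenE
  split_ifs with hp
  · exact hm
  · have hp' : C.parity i = 1 := (parity_cases _).resolve_left hp
    have h1 : (bracket (bracket (C.e i) (C.e i)) : Module.End ℂ L) = (2 : ℂ) • C.adE i ^ 2 := by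
      refine LinearMap.ext fun z => ?_
      rw [bracket_bracket_odd (hp' ▸ C.e_parity i), LinearMap.smul_apply, adE_pow_succ,
        adE_pow_succ]
      rfl
    rw [h1, smul_pow, LinearMap.smul_apply, ← pow_mul, C.adE_pow_zero i (by omega) hm, smul_zero]

theorem evenE_isLocNilpotent (hβ : LinearIndependent ℂ β)
    (hrad : ∀ I : Submodule ℂ L, IsIdeal I → I ⊓ LinearMap.range H = ⊥ → I = ⊥)
    {i : Fin n} (hint : C.IsIntegrableAt i) :
    IsLocNilpotent (bracket (C.evenE i) : Module.End ℂ L) :=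
  C.isLocNilpotent (fun x y => bracket_derivation (C.evenE_mem_part i) x y)
    (fun t => C.exists_evenE_pow i ⟨3, C.adE_cube_H i t⟩)
    (fun j => C.exists_evenE_pow i (C.exists_adE_pow_e hβ hrad hint j))
    (fun j => C.exists_evenE_pow i (C.exists_adE_pow_f i j))

end ChevalleySystem

/-! ### Exponentials of locally nilpotent derivations -/

section Exponential

/-- Up to `N + N` the antidiagonals cover the square, and the terms outside the square vanish. This
is the rearrangement behind products of exponential series. -/
theorem sum_product_eq_sum_antidiagonal {M : Type v} [AddCommMonoid M] {N : ℕ} (g : ℕ × ℕ → M)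
    (hg : ∀ p : ℕ × ℕ, N ≤ p.1 ∨ N ≤ p.2 → g p = 0) :
    ∑ p ∈ Finset.range N ×ˢ Finset.range N, g p =
      ∑ k ∈ Finset.range (N + N), ∑ p ∈ Finset.HasAntidiagonal.antidiagonal k, g p := by
  rw [← Finset.sum_fiberwise_of_maps_to (t := Finset.range (N + N)) (g := fun p => p.1 + p.2)
    (fun p hp => by
      simp only [Finset.mem_product, Finset.mem_range] at hp ⊢
      omega)]
  refine Finset.sum_congr rfl fun k _ => Finset.sum_subset (fun p hp => ?_) fun p hp hp' => ?_
  · simpa using (Finset.mem_filter.1 hp).2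
  · refine hg p ?_
    by_contra! hcon
    refine hp' (Finset.mem_filter.2 ⟨?_, Finset.HasAntidiagonal.mem_antidiagonal.1 hp⟩)
    simpa using hcon

variable {L : Type v} [AddCommGroup L] [Module ℂ L]

/-- The divided powers of an endomorphism. -/
def divPow (X : Module.End ℂ L) (k : ℕ) : Module.End ℂ L := (k.factorial : ℂ)⁻¹ • X ^ k

theorem divPow_apply (X : Module.End ℂ L) (k : ℕ) (x : L) :
    divPow X k x = (k.factorial : ℂ)⁻¹ • (X ^ k) x := rfl

theorem divPow_apply_eq_zero {X : Module.End ℂ L} {m : ℕ} {x : L} (hx : (X ^ m) x = 0) {k : ℕ}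
    (hk : m ≤ k) : divPow X k x = 0 := by
  rw [divPow_apply, pow_apply_eq_zero_of_le hk hx, smul_zero]

/-- The exponential series. It is a finite sum at the elements annihilated by a power of `X`. -/
def expFun (X : Module.End ℂ L) (x : L) : L := ∑ᶠ k, divPow X k x

theorem expFun_eq_sum {X : Module.End ℂ L} {m : ℕ} {x : L} (hx : (X ^ m) x = 0) :
    expFun X x = ∑ k ∈ Finset.range m, divPow X k x := by
  refine finsum_eq_sum_of_support_subset _ fun k hk => ?_
  rw [Finset.coe_range, Set.mem_Iio]
  by_contra! hcon
  exact hk (divPow_apply_eq_zero hx hcon)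

theorem expFun_add {X : Module.End ℂ L} (hX : IsLocNilpotent X) (x y : L) :
    expFun X (x + y) = expFun X x + expFun X y := by
  obtain ⟨m, hm⟩ := hX x
  obtain ⟨k, hk⟩ := hX y
  have h1 := pow_apply_eq_zero_of_le (Nat.le_add_right m k) hm
  have h2 := pow_apply_eq_zero_of_le (Nat.le_add_left k m) hk
  rw [expFun_eq_sum h1, expFun_eq_sum h2, expFun_eq_sum (m := m + k) (by rw [map_add, h1, h2, add_zero]),
    ← Finset.sum_add_distrib]
  simp only [map_add]

theorem expFun_smul {X : Module.End ℂ L} (hX : IsLocNilpotent X) (c : ℂ) (x : L) :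
    expFun X (c • x) = c • expFun X x := by
  obtain ⟨m, hm⟩ := hX x
  rw [expFun_eq_sum hm, expFun_eq_sum (m := m) (by rw [map_smul, hm, smul_zero]), Finset.smul_sum]
  simp only [map_smul]

theorem divPow_neg (X : Module.End ℂ L) (k : ℕ) : divPow (-X) k = (-1 : ℂ) ^ k • divPow X k := by
  rw [divPow, divPow, neg_pow, smul_comm]
  rcases Nat.even_or_odd k with hk | hk
  · simp [hk.neg_one_pow]
  · simp [hk.neg_one_pow]

theorem divPow_mul_divPow (X : Module.End ℂ L) (i j : ℕ) :
    divPow X i * divPow X j = ((i + j).choose i : ℂ) • divPow X (i + j) := by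
  rw [divPow, divPow, divPow, smul_mul_smul_comm, ← pow_add, smul_smul]
  congr 1
  rw [Nat.cast_add_choose]
  have h1 : ((i + j).factorial : ℂ) ≠ 0 := Nat.cast_ne_zero.2 (Nat.factorial_ne_zero _)
  have h2 : (i.factorial : ℂ) ≠ 0 := Nat.cast_ne_zero.2 (Nat.factorial_ne_zero _)
  have h3 : (j.factorial : ℂ) ≠ 0 := Nat.cast_ne_zero.2 (Nat.factorial_ne_zero _)
  field_simp

theorem IsLocNilpotent.neg {X : Module.End ℂ L} (hX : IsLocNilpotent X) : IsLocNilpotent (-X) := by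
  intro x
  obtain ⟨m, hm⟩ := hX x
  refine ⟨m, ?_⟩
  rcases Nat.even_or_odd m with hk | hk
  · rw [hk.neg_pow, hm]
  · rw [hk.neg_pow, LinearMap.neg_apply, hm, neg_zero]

theorem IsLocNilpotent.smul {X : Module.End ℂ L}
    (hX : IsLocNilpotent X) (c : ℂ) : IsLocNilpotent (c • X) := by
  intro x
  obtain ⟨m, hm⟩ := hX x
  exact ⟨m, by rw [smul_pow, LinearMap.smul_apply, hm, smul_zero]⟩

theorem divPow_mul_comm (X : Module.End ℂ L) (i j : ℕ) :
    divPow X i * divPow X j = divPow X j * divPow X i := by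
  rw [divPow, divPow, smul_mul_smul_comm, smul_mul_smul_comm, ← pow_add, ← pow_add, add_comm,
    mul_comm]

theorem pow_divPow_apply_eq_zero {X : Module.End ℂ L} {m : ℕ} {x : L} (hx : (X ^ m) x = 0) (k : ℕ) :
    (X ^ m) (divPow X k x) = 0 := by
  rw [divPow_apply, map_smul, ← Module.End.mul_apply, ← pow_add, add_comm, pow_add,
    Module.End.mul_apply, hx, map_zero, smul_zero]

/-- On each antidiagonal the binomial theorem gives `(-1 + 1) ^ k`, so only the term `k = 0`
survives. -/
theorem expFun_neg_expFun {X : Module.End ℂ L} (hX : IsLocNilpotent X) (x : L) :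
    expFun (-X) (expFun X x) = x := by
  obtain ⟨N, hN⟩ := hX x
  have hpow : ∀ {y : L}, (X ^ N) y = 0 → ((-X) ^ N) y = 0 := by
    intro y hy
    rcases Nat.even_or_odd N with hk | hk
    · rw [hk.neg_pow, hy]
    · rw [hk.neg_pow, LinearMap.neg_apply, hy, neg_zero]
  have h1 : (X ^ N) (expFun X x) = 0 := by
    rw [expFun_eq_sum hN, map_sum]
    exact Finset.sum_eq_zero fun k _ => pow_divPow_apply_eq_zero hN k
  rw [expFun_eq_sum (hpow h1), expFun_eq_sum hN]
  simp only [map_sum]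
  rw [← Finset.sum_product' (f := fun i j => divPow (-X) i (divPow X j x)),
    sum_product_eq_sum_antidiagonal]
  · have key : ∀ k, ∑ p ∈ Finset.HasAntidiagonal.antidiagonal k, divPow (-X) p.1 (divPow X p.2 x) =
        if k = 0 then x else 0 := by
      intro k
      have h2 : ∀ p ∈ Finset.HasAntidiagonal.antidiagonal k, divPow (-X) p.1 (divPow X p.2 x) =
          ((-1 : ℂ) ^ p.1 * 1 ^ p.2 * (k.choose p.1 : ℂ)) • divPow X k x := by
        intro p hp
        rw [Finset.HasAntidiagonal.mem_antidiagonal] at hp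
        subst hp
        rw [divPow_neg, LinearMap.smul_apply, ← Module.End.mul_apply, divPow_mul_divPow,
          LinearMap.smul_apply, smul_smul, one_pow, mul_one]
      rw [Finset.sum_congr rfl h2, ← Finset.sum_smul]
      have h3 := add_pow (-1 : ℂ) 1 k
      rw [← Finset.Nat.sum_antidiagonal_eq_sum_range_succ
        (fun i j => (-1 : ℂ) ^ i * 1 ^ j * (k.choose i : ℂ))] at h3
      rw [← h3, neg_add_cancel]
      cases k with
      | zero => simp [divPow]
      | succ k => simp
    simp only [key]
    rw [Finset.sum_ite_eq']
    cases N with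
    | zero => simpa using hN.symm
    | succ N => simp
  · rintro p (hp | hp)
    · rw [divPow_neg, LinearMap.smul_apply, ← Module.End.mul_apply, divPow_mul_comm,
        Module.End.mul_apply, divPow_apply_eq_zero hN hp, map_zero, smul_zero]
    · rw [divPow_apply_eq_zero hN hp, map_zero]

/-- The exponential of a locally nilpotent endomorphism. -/
def expEquiv (X : Module.End ℂ L) (hX : IsLocNilpotent X) : L ≃ₗ[ℂ] L where
  toFun := expFun X
  invFun := expFun (-X)
  map_add' := expFun_add hX
  map_smul' := expFun_smul hX
  left_inv := expFun_neg_expFun hX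
  right_inv x := by
    have := expFun_neg_expFun hX.neg x
    rwa [neg_neg] at this

theorem divPow_succ (X : Module.End ℂ L) (k : ℕ) (x : L) :
    ((k + 1 : ℕ) : ℂ) • divPow X (k + 1) x = X (divPow X k x) := by
  rw [divPow_apply, divPow_apply, map_smul, smul_smul, pow_succ', Module.End.mul_apply,
    Nat.factorial_succ]
  congr 1
  have h1 : (k.factorial : ℂ) ≠ 0 := Nat.cast_ne_zero.2 (Nat.factorial_ne_zero _)
  have h2 : ((k + 1 : ℕ) : ℂ) ≠ 0 := Nat.cast_ne_zero.2 (Nat.succ_ne_zero _)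
  push_cast at *
  field_simp

/-- The Leibniz rule for a derivation, free of binomial coefficients thanks to divided powers. The
induction multiplies by `k + 1 = p.1 + p.2` and lowers one index in each half. -/
theorem divPow_bracket [SuperAlg L] {X : Module.End ℂ L}
    (hX : ∀ x y, X (bracket x y) = bracket (X x) y + bracket x (X y)) (k : ℕ) (x y : L) :
    divPow X k (bracket x y) =
      ∑ p ∈ Finset.HasAntidiagonal.antidiagonal k, bracket (divPow X p.1 x) (divPow X p.2 y) := by
  induction k with
  | zero => simp [divPow]
  | succ k ih =>
    have hk : ((k + 1 : ℕ) : ℂ) ≠ 0 := Nat.cast_ne_zero.2 (Nat.succ_ne_zero _)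
    refine smul_right_injective L hk ?_
    simp only []
    rw [divPow_succ, ih, map_sum]
    simp only [hX, Finset.sum_add_distrib]
    have h1 : ((k + 1 : ℕ) : ℂ) • ∑ p ∈ Finset.HasAntidiagonal.antidiagonal (k + 1),
        bracket (divPow X p.1 x) (divPow X p.2 y) =
        ∑ p ∈ Finset.HasAntidiagonal.antidiagonal (k + 1), (p.1 : ℂ) • bracket (divPow X p.1 x) (divPow X p.2 y) +
        ∑ p ∈ Finset.HasAntidiagonal.antidiagonal (k + 1), (p.2 : ℂ) • bracket (divPow X p.1 x) (divPow X p.2 y) := by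
      rw [← Finset.sum_add_distrib, Finset.smul_sum]
      refine Finset.sum_congr rfl fun p hp => ?_
      rw [← add_smul, ← Nat.cast_add, Finset.HasAntidiagonal.mem_antidiagonal.1 hp]
    rw [h1, Finset.Nat.sum_antidiagonal_succ, Finset.Nat.sum_antidiagonal_succ']
    simp only [Nat.cast_zero, zero_smul, zero_add]
    congr 1
    · refine Finset.sum_congr rfl fun p _ => ?_
      rw [← divPow_succ, map_smul, LinearMap.smul_apply]
    · refine Finset.sum_congr rfl fun p _ => ?_
      rw [← divPow_succ, map_smul]

theorem expFun_bracket [SuperAlg L] {X : Module.End ℂ L} (hloc : IsLocNilpotent X)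
    (hX : ∀ x y, X (bracket x y) = bracket (X x) y + bracket x (X y)) (x y : L) :
    expFun X (bracket x y) = bracket (expFun X x) (expFun X y) := by
  obtain ⟨m, hm⟩ := hloc x
  obtain ⟨k, hk⟩ := hloc y
  have h1 := pow_apply_eq_zero_of_le (Nat.le_add_right m k) hm
  have h2 := pow_apply_eq_zero_of_le (Nat.le_add_left k m) hk
  set N := m + k
  rw [expFun_eq_sum h1, expFun_eq_sum h2,
    expFun_eq_sum (pow_bracket_eq_zero hX (N + N) N N x y rfl h1 h2)]
  simp only [map_sum, LinearMap.sum_apply]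
  rw [Finset.sum_comm,
    ← Finset.sum_product' (f := fun i j => bracket (divPow X i x) (divPow X j y)),
    sum_product_eq_sum_antidiagonal]
  · exact Finset.sum_congr rfl fun k _ => divPow_bracket hX k x y
  · rintro p (hp | hp)
    · rw [divPow_apply_eq_zero h1 hp, map_zero, LinearMap.zero_apply]
    · rw [divPow_apply_eq_zero h2 hp, map_zero]

theorem expFun_two {X : Module.End ℂ L} {x : L} (hx : X (X x) = 0) : expFun X x = x + X x := by
  rw [expFun_eq_sum (m := 2) (by rw [pow_two]; exact hx)]
  simp [Finset.sum_range_succ, divPow]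

theorem expFun_three {X : Module.End ℂ L} {x : L} (hx : X (X (X x)) = 0) :
    expFun X x = x + X x + (1 / 2 : ℂ) • X (X x) := by
  rw [expFun_eq_sum (m := 3) (by rw [pow_succ, pow_two]; exact hx)]
  simp [Finset.sum_range_succ, divPow, pow_two, Nat.factorial]

end Exponential

/-! ### Automorphisms from `sl(2)`-triples -/

section SlTwo

variable {L : Type v} [AddCommGroup L] [Module ℂ L] [LieSuperalgebra L]
  {h : Type u} [AddCommGroup h] [Module ℂ h] {H : h →ₗ[ℂ] L}

/-- The automorphism that belongs to an even root vector pair with locally nilpotent adjoint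
action. It acts on the Cartan subalgebra by a reflection. -/
theorem exists_automorphism_of_slTwo {γ : Module.Dual ℂ h}
    {a b : L} {c : h} (ha : a ∈ part (L := L) 0) (hb : b ∈ part (L := L) 0)
    (haγ : a ∈ wtSpace H γ) (hbγ : b ∈ wtSpace H (-γ)) (hab : bracket a b = H c) (hc : γ c = 2)
    (hna : IsLocNilpotent (bracket a : Module.End ℂ L))
    (hnb : IsLocNilpotent (bracket b : Module.End ℂ L)) :
    ∃ σ : L ≃ₗ[ℂ] L, (∀ x y, σ (bracket x y) = bracket (σ x) (σ y)) ∧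
      ∀ t, σ (H t) = H (t - γ t • c) := by
  have haH : ∀ t, bracket a (H t) = -(γ t • a) := fun t => by
    rw [skew_of_even ha, haγ t]
  have hbH : ∀ t, bracket b (H t) = γ t • b := fun t => by
    rw [skew_of_even hb, hbγ t, LinearMap.neg_apply, neg_smul, neg_neg]
  have hba : bracket b a = -H c := by rw [skew_of_even hb, hab]
  have haa := bracket_self_even ha
  have hbb := bracket_self_even hb
  let X : Module.End ℂ L := bracket a
  let Y : Module.End ℂ L := -(bracket b : Module.End ℂ L)
  have hX : ∀ x y, X (bracket x y) = bracket (X x) y + bracket x (X y) := bracket_derivation ha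
  have hY : ∀ x y, Y (bracket x y) = bracket (Y x) y + bracket x (Y y) := by
    intro x y
    change -(bracket b _) = bracket (-(bracket b x)) y + bracket x (-(bracket b y))
    rw [bracket_derivation hb, map_neg, map_neg, LinearMap.neg_apply, neg_add]
  have hYn : IsLocNilpotent Y := hnb.neg
  let E := expEquiv X hna
  let F := expEquiv Y hYn
  have hEb : ∀ x y, E (bracket x y) = bracket (E x) (E y) := expFun_bracket hna hX
  have hFb : ∀ x y, F (bracket x y) = bracket (F x) (F y) := expFun_bracket hYn hY
  have hXa : X a = 0 := haa
  have hXH : ∀ t, X (H t) = -(γ t • a) := haH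
  have hXb : X b = H c := hab
  have hYa : Y a = H c := by change -(bracket b a) = H c; rw [hba, neg_neg]
  have hYH : ∀ t, Y (H t) = -(γ t • b) := fun t => by
    change -(bracket b (H t)) = _; rw [hbH]
  have hYb : Y b = 0 := by change -(bracket b b) = 0; rw [hbb, neg_zero]
  have hEH : ∀ t, E (H t) = H t - γ t • a := fun t => by
    refine (expFun_two (by rw [hXH, map_neg, map_smul, hXa, smul_zero, neg_zero])).trans ?_
    rw [hXH, sub_eq_add_neg]
  have hEa : E a = a := by
    refine (expFun_two (by rw [hXa, map_zero])).trans ?_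
    rw [hXa, add_zero]
  have hEbb : E b = b + H c - a := by
    refine (expFun_three (by rw [hXb, hXH, map_neg, map_smul, hXa, smul_zero, neg_zero])).trans ?_
    rw [hXb, hXH, hc]
    module
  have hFH : ∀ t, F (H t) = H t - γ t • b := fun t => by
    refine (expFun_two (by rw [hYH, map_neg, map_smul, hYb, smul_zero, neg_zero])).trans ?_
    rw [hYH, sub_eq_add_neg]
  have hFa : F a = a + H c - b := by
    refine (expFun_three (by rw [hYa, hYH, map_neg, map_smul, hYb, smul_zero, neg_zero])).trans ?_
    rw [hYa, hYH, hc]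
    module
  -- The usual lift `exp(ad a) exp(-ad b) exp(ad a)` of a Weyl reflection. On `H t`, `a` and `b` the
  -- series stop after the quadratic term at the latest, so the product is computed exactly.
  refine ⟨(E.trans F).trans E, fun x y => ?_, fun t => ?_⟩
  · simp only [LinearEquiv.trans_apply]
    rw [hEb, hFb, hEb]
  · simp only [LinearEquiv.trans_apply]
    rw [hEH, map_sub, map_smul, hFH, hFa]
    simp only [map_sub, map_add, map_smul, hEH, hEa, hEbb, hc]
    module

end SlTwo

/-! ### Reflections -/

namespace ChevalleySystem

variable {n : ℕ} {h : Type u} [AddCommGroup h] [Module ℂ h] {L : Type v}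
  [AddCommGroup L] [Module ℂ L] [LieSuperalgebra L] {H : h →ₗ[ℂ] L}
  {β : Fin n → Module.Dual ℂ h} (C : ChevalleySystem H β)

/-- For a non-isotropic odd simple root the result is nonzero, so `[e i, e i]` and `[f i, f i]` span
an `sl(2)` with the coroot line of `i`, after rescaling. -/
theorem bracket_double {i : Fin n} (hp : C.parity i = 1) :
    bracket (bracket (C.e i) (C.e i)) (bracket (C.f i) (C.f i)) =
      H ((-4 * β i (C.coroot i)) • C.coroot i) := by
  have hk : koszul 1 1 = -1 := by simp [koszul]
  have h1 : bracket (H (C.coroot i)) (C.f i) = -(β i (C.coroot i)) • C.f i := by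
    rw [C.f_mem i (C.coroot i), LinearMap.neg_apply]
  have h2 : bracket (C.f i) (H (C.coroot i)) = β i (C.coroot i) • C.f i := by
    have := skew_of_even (C.H_even (C.coroot i)) (C.f i)
    rw [h1] at this
    rw [← neg_eq_iff_eq_neg.2 this, neg_smul, neg_neg]
  have h3 : bracket (C.e i) (bracket (C.f i) (C.f i)) = (-2 * β i (C.coroot i)) • C.f i := by
    rw [jacobi_of_mem (C.e_parity i) (C.f_parity i), hp, hk, C.bracket_self, h1, h2]
    module
  rw [bracket_bracket_odd (hp ▸ C.e_parity i), h3, map_smul, C.bracket_self, map_smul]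
  module

/-- The reflection at a non-isotropic simple root lifts to an automorphism. -/
theorem exists_automorphism (hβ : LinearIndependent ℂ β)
    (hrad : ∀ I : Submodule ℂ L, IsIdeal I → I ⊓ LinearMap.range H = ⊥ → I = ⊥)
    {i : Fin n} (hi : C.IsIntegrableAt i) :
    ∃ σ : L ≃ₗ[ℂ] L, (∀ x y, σ (bracket x y) = bracket (σ x) (σ y)) ∧
      ∀ t, σ (H t) = H (t - β i t • (2 / β i (C.coroot i)) • C.coroot i) := by
  set b := β i (C.coroot i) with hb
  have hb0 : b ≠ 0 := hi.self_ne_zero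
  have hE := C.evenE_isLocNilpotent hβ hrad hi
  have hF := C.swap.evenE_isLocNilpotent (linearIndependent_neg_iff.2 hβ) hrad hi.swap
  rcases parity_cases (C.parity i) with hp | hp
  · have hEe : C.evenE i = C.e i := if_pos hp
    have hFf : C.swap.evenE i = C.f i := if_pos hp
    rw [hEe] at hE
    rw [hFf] at hF
    refine exists_automorphism_of_slTwo (γ := β i) (a := C.e i) (b := (2 / b) • C.f i)
      (c := (2 / b) • C.coroot i) (hp ▸ C.e_parity i)
      (Submodule.smul_mem _ _ (hp ▸ C.f_parity i)) (C.e_mem i)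
      (Submodule.smul_mem _ _ (C.f_mem i)) ?_ ?_ hE ?_
    · rw [map_smul, C.bracket_self, map_smul]
    · rw [map_smul, ← hb, smul_eq_mul, div_mul_cancel₀ _ hb0]
    · rw [map_smul]
      exact hF.smul _
  · have hp0 : C.parity i ≠ 0 := by rw [hp]; decide
    have hEe : C.evenE i = bracket (C.e i) (C.e i) := if_neg hp0
    have hFf : C.swap.evenE i = bracket (C.f i) (C.f i) := if_neg hp0
    rw [hEe] at hE
    rw [hFf] at hF
    -- The factor `-1 / (4 b ^ 2)` normalises the bracket from `bracket_double` to `(1 / b)` times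
    -- the coroot, on which `2 β i` takes the value two. Twice the root with half the coroot gives
    -- the same reflection.
    obtain ⟨σ, h1, h2⟩ := exists_automorphism_of_slTwo (H := H) (γ := (2 : ℂ) • β i)
      (a := bracket (C.e i) (C.e i))
      (b := (-1 / (4 * b ^ 2)) • bracket (C.f i) (C.f i)) (c := (1 / b) • C.coroot i)
      (bracket_self_mem (C.e_parity i)) (Submodule.smul_mem _ _ (bracket_self_mem (C.f_parity i)))
      (by rw [two_smul]; exact bracket_mem_wtSpace C.H_even (C.e_mem i) (C.e_mem i))
      (Submodule.smul_mem _ _ (by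
        rw [two_smul, neg_add]; exact bracket_mem_wtSpace C.H_even (C.f_mem i) (C.f_mem i)))
      (by
        rw [map_smul, C.bracket_double hp, ← hb, ← map_smul, smul_smul]
        congr 2
        field_simp)
      (by
        rw [map_smul, LinearMap.smul_apply, ← hb, smul_eq_mul, smul_eq_mul]
        field_simp) hE (by rw [map_smul]; exact hF.smul _)
    refine ⟨σ, h1, fun t => ?_⟩
    rw [h2, LinearMap.smul_apply, smul_smul, smul_smul, smul_eq_mul]
    congr 3
    ring

end ChevalleySystem

/-! ### Reflections of the dual Cartan subalgebra and their lifts -/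

section Reflections

variable {n : ℕ} {h : Type u} [AddCommGroup h] [Module ℂ h] {D : CartanDatum n}
  {R : MinimalRealization D.B h}

theorem IsReflection.mul_self {α : Module.Dual ℂ h} {w : Module.Dual ℂ h ≃ₗ[ℂ] Module.Dual ℂ h}
    (hw : IsReflection D R α w) : w * w = 1 := by
  obtain ⟨c, -, hc, hw⟩ := hw
  refine LinearEquiv.ext fun μ => ?_
  rw [LinearEquiv.mul_apply, hw, hw, LinearMap.sub_apply, LinearMap.smul_apply, hc,
    LinearEquiv.coe_one, id]
  module

theorem IsReflection.apply_self {α : Module.Dual ℂ h}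
    {w : Module.Dual ℂ h ≃ₗ[ℂ] Module.Dual ℂ h} (hw : IsReflection D R α w) : w α = -α := by
  obtain ⟨c, -, hc, hw⟩ := hw
  rw [hw, hc]
  module

/-- The elements of the general linear group of the dual Cartan subalgebra that are induced by
automorphisms of the Lie superalgebra. -/
def IsLiftable (D : CartanDatum n) (R : MinimalRealization D.B h)
    (u : Module.Dual ℂ h ≃ₗ[ℂ] Module.Dual ℂ h) : Prop :=
  ∃ (σ : G D.τ R ≃ₗ[ℂ] G D.τ R) (s : h ≃ₗ[ℂ] h),
    (∀ x y, σ (bracket x y) = bracket (σ x) (σ y)) ∧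
    (∀ t, σ (G.ofH D.τ R t) = G.ofH D.τ R (s t)) ∧ ∀ μ t, (u μ) (s t) = μ t

/-- The subgroup of liftable elements. -/
def liftableSubgroup (D : CartanDatum n) (R : MinimalRealization D.B h) :
    Subgroup (Module.Dual ℂ h ≃ₗ[ℂ] Module.Dual ℂ h) where
  carrier := {u | IsLiftable D R u}
  one_mem' := ⟨LinearEquiv.refl ℂ _, LinearEquiv.refl ℂ _, fun _ _ => rfl, fun _ => rfl,
    fun _ _ => rfl⟩
  mul_mem' := by
    rintro u u' ⟨σ, s, h1, h2, h3⟩ ⟨σ', s', h1', h2', h3'⟩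
    refine ⟨σ'.trans σ, s'.trans s, fun x y => ?_, fun t => ?_, fun μ t => ?_⟩
    · simp only [LinearEquiv.trans_apply, h1', h1]
    · simp only [LinearEquiv.trans_apply, h2', h2]
    · simp only [LinearEquiv.trans_apply, LinearEquiv.mul_apply, h3, h3']
  inv_mem' := by
    rintro u ⟨σ, s, h1, h2, h3⟩
    refine ⟨σ.symm, s.symm, fun x y => ?_, fun t => ?_, fun μ t => ?_⟩
    · rw [LinearEquiv.symm_apply_eq, h1]; simp
    · rw [LinearEquiv.symm_apply_eq, h2]; simp
    · have := h3 (u⁻¹ μ) (s.symm t)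
      rw [LinearEquiv.apply_symm_apply] at this
      rw [← this, ← LinearEquiv.mul_apply, mul_inv_cancel, LinearEquiv.coe_one, id]

theorem mem_rootSpace_of_lift {u : Module.Dual ℂ h ≃ₗ[ℂ] Module.Dual ℂ h}
    {σ : G D.τ R ≃ₗ[ℂ] G D.τ R} {s : h ≃ₗ[ℂ] h}
    (h1 : ∀ x y, σ (bracket x y) = bracket (σ x) (σ y))
    (h2 : ∀ t, σ (G.ofH D.τ R t) = G.ofH D.τ R (s t)) (h3 : ∀ μ t, (u μ) (s t) = μ t)
    {α : Module.Dual ℂ h} {x : G D.τ R} (hx : x ∈ rootSpace D R α) :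
    σ x ∈ rootSpace D R (u α) := by
  intro t
  obtain ⟨t, rfl⟩ := s.surjective t
  rw [← h2, ← h1, hx t, map_smul, h3]

theorem IsLiftable.isRoot {u : Module.Dual ℂ h ≃ₗ[ℂ] Module.Dual ℂ h} (hu : IsLiftable D R u)
    {α : Module.Dual ℂ h} (hα : IsRoot D R α) : IsRoot D R (u α) := by
  obtain ⟨σ, s, h1, h2, h3⟩ := hu
  refine ⟨(LinearEquiv.map_ne_zero_iff u).2 hα.1, ?_⟩
  obtain ⟨x, hx, hx0⟩ := Submodule.exists_mem_ne_zero_of_ne_bot hα.2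
  intro hbot
  have h4 := mem_rootSpace_of_lift h1 h2 h3 hx
  rw [hbot, Submodule.mem_bot, LinearEquiv.map_eq_zero_iff] at h4
  exact hx0 h4

/-- The coroot is pinned down by brackets of root spaces, and a lift `σ` carries these brackets
along; hence liftability of `u` is needed, not just linearity. -/
theorem IsReflection.conj {u : Module.Dual ℂ h ≃ₗ[ℂ] Module.Dual ℂ h} (hu : IsLiftable D R u)
    {α : Module.Dual ℂ h} {w : Module.Dual ℂ h ≃ₗ[ℂ] Module.Dual ℂ h}
    (hw : IsReflection D R α w) : IsReflection D R (u α) (u * w * u⁻¹) := by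
  obtain ⟨σ, s, h1, h2, h3⟩ := hu
  obtain ⟨c, hc, hc2, hw⟩ := hw
  refine ⟨s c, ?_, by rw [h3, hc2], fun μ => ?_⟩
  · rw [← h2]
    have h4 := Submodule.mem_map_of_mem (f := (σ : G D.τ R →ₗ[ℂ] G D.τ R)) hc
    rw [Submodule.map_span] at h4
    refine Submodule.span_mono ?_ h4
    rintro _ ⟨_, ⟨a, ha, b, hb, rfl⟩, rfl⟩
    refine ⟨σ a, mem_rootSpace_of_lift h1 h2 h3 ha, σ b, ?_, h1 a b⟩
    rw [← map_neg]
    exact mem_rootSpace_of_lift h1 h2 h3 hb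
  · rw [LinearEquiv.mul_apply, LinearEquiv.mul_apply, hw, map_sub, map_smul]
    have h5 : u (u⁻¹ μ) = μ := by
      rw [← LinearEquiv.mul_apply, mul_inv_cancel, LinearEquiv.coe_one, id]
    rw [h5, ← h3 (u⁻¹ μ) c, h5]

/-- The reflection with root `α` and coroot `c`. -/
def dualReflection (α : Module.Dual ℂ h) (c : h) (hc : α c = 2) :
    Module.Dual ℂ h ≃ₗ[ℂ] Module.Dual ℂ h :=
  Module.reflection (x := α) (f := Module.Dual.eval ℂ h c) hc

theorem dualReflection_apply {α : Module.Dual ℂ h} {c : h} (hc : α c = 2) (μ : Module.Dual ℂ h) :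
    dualReflection α c hc μ = μ - μ c • α := Module.reflection_apply (f := Module.Dual.eval ℂ h c) _ _

namespace OrderedRootBase

variable (x : OrderedRootBase D R)

theorem datum_B (i j : Fin n) : x.datum.B i j = x.root j (x.gens.coroot i) := rfl

theorem rootSpace_simple (i : Fin n) :
    rootSpace D R (x.root i) = Submodule.span ℂ {x.gens.e i} :=
  x.system.wtSpace_simple x.linearIndependent i

theorem rootSpace_neg_simple (i : Fin n) :
    rootSpace D R (-x.root i) = Submodule.span ℂ {x.gens.f i} :=
  x.system.wtSpace_neg_simple x.linearIndependent i

theorem rootSpace_double_le (i : Fin n) :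
    rootSpace D R ((2 : ℂ) • x.root i) ≤ Submodule.span ℂ {bracket (x.gens.e i) (x.gens.e i)} :=
  x.system.wtSpace_double_le x.linearIndependent i

theorem rootSpace_neg_double_le (i : Fin n) :
    rootSpace D R (-((2 : ℂ) • x.root i)) ≤ Submodule.span ℂ {bracket (x.gens.f i) (x.gens.f i)} :=
  x.system.wtSpace_neg_double_le x.linearIndependent i

theorem span_bracket_le {P Q : Submodule ℂ (G D.τ R)} {a b : G D.τ R}
    (hP : P ≤ Submodule.span ℂ {a}) (hQ : Q ≤ Submodule.span ℂ {b}) :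
    Submodule.span ℂ {z | ∃ a ∈ P, ∃ b ∈ Q, z = bracket a b} ≤ Submodule.span ℂ {bracket a b} := by
  rw [Submodule.span_le]
  rintro _ ⟨a', ha, b', hb, rfl⟩
  obtain ⟨p, rfl⟩ := Submodule.mem_span_singleton.1 (hP ha)
  obtain ⟨q, rfl⟩ := Submodule.mem_span_singleton.1 (hQ hb)
  rw [map_smul, map_smul, LinearMap.smul_apply]
  exact Submodule.smul_mem _ _ (Submodule.smul_mem _ _ (Submodule.mem_span_singleton_self _))

/-- Both root spaces are lines, so their brackets span the line of the coroot, and the normalisation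
to two fixes the scalar. In particular no reflection exists at an isotropic simple root. -/
theorem apply_of_isReflection {i : Fin n} {w : Module.Dual ℂ h ≃ₗ[ℂ] Module.Dual ℂ h}
    (hw : IsReflection D R (x.root i) w) : x.datum.B i i ≠ 0 ∧
      ∀ μ, w μ = μ - μ ((2 / x.datum.B i i) • x.gens.coroot i) • x.root i := by
  obtain ⟨c, hc, hc2, hw⟩ := hw
  have h1 := span_bracket_le (x.rootSpace_simple i).le (x.rootSpace_neg_simple i).le hc
  obtain ⟨k, hk⟩ := Submodule.mem_span_singleton.1 h1
  rw [x.gens.bracket_self, ← map_smul] at hk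
  have h2 := G.ofH_injective D.τ R hk
  rw [← h2, map_smul, ← datum_B, smul_eq_mul] at hc2
  have h3 : x.datum.B i i ≠ 0 := by
    intro h0
    rw [h0, mul_zero] at hc2
    exact two_ne_zero hc2.symm
  have h4 : 2 / x.datum.B i i = k := by rw [← hc2]; field_simp
  exact ⟨h3, by rw [h4, h2]; exact hw⟩

theorem coroot_pairing {i : Fin n} (hi : x.datum.B i i ≠ 0) :
    x.root i ((2 / x.datum.B i i) • x.gens.coroot i) = 2 := by
  rw [map_smul, ← datum_B, smul_eq_mul, div_mul_cancel₀ _ hi]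

/-- The reflection at a non-isotropic simple root. -/
def reflection {i : Fin n} (hi : x.datum.B i i ≠ 0) : Module.Dual ℂ h ≃ₗ[ℂ] Module.Dual ℂ h :=
  dualReflection (x.root i) ((2 / x.datum.B i i) • x.gens.coroot i) (x.coroot_pairing hi)

theorem reflection_apply {i : Fin n} (hi : x.datum.B i i ≠ 0) (μ : Module.Dual ℂ h) :
    x.reflection hi μ = μ - μ ((2 / x.datum.B i i) • x.gens.coroot i) • x.root i :=
  dualReflection_apply _ μ

theorem isReflection_reflection {i : Fin n} (hi : x.datum.B i i ≠ 0) :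
    IsReflection D R (x.root i) (x.reflection hi) := by
  refine ⟨(2 / x.datum.B i i) • x.gens.coroot i, ?_, x.coroot_pairing hi, x.reflection_apply hi⟩
  rw [map_smul, ← x.gens.bracket_self]
  exact Submodule.smul_mem _ _ (Submodule.subset_span
    ⟨_, x.gens.e_mem i, _, x.gens.f_mem i, rfl⟩)

theorem eq_reflection {i : Fin n} {w : Module.Dual ℂ h ≃ₗ[ℂ] Module.Dual ℂ h}
    (hw : IsReflection D R (x.root i) w) :
    w = x.reflection (x.apply_of_isReflection hw).1 := by
  refine LinearEquiv.ext fun μ => ?_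
  rw [x.reflection_apply, (x.apply_of_isReflection hw).2]

theorem isIntegrableAt (hreg : IsRegularLSA D R) {i : Fin n} (hi : x.datum.B i i ≠ 0) :
    x.system.IsIntegrableAt i := by
  have hr := x.datum_isRegular hreg
  refine ⟨hi, fun j _ hj => (hr.zero_iff i j).1 hj, fun hp j hj => ?_, fun hp j hj => ?_⟩
  · obtain ⟨k, hk, hk'⟩ := hr.even_int i hp j hj
    rw [div_eq_iff hi] at hk'
    refine ⟨(-k).toNat, ?_⟩
    have h1 : (((-k).toNat : ℕ) : ℂ) = -(k : ℂ) := by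
      rw [← Int.cast_natCast, Int.toNat_of_nonneg (by omega)]; push_cast; rfl
    rw [h1, neg_neg]
    exact hk'
  · obtain ⟨k, hk, hk'⟩ := hr.odd_int i hp hi j hj
    rw [div_eq_iff hi] at hk'
    refine ⟨(-k).toNat, ?_⟩
    have h1 : (((-k).toNat : ℕ) : ℂ) = -(k : ℂ) := by
      rw [← Int.cast_natCast, Int.toNat_of_nonneg (by omega)]; push_cast; rfl
    rw [h1, neg_neg]
    refine mul_left_cancel₀ (two_ne_zero (α := ℂ)) ?_
    rw [← mul_assoc]
    exact hk'

theorem isLiftable_reflection (hreg : IsRegularLSA D R) {i : Fin n} (hi : x.datum.B i i ≠ 0) :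
    IsLiftable D R (x.reflection hi) := by
  obtain ⟨σ, h1, h2⟩ := x.system.exists_automorphism x.linearIndependent
    (G.eq_bot_of_isIdeal D.τ R) (x.isIntegrableAt hreg hi)
  have h3 := x.coroot_pairing hi
  refine ⟨σ, Module.reflection h3, h1, fun t => ?_, fun μ t => ?_⟩
  · rw [h2, Module.reflection_apply]
    rfl
  · rw [x.reflection_apply hi, Module.reflection_apply, LinearMap.sub_apply, LinearMap.smul_apply,
      map_sub, map_sub, map_smul μ (x.root i t), map_smul (x.root i) (x.root i t), h3]
    simp only [smul_eq_mul]
    ring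

/-- The double of the root has half the coroot, hence the same reflection. It is an even root
because `[e i, e i]` has a nonzero bracket. -/
theorem isReflection_double {i : Fin n} (hp : x.datum.τ i = 1) (hi : x.datum.B i i ≠ 0) :
    IsEvenRoot D R ((2 : ℂ) • x.root i) ∧
      IsReflection D R ((2 : ℂ) • x.root i) (x.reflection hi) := by
  have h0 := x.system.bracket_double (i := i) hp
  have h1 : bracket (bracket (x.gens.e i) (x.gens.e i)) (bracket (x.gens.f i) (x.gens.f i)) =
    G.ofH D.τ R ((-4 * x.datum.B i i) • x.gens.coroot i) := h0
  have he : bracket (x.gens.e i) (x.gens.e i) ∈ rootSpace D R ((2 : ℂ) • x.root i) := by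
    rw [two_smul]
    exact bracket_mem_wtSpace x.system.H_even (x.gens.e_mem i) (x.gens.e_mem i)
  have hf : bracket (x.gens.f i) (x.gens.f i) ∈ rootSpace D R (-((2 : ℂ) • x.root i)) := by
    rw [two_smul, neg_add]
    exact bracket_mem_wtSpace x.system.H_even (x.gens.f_mem i) (x.gens.f_mem i)
  refine ⟨⟨smul_ne_zero two_ne_zero (x.linearIndependent.ne_zero i), fun hbot => ?_⟩, ?_⟩
  · have h2 : bracket (x.gens.e i) (x.gens.e i) ∈
        rootSpace D R ((2 : ℂ) • x.root i) ⊓ part 0 :=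
      ⟨he, bracket_self_mem (x.gens.e_parity i)⟩
    rw [hbot, Submodule.mem_bot] at h2
    rw [h2, map_zero, LinearMap.zero_apply, eq_comm,
      map_eq_zero_iff _ (G.ofH_injective D.τ R), smul_eq_zero] at h1
    rcases h1 with h1 | h1
    · exact mul_ne_zero (by norm_num) hi h1
    · exact x.coroot_linearIndependent.ne_zero i h1
  · refine ⟨(1 / x.datum.B i i) • x.gens.coroot i, ?_, ?_, fun μ => ?_⟩
    · have h2 : (1 / x.datum.B i i) • x.gens.coroot i =
          (-1 / (4 * x.datum.B i i ^ 2)) • (-4 * x.datum.B i i) • x.gens.coroot i := by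
        rw [smul_smul]
        congr 1
        field_simp
      rw [h2, map_smul, ← h1]
      exact Submodule.smul_mem _ _ (Submodule.subset_span ⟨_, he, _, hf, rfl⟩)
    · rw [LinearMap.smul_apply, map_smul, ← datum_B, smul_eq_mul, smul_eq_mul]
      field_simp
    · rw [x.reflection_apply hi, map_smul, map_smul, smul_smul, smul_eq_mul, smul_eq_mul]
      congr 2
      ring

theorem isReflection_of_double {i : Fin n} {w : Module.Dual ℂ h ≃ₗ[ℂ] Module.Dual ℂ h}
    (hw : IsReflection D R ((2 : ℂ) • x.root i) w) : IsReflection D R (x.root i) w := by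
  obtain ⟨c, hc, hc2, hw⟩ := hw
  have h1 := span_bracket_le (x.rootSpace_double_le i) (x.rootSpace_neg_double_le i) hc
  obtain ⟨k, hk⟩ := Submodule.mem_span_singleton.1 h1
  have hc0 : c ≠ 0 := by
    rintro rfl
    rw [map_zero] at hc2
    exact two_ne_zero hc2.symm
  -- For an even generator `[e i, e i] = 0` would force the coroot to vanish; so the generator is
  -- odd, and `2 c` is the coroot of the undoubled root.
  rcases parity_cases (x.gens.parity i) with hp | hp
  · have he : bracket (x.gens.e i) (x.gens.e i) = 0 :=
      bracket_self_even (hp ▸ x.gens.e_parity i)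
    rw [he, map_zero, LinearMap.zero_apply, smul_zero, eq_comm,
      map_eq_zero_iff _ (G.ofH_injective D.τ R)] at hk
    exact absurd hk hc0
  · have h2 := x.system.bracket_double (i := i) hp
    have h3 : bracket (bracket (x.gens.e i) (x.gens.e i)) (bracket (x.gens.f i) (x.gens.f i)) =
      G.ofH D.τ R ((-4 * x.datum.B i i) • x.gens.coroot i) := h2
    rw [h3, ← map_smul] at hk
    have h4 := G.ofH_injective D.τ R hk
    refine ⟨(2 : ℂ) • c, ?_, ?_, fun μ => ?_⟩
    · rw [← h4, map_smul, map_smul, map_smul, ← x.gens.bracket_self]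
      exact Submodule.smul_mem _ _ (Submodule.smul_mem _ _ (Submodule.smul_mem _ _
        (Submodule.subset_span ⟨_, x.gens.e_mem i, _, x.gens.f_mem i, rfl⟩)))
    · rw [map_smul]
      exact hc2
    · rw [hw, map_smul, smul_smul, smul_eq_mul, mul_comm]

end OrderedRootBase
end Reflections

/-! ### The root lattice and the morphisms of the Weyl groupoid -/

section Lattice

variable {n : ℕ}

theorem lattice_ext {M : Type v} [AddCommGroup M] {f g : (Fin n → ℤ) →ₗ[ℤ] M}
    (hfg : ∀ j, f (Pi.single j 1) = g (Pi.single j 1)) : f = g :=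
  LinearMap.pi_ext' fun j => LinearMap.ext_ring (hfg j)

/-- The reflection of the lattice with row `A` at the basis vector `i`. -/
def latticeReflection (A : Fin n → ℤ) (i : Fin n) (hA : A i = 2) :
    (Fin n → ℤ) ≃ₗ[ℤ] (Fin n → ℤ) :=
  Module.reflection (x := Pi.single i 1) (f := Fintype.linearCombination ℤ A) (by simp [hA])

theorem latticeReflection_single (A : Fin n → ℤ) (i : Fin n) (hA : A i = 2) (j : Fin n) :
    latticeReflection A i hA (Pi.single j 1) = Pi.single j 1 - A j • Pi.single i 1 := by
  rw [latticeReflection, Module.reflection_apply]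
  simp

/-- A reflection along an edge of colour `i` alters only the coordinate `i`. The comparison of signs
of real roots rests on this. -/
theorem apply_of_ne {A : Fin n → ℤ} {i : Fin n} {s : (Fin n → ℤ) ≃ₗ[ℤ] (Fin n → ℤ)}
    (hs : ∀ j, s (Pi.single j 1) = Pi.single j 1 - A j • Pi.single i 1) (m : Fin n → ℤ)
    {k : Fin n} (hk : k ≠ i) : s m k = m k := by
  have h1 : (LinearMap.proj k).comp (s : (Fin n → ℤ) →ₗ[ℤ] (Fin n → ℤ)) =
      (LinearMap.proj k : (Fin n → ℤ) →ₗ[ℤ] ℤ) := by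
    refine lattice_ext fun j => ?_
    simp [hs, hk]
  exact LinearMap.congr_fun h1 m

end Lattice

/-! ### Morphisms of the Weyl groupoid and elements of the Weyl group -/

section Groupoid

variable {n : ℕ} {h : Type u} [AddCommGroup h] [Module ℂ h] {D : CartanDatum n}
  {R : MinimalRealization D.B h}

namespace OrderedRootBase

variable (x y z : OrderedRootBase D R)

/-- The evaluation of the lattice at `x` in the dual Cartan subalgebra. -/
def ev : (Fin n → ℤ) →ₗ[ℤ] Module.Dual ℂ h := Fintype.linearCombination ℤ x.root

theorem ev_single (j : Fin n) : x.ev (Pi.single j 1) = x.root j := by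
  simp [ev]

theorem ev_apply (m : Fin n → ℤ) : x.ev m = ∑ j, (m j : ℂ) • x.root j := by
  simp [ev, Fintype.linearCombination_apply, Int.cast_smul_eq_zsmul]

theorem ev_injective : Function.Injective x.ev := by
  rw [injective_iff_map_eq_zero]
  intro m hm
  rw [ev_apply] at hm
  ext j
  exact_mod_cast Fintype.linearIndependent_iff.1 x.linearIndependent _ hm j

variable {x y z}

theorem serre_self (i : Fin n) : x.datum.serre i i = 2 := by
  simp [CartanDatum.serre]

theorem B_self_ne_zero (hreg : IsRegularLSA D R) {i : Fin n} (hi : ¬ x.IsOddIsotropic i) :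
    x.datum.B i i ≠ 0 := by
  rcases parity_cases (x.datum.τ i) with hp | hp
  · exact (x.datum_isRegular hreg).even_ne_zero i hp
  · exact fun h0 => hi ⟨hp, h0⟩

/-- Regularity makes the quotient an integer, so taking the floor loses nothing. -/
theorem serre_cast (hreg : IsRegularLSA D R) {i j : Fin n} (hi : x.datum.B i i ≠ 0) :
    ((x.datum.serre i j : ℤ) : ℂ) = 2 * x.datum.B i j / x.datum.B i i := by
  by_cases hij : i = j
  · subst hij
    rw [serre_self]
    field_simp
    norm_num
  · by_cases h0 : x.datum.B i j = 0
    · simp [CartanDatum.serre, hij, h0]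
    · have hr := x.datum_isRegular hreg
      obtain ⟨k, hk⟩ : ∃ k : ℤ, 2 * x.datum.B i j / x.datum.B i i = k := by
        rcases parity_cases (x.datum.τ i) with hp | hp
        · obtain ⟨k, -, hk⟩ := hr.even_int i hp j (Ne.symm hij)
          exact ⟨k, hk⟩
        · obtain ⟨k, -, hk⟩ := hr.odd_int i hp hi j (Ne.symm hij)
          exact ⟨2 * k, by rw [hk]; push_cast; rfl⟩
      simp [CartanDatum.serre, hij, h0, hi, hk]

/-- The entries `2`, `-1` and `0` of the Serre row express the simple roots of `x` in those of `y`: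
the lattice map is a change of basis and moves no weight. -/
theorem IsOddReflection.ev_eq {i : Fin n} (hxy : IsOddReflection i x y)
    {s : (Fin n → ℤ) ≃ₗ[ℤ] (Fin n → ℤ)}
    (hs : ∀ j, s (Pi.single j 1) = Pi.single j 1 - x.datum.serre i j • Pi.single i 1)
    (m : Fin n → ℤ) : y.ev (s m) = x.ev m := by
  have h1 : y.ev.comp (s : (Fin n → ℤ) →ₗ[ℤ] (Fin n → ℤ)) = x.ev := by
    refine lattice_ext fun j => ?_
    simp only [LinearMap.comp_apply, LinearEquiv.coe_coe, hs, map_sub, map_smul, ev_single]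
    rw [hxy.2 i, if_pos rfl, hxy.2 j]
    by_cases hij : j = i
    · subst hij
      rw [if_pos rfl, serre_self]
      module
    · rw [if_neg hij]
      by_cases h0 : x.root j (x.gens.coroot i) = 0
      · have h2 : x.datum.B i j = 0 := h0
        simp [CartanDatum.serre, h0, h2, Ne.symm hij]
      · have h2 : x.datum.B i j ≠ 0 := h0
        simp [CartanDatum.serre, h0, h2, Ne.symm hij, hxy.1.2]
  exact LinearMap.congr_fun h1 m

theorem ev_loop (hreg : IsRegularLSA D R) {i : Fin n} (hi : x.datum.B i i ≠ 0)
    {s : (Fin n → ℤ) ≃ₗ[ℤ] (Fin n → ℤ)}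
    (hs : ∀ j, s (Pi.single j 1) = Pi.single j 1 - x.datum.serre i j • Pi.single i 1)
    (m : Fin n → ℤ) : x.ev (s m) = x.reflection hi (x.ev m) := by
  have h1 : x.ev.comp (s : (Fin n → ℤ) →ₗ[ℤ] (Fin n → ℤ)) =
      ((x.reflection hi : Module.Dual ℂ h →ₗ[ℂ] Module.Dual ℂ h).restrictScalars ℤ).comp x.ev := by
    refine lattice_ext fun j => ?_
    simp only [LinearMap.comp_apply, LinearEquiv.coe_coe, hs, map_sub, map_smul, ev_single,
      LinearMap.restrictScalars_apply]
    rw [x.reflection_apply hi, ← Int.cast_smul_eq_zsmul ℂ, serre_cast hreg hi, map_smul,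
      ← datum_B, smul_eq_mul]
    congr 2
    ring
  exact LinearMap.congr_fun h1 m

/-- The root spaces of `±β_i` are lines, so the generators of `y` at `i` are multiples of those of
`x` exchanged, and the coroot is a nonzero multiple `κ` of the old one. As `β_i` vanishes on it,
adding `β_i` to `β_j` does not affect which pairings are zero. -/
theorem IsOddReflection.symm {i : Fin n}
    (hxy : IsOddReflection i x y) : IsOddReflection i y x := by
  obtain ⟨⟨hp, hB⟩, hroot⟩ := hxy
  have hi : y.root i = -x.root i := by rw [hroot, if_pos rfl]
  have hcy : y.gens.coroot i ≠ 0 := y.coroot_linearIndependent.ne_zero i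
  obtain ⟨p, hp'⟩ : ∃ p : ℂ, p • x.gens.f i = y.gens.e i := by
    have h1 := y.gens.e_mem i
    rw [hi, rootSpace_neg_simple] at h1
    exact Submodule.mem_span_singleton.1 h1
  obtain ⟨q, hq⟩ : ∃ q : ℂ, q • x.gens.e i = y.gens.f i := by
    have h1 := y.gens.f_mem i
    rw [hi, neg_neg, rootSpace_simple] at h1
    exact Submodule.mem_span_singleton.1 h1
  have hc : G.ofH D.τ R (y.gens.coroot i) =
      G.ofH D.τ R ((q * p * x.system.oppSign i) • x.gens.coroot i) := by
    rw [← y.gens.bracket_self, ← hp', ← hq, map_smul, map_smul, LinearMap.smul_apply]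
    have := x.system.bracket_f_e i
    change bracket (x.gens.f i) (x.gens.e i) =
      G.ofH D.τ R (x.system.oppSign i • x.gens.coroot i) at this
    rw [this, ← map_smul, ← map_smul, smul_smul, smul_smul, mul_assoc]
  replace hc := G.ofH_injective D.τ R hc
  set κ := q * p * x.system.oppSign i with hκ
  have hκ0 : κ ≠ 0 := by
    intro h0
    rw [h0, zero_smul] at hc
    exact hcy hc
  have he0 : y.gens.e i ≠ 0 := by
    intro h0
    have h1 := y.gens.bracket_self i
    rw [h0, map_zero, LinearMap.zero_apply, eq_comm,
      map_eq_zero_iff _ (G.ofH_injective D.τ R)] at h1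
    exact hcy h1
  have hpy : y.gens.parity i = 1 := by
    refine parity_unique he0 (y.gens.e_parity i) ?_
    rw [← hp']
    have h1 := x.gens.f_parity i
    rw [show x.gens.parity i = 1 from hp] at h1
    exact Submodule.smul_mem _ _ h1
  have hB' : x.root i (x.gens.coroot i) = 0 := hB
  have hval : ∀ j, j ≠ i → (y.root j (y.gens.coroot i) = 0 ↔ x.root j (x.gens.coroot i) = 0) := by
    intro j hj
    rw [hc, map_smul, smul_eq_zero, or_iff_right hκ0, hroot j, if_neg hj]
    split_ifs with h0
    · rfl
    · rw [LinearMap.add_apply, hB', add_zero]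
  refine ⟨⟨hpy, ?_⟩, fun j => ?_⟩
  · rw [datum_B, hi, hc, map_smul, LinearMap.neg_apply, hB', neg_zero, smul_zero]
  · by_cases hj : j = i
    · subst hj
      rw [if_pos rfl, hi, neg_neg]
    · rw [if_neg hj]
      simp only [hval j hj]
      rw [hroot j, if_neg hj, hi]
      split_ifs with h0
      · rfl
      · abel

end OrderedRootBase

open OrderedRootBase

/-- Symmetry merges the two orientations of an odd reflection, and regularity excludes loops at
roots with `b_ii = 0`. -/
theorem edge_cases (hreg : IsRegularLSA D R) {i : Fin n} {x y : OrderedRootBase D R}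
    (hxy : (cartanGraph D R).Edge i x y) :
    IsOddReflection i x y ∨ (x = y ∧ x.datum.B i i ≠ 0) := by
  rcases hxy with hxy | hxy | ⟨rfl, hx⟩
  · exact Or.inl hxy
  · exact Or.inl hxy.symm
  · exact Or.inr ⟨rfl, B_self_ne_zero hreg hx⟩

/-- The lattice reflection of an edge. -/
def simpleMap (x : OrderedRootBase D R) (i : Fin n) : (Fin n → ℤ) ≃ₗ[ℤ] (Fin n → ℤ) :=
  latticeReflection (x.datum.serre i) i (serre_self i)

theorem simpleMap_single (x : OrderedRootBase D R) (i j : Fin n) :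
    simpleMap x i (Pi.single j 1) = Pi.single j 1 - x.datum.serre i j • Pi.single i 1 :=
  latticeReflection_single _ _ _ _

theorem isMorphism_simpleMap {i : Fin n} {x y : OrderedRootBase D R}
    (hxy : (cartanGraph D R).Edge i x y) : IsMorphism (cartanGraph D R) x y (simpleMap x i) :=
  IsMorphism.simple (Γ := cartanGraph D R) i hxy _ (simpleMap_single x i)

theorem connected_symm {x y : OrderedRootBase D R} (hxy : y ∈ component D R x) :
    x ∈ component D R y := by
  have : Std.Symm fun a b => ∃ i, (cartanGraph D R).Edge i a b :=
    ⟨fun _ _ ⟨i, hi⟩ => ⟨i, (cartanGraph D R).symm i _ _ hi⟩⟩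
  exact Relation.ReflTransGen.stdSymm.symm _ _ hxy

theorem connected_trans {x y z : OrderedRootBase D R} (hxy : y ∈ component D R x)
    (hyz : z ∈ component D R y) : z ∈ component D R x := Relation.ReflTransGen.trans hxy hyz

theorem reflection_mem {x y : OrderedRootBase D R} (hxy : y ∈ component D R x) {i : Fin n}
    (hi : y.datum.B i i ≠ 0) : y.reflection hi ∈ componentWeylGroup D R x :=
  Subgroup.subset_closure ⟨y, hxy, i, hi, y.isReflection_reflection hi⟩

theorem inv_apply_apply (w : Module.Dual ℂ h ≃ₗ[ℂ] Module.Dual ℂ h) (μ : Module.Dual ℂ h) :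
    w⁻¹ (w μ) = μ := by
  rw [← LinearEquiv.mul_apply, inv_mul_cancel, LinearEquiv.coe_one, id]

/-- Every morphism of the Weyl groupoid is the restriction of an element of the Weyl group of the
component. -/
theorem IsMorphism.exists_mem (hreg : IsRegularLSA D R) {x y : (cartanGraph D R).V}
    {v : (Fin n → ℤ) ≃ₗ[ℤ] (Fin n → ℤ)} (hv : IsMorphism (cartanGraph D R) x y v) :
    y ∈ component D R x ∧ ∀ b : OrderedRootBase D R, x ∈ component D R b →
      ∃ w ∈ componentWeylGroup D R b, ∀ m, OrderedRootBase.ev y (v m) = w (OrderedRootBase.ev x m) := by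
  -- The statement is made for all `b` in the component, so that two composable morphisms with
  -- different sources are realised in the same group.
  induction hv with
  | id x => exact ⟨Relation.ReflTransGen.refl, fun b _ => ⟨1, one_mem _, fun m => rfl⟩⟩
  | @simple x y i hxy s hs =>
    refine ⟨Relation.ReflTransGen.single ⟨i, hxy⟩, fun b hb => ?_⟩
    rcases edge_cases hreg hxy with hxy | ⟨rfl, hi⟩
    · exact ⟨1, one_mem _, fun m => hxy.ev_eq hs m⟩
    · exact ⟨_, reflection_mem hb hi, fun m => ev_loop hreg hi hs m⟩
  | @comp x y z v w hv hw ihv ihw =>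
    refine ⟨connected_trans ihv.1 ihw.1, fun b hb => ?_⟩
    obtain ⟨w₁, h₁, h₁'⟩ := ihv.2 b hb
    obtain ⟨w₂, h₂, h₂'⟩ := ihw.2 b (connected_trans hb ihv.1)
    refine ⟨w₂ * w₁, mul_mem h₂ h₁, fun m => ?_⟩
    rw [LinearEquiv.trans_apply, h₂', h₁', LinearEquiv.mul_apply]
  | @inv x y v hv ih =>
    refine ⟨connected_symm ih.1, fun b hb => ?_⟩
    obtain ⟨w, hw, hw'⟩ := ih.2 b (connected_trans hb (connected_symm ih.1))
    refine ⟨w⁻¹, inv_mem hw, fun m => ?_⟩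
    have := hw' (v.symm m)
    rw [LinearEquiv.apply_symm_apply] at this
    rw [this, inv_apply_apply]

/-- Two bases in a component are joined by a morphism that does not move the root lattice. -/
theorem exists_transport (hreg : IsRegularLSA D R) {x y : OrderedRootBase D R}
    (hxy : y ∈ component D R x) :
    ∃ p, IsMorphism (cartanGraph D R) x y p ∧ ∀ m, y.ev (p m) = x.ev m := by
  induction hxy with
  | refl => exact ⟨_, IsMorphism.id (Γ := cartanGraph D R) x, fun m => rfl⟩
  | @tail y z _ hyz ih =>
    obtain ⟨p, hp, hp'⟩ := ih
    obtain ⟨i, hi⟩ := hyz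
    rcases edge_cases hreg hi with h1 | ⟨rfl, -⟩
    · refine ⟨_, hp.comp (isMorphism_simpleMap hi), fun m => ?_⟩
      rw [LinearEquiv.trans_apply, ← hp' m]
      exact h1.ev_eq (simpleMap_single y i) (p m)
    · exact ⟨p, hp, hp'⟩

/-- Every element of the Weyl group of the component is induced by an automorphism in the Weyl
groupoid. -/
theorem exists_isMorphism (hreg : IsRegularLSA D R) {x : OrderedRootBase D R}
    {w : Module.Dual ℂ h ≃ₗ[ℂ] Module.Dual ℂ h} (hw : w ∈ componentWeylGroup D R x) :
    ∃ v, IsMorphism (cartanGraph D R) x x v ∧ ∀ m, x.ev (v m) = w (x.ev m) := by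
  induction hw using Subgroup.closure_induction with
  | mem w hw =>
    obtain ⟨y, hy, i, hi, hw⟩ := hw
    obtain ⟨p, hp, hp'⟩ := exists_transport hreg hy
    have hedge : (cartanGraph D R).Edge i y y := Or.inr (Or.inr ⟨rfl, fun hiso => hi hiso.2⟩)
    -- Travel to `y`, use its loop, and return. The two journeys fix all weights, so only the
    -- reflection remains.
    refine ⟨_, (hp.comp (isMorphism_simpleMap hedge)).comp hp.inv, fun m => ?_⟩
    rw [y.eq_reflection hw, ← hp', ← hp']
    simp only [LinearEquiv.trans_apply, LinearEquiv.apply_symm_apply]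
    exact ev_loop hreg hi (simpleMap_single y i) (p m)
  | one => exact ⟨_, IsMorphism.id (Γ := cartanGraph D R) x, fun m => rfl⟩
  | mul w₁ w₂ _ _ ih₁ ih₂ =>
    obtain ⟨v₁, h₁, h₁'⟩ := ih₁
    obtain ⟨v₂, h₂, h₂'⟩ := ih₂
    refine ⟨_, h₂.comp h₁, fun m => ?_⟩
    rw [LinearEquiv.trans_apply, h₁', h₂', LinearEquiv.mul_apply]
  | inv w _ ih =>
    obtain ⟨v, hv, hv'⟩ := ih
    refine ⟨_, hv.inv, fun m => ?_⟩
    have := hv' (v.symm m)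
    rw [LinearEquiv.apply_symm_apply] at this
    rw [this, inv_apply_apply]

end Groupoid

/-! ### Positivity of real roots and faithfulness on the root lattice -/

section Faithful

variable {n : ℕ} {h : Type u} [AddCommGroup h] [Module ℂ h] {D : CartanDatum n}
  {R : MinimalRealization D.B h}

open OrderedRootBase

/-- Positive elements of the root lattice with respect to an ordered root base. -/
def IsPos (x : OrderedRootBase D R) (α : Module.Dual ℂ h) : Prop :=
  ∃ m : Fin n → ℤ, (∀ j, 0 ≤ m j) ∧ α = x.ev m

theorem isPos_simple (x : OrderedRootBase D R) (i : Fin n) : IsPos x (x.root i) := by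
  refine ⟨Pi.single i 1, fun j => ?_, (x.ev_single i).symm⟩
  by_cases hj : j = i
  · subst hj; simp
  · simp [hj]

theorem IsRoot.isPos_or {α : Module.Dual ℂ h} (hα : IsRoot D R α) (x : OrderedRootBase D R) :
    IsPos x α ∨ IsPos x (-α) := by
  have key : ∀ l, IsPos x (ChevalleySystem.listWt x.root l) := fun l =>
    ⟨fun j => (l.count j : ℤ), fun j => Int.natCast_nonneg _, by
      rw [ChevalleySystem.listWt_eq_sum, x.ev_apply]; simp⟩
  obtain ⟨l, rfl | rfl⟩ := x.system.exists_list_of_ne_bot hα.2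
  · exact Or.inl (key l)
  · exact Or.inr (by rw [neg_neg]; exact key l)

/-- `w` is the reflection at the non-isotropic root `γ` that is simple in a base in the component
of `x`. -/
def IsSimpleReflection (x : OrderedRootBase D R) (γ : Module.Dual ℂ h)
    (w : Module.Dual ℂ h ≃ₗ[ℂ] Module.Dual ℂ h) : Prop :=
  ∃ y ∈ component D R x, ∃ i, y.root i = γ ∧ IsReflection D R γ w

theorem IsSimpleReflection.mem {x : OrderedRootBase D R} {γ : Module.Dual ℂ h}
    {w : Module.Dual ℂ h ≃ₗ[ℂ] Module.Dual ℂ h} (hw : IsSimpleReflection x γ w) :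
    w ∈ componentWeylGroup D R x := by
  obtain ⟨y, hy, i, rfl, hw⟩ := hw
  exact Subgroup.subset_closure ⟨y, hy, i, (y.apply_of_isReflection hw).1, hw⟩

theorem componentWeylGroup_le_liftable (hreg : IsRegularLSA D R) (x : OrderedRootBase D R) :
    componentWeylGroup D R x ≤ liftableSubgroup D R := by
  refine (Subgroup.closure_le _).2 ?_
  rintro w ⟨y, -, i, hi, hw⟩
  rw [y.eq_reflection hw]
  exact y.isLiftable_reflection hreg _

/-- The images of the non-isotropic simple roots under the Weyl group of the component. -/
def IsReal (x : OrderedRootBase D R) (α : Module.Dual ℂ h) : Prop :=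
  ∃ u ∈ componentWeylGroup D R x, ∃ γ w, IsSimpleReflection x γ w ∧ α = u γ

theorem IsSimpleReflection.isReal {x : OrderedRootBase D R} {γ : Module.Dual ℂ h}
    {w : Module.Dual ℂ h ≃ₗ[ℂ] Module.Dual ℂ h} (hw : IsSimpleReflection x γ w) : IsReal x γ :=
  ⟨1, one_mem _, γ, w, hw, rfl⟩

theorem IsReal.apply {x : OrderedRootBase D R} {α : Module.Dual ℂ h} (hα : IsReal x α)
    {u : Module.Dual ℂ h ≃ₗ[ℂ] Module.Dual ℂ h} (hu : u ∈ componentWeylGroup D R x) :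
    IsReal x (u α) := by
  obtain ⟨u', hu', γ, w, hw, rfl⟩ := hα
  exact ⟨u * u', mul_mem hu hu', γ, w, hw, rfl⟩

theorem IsReal.isRoot (hreg : IsRegularLSA D R) {x : OrderedRootBase D R} {α : Module.Dual ℂ h}
    (hα : IsReal x α) : IsRoot D R α := by
  obtain ⟨u, hu, _, w, ⟨y, -, i, rfl, -⟩, rfl⟩ := hα
  exact IsLiftable.isRoot (componentWeylGroup_le_liftable hreg x hu) (y.isRoot i)

theorem IsReal.exists_isReflection (hreg : IsRegularLSA D R) {x : OrderedRootBase D R}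
    {α : Module.Dual ℂ h} (hα : IsReal x α) : ∃ w, IsReflection D R α w := by
  obtain ⟨u, hu, γ, w, ⟨y, -, i, -, hw⟩, rfl⟩ := hα
  exact ⟨_, hw.conj (componentWeylGroup_le_liftable hreg x hu)⟩

/-- All bases of a component have the same root lattice, and `W_x` preserves it. This supplies the
integrality in the next lemma. -/
theorem exists_ev_eq (hreg : IsRegularLSA D R) {x y z : OrderedRootBase D R}
    (hy : y ∈ component D R x) (hz : z ∈ component D R x)
    {u : Module.Dual ℂ h ≃ₗ[ℂ] Module.Dual ℂ h} (hu : u ∈ componentWeylGroup D R x)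
    (m : Fin n → ℤ) : ∃ m', u (y.ev m) = z.ev m' := by
  obtain ⟨p, -, hp⟩ := exists_transport hreg (connected_symm hy)
  obtain ⟨q, -, hq⟩ := exists_transport hreg hz
  obtain ⟨v, -, hv⟩ := exists_isMorphism hreg hu
  exact ⟨q (v (p m)), by rw [hq, hv, hp]⟩

/-- A real root is a multiple of a simple root only if it is this root up to sign. -/
theorem IsReal.isUnit_of_eq_smul (hreg : IsRegularLSA D R) {x : OrderedRootBase D R}
    {α : Module.Dual ℂ h} (hα : IsReal x α) {y : OrderedRootBase D R} (hy : y ∈ component D R x)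
    {i : Fin n} {k : ℤ} (hk : α = y.ev (k • Pi.single i 1)) : IsUnit k := by
  obtain ⟨u, hu, _, w, ⟨z, hz, j, rfl, -⟩, rfl⟩ := hα
  obtain ⟨m', hm'⟩ := exists_ev_eq hreg hy hz (inv_mem hu) (Pi.single i 1)
  -- Moved back to the simple root `j` of `z`, the root is `k` times a lattice vector, while its
  -- coordinate at `j` is one.
  have h1 : z.ev (Pi.single j 1) = z.ev (k • m') := by
    rw [z.ev_single, map_smul, ← hm', ← inv_apply_apply u (z.root j), hk, map_smul, map_zsmul]
  have h2 := congrFun (z.ev_injective h1) j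
  simp only [Pi.single_eq_same, Pi.smul_apply, smul_eq_mul] at h2
  exact IsUnit.of_mul_eq_one _ h2.symm

/-- Off `i` the coordinates are both nonnegative and nonpositive, so the root is a nonnegative
multiple of a simple root, and for a real root the multiple is one. -/
theorem IsReal.eq_simple (hreg : IsRegularLSA D R) {x : OrderedRootBase D R}
    {α : Module.Dual ℂ h} (hα : IsReal x α) {y : OrderedRootBase D R} (hy : y ∈ component D R x)
    {i : Fin n} {m m' : Fin n → ℤ} (hm : ∀ j, 0 ≤ m j) (hαm : α = y.ev m) (hm' : ∀ j, 0 ≤ m' j)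
    (hmm' : ∀ j, j ≠ i → m j = -m' j) : α = y.root i := by
  have h1 : m = m i • Pi.single i 1 := by
    ext j
    by_cases hj : j = i
    · subst hj; simp
    · have h2 := hm j
      have h3 := hm' j
      have h4 := hmm' j hj
      simp only [Pi.smul_apply, Pi.single_eq_of_ne hj, smul_zero]
      omega
  have h2 := hα.isUnit_of_eq_smul hreg hy (hαm.trans (congrArg y.ev h1))
  rcases Int.isUnit_iff.1 h2 with h3 | h3
  · rw [hαm, h1, h3, one_smul, y.ev_single]
  · have := hm i
    omega

/-- The sign of a real root does not depend on the base in the component. -/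
theorem IsReal.isPos_congr (hreg : IsRegularLSA D R) {x : OrderedRootBase D R}
    {α : Module.Dual ℂ h} (hα : IsReal x α) {y z : OrderedRootBase D R}
    (hy : y ∈ component D R x) (hyz : z ∈ component D R y) (hpos : IsPos y α) : IsPos z α := by
  induction hyz with
  | refl => exact hpos
  | @tail z z' hz hzz' ih =>
    obtain ⟨i, hi⟩ := hzz'
    rcases edge_cases hreg hi with hodd | ⟨rfl, -⟩
    · rcases (hα.isRoot hreg).isPos_or z' with h1 | ⟨m', hm', hα'⟩
      · exact h1
      · exfalso
        obtain ⟨m, hm, hαm⟩ := ih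
        -- A change of sign across an odd edge would make the root equal to the isotropic simple
        -- root. But a real root has a reflection and an isotropic simple root has none.
        have hs := hodd.ev_eq (simpleMap_single z i) m
        have h2 : simpleMap z i m = -m' := by
          refine z'.ev_injective ?_
          rw [hs, ← hαm, map_neg, ← hα', neg_neg]
        have h3 : α = z.root i := by
          refine hα.eq_simple hreg (connected_trans hy hz) hm hαm hm' fun j hj => ?_
          rw [← apply_of_ne (simpleMap_single z i) m hj, h2, Pi.neg_apply]
        obtain ⟨w, hw⟩ := hα.exists_isReflection hreg
        rw [h3] at hw
        exact (z.apply_of_isReflection hw).1 hodd.1.2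
    · exact ih

/-- A simple reflection changes the sign of no positive real root but the simple one. -/
theorem IsReal.eq_of_isPos_neg (hreg : IsRegularLSA D R) {x : OrderedRootBase D R}
    {α : Module.Dual ℂ h} (hα : IsReal x α) {δ : Module.Dual ℂ h}
    {w : Module.Dual ℂ h ≃ₗ[ℂ] Module.Dual ℂ h} (hw : IsSimpleReflection x δ w)
    (hpos : IsPos x α) (hneg : IsPos x (-w α)) : α = δ := by
  have hwα := hα.apply hw.mem
  obtain ⟨y, hy, i, rfl, hw⟩ := hw
  obtain ⟨m, hm, hαm⟩ := hα.isPos_congr hreg Relation.ReflTransGen.refl hy hpos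
  -- Negativity passes from `x` to `y`: otherwise `w α` would be positive at `y`, hence at `x`, and
  -- both signs at `x` would force it to be zero.
  have hneg' : IsPos y (-w α) := by
    rcases (hwα.isRoot hreg).isPos_or y with h1 | h1
    · obtain ⟨m₁, hm₁, h2⟩ := hwα.isPos_congr hreg hy (connected_symm hy) h1
      obtain ⟨m₂, hm₂, h3⟩ := hneg
      have h4 : m₁ + m₂ = 0 := by
        refine x.ev_injective ?_
        rw [map_add, ← h2, ← h3, map_zero, add_neg_cancel]
      have h5 : m₁ = 0 := by
        ext j
        have := congrFun h4 j
        simp only [Pi.add_apply, Pi.zero_apply] at this ⊢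
        linarith [hm₁ j, hm₂ j]
      rw [h5, map_zero] at h2
      exact absurd h2 (hwα.isRoot hreg).1
    · exact h1
  obtain ⟨m', hm', hαm'⟩ := hneg'
  have hs := ev_loop hreg (y.apply_of_isReflection hw).1 (simpleMap_single y i) m
  rw [← y.eq_reflection hw, ← hαm] at hs
  have h2 : simpleMap y i m = -m' := by
    refine y.ev_injective ?_
    rw [hs, map_neg, ← hαm', neg_neg]
  refine hα.eq_simple hreg hy hm hαm hm' fun j hj => ?_
  rw [← apply_of_ne (simpleMap_single y i) m hj, h2, Pi.neg_apply]

theorem IsSimpleReflection.isPos (hreg : IsRegularLSA D R) {x : OrderedRootBase D R}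
    {γ : Module.Dual ℂ h} {w : Module.Dual ℂ h ≃ₗ[ℂ] Module.Dual ℂ h}
    (hw : IsSimpleReflection x γ w) : IsPos x γ := by
  have h1 := hw.isReal
  obtain ⟨y, hy, i, rfl, -⟩ := hw
  exact h1.isPos_congr hreg hy (connected_symm hy) (isPos_simple y i)

/-- Words in the simple reflections. -/
def IsReflectionWord (x : OrderedRootBase D R)
    (l : List (Module.Dual ℂ h ≃ₗ[ℂ] Module.Dual ℂ h)) : Prop :=
  ∀ w ∈ l, ∃ γ, IsSimpleReflection x γ w

theorem IsReflectionWord.prod_mem {x : OrderedRootBase D R}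
    {l : List (Module.Dual ℂ h ≃ₗ[ℂ] Module.Dual ℂ h)} (hl : IsReflectionWord x l) :
    l.prod ∈ componentWeylGroup D R x :=
  Subgroup.list_prod_mem _ fun w hw => (hl w hw).choose_spec.mem

/-- The exchange condition. -/
theorem IsReflectionWord.exchange (hreg : IsRegularLSA D R) {x : OrderedRootBase D R}
    {γ : Module.Dual ℂ h} {r : Module.Dual ℂ h ≃ₗ[ℂ] Module.Dual ℂ h}
    (hr : IsSimpleReflection x γ r) (l : List (Module.Dual ℂ h ≃ₗ[ℂ] Module.Dual ℂ h))
    (hl : IsReflectionWord x l) (hneg : IsPos x (-(l.prod γ))) :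
    ∃ l', IsReflectionWord x l' ∧ l'.prod = l.prod * r ∧ l'.length + 1 = l.length := by
  induction l with
  | nil =>
    exfalso
    obtain ⟨m₁, hm₁, h2⟩ := hr.isPos hreg
    obtain ⟨m₂, hm₂, h3⟩ := hneg
    rw [List.prod_nil, LinearEquiv.coe_one, id] at h3
    have h4 : m₁ + m₂ = 0 := by
      refine x.ev_injective ?_
      rw [map_add, ← h2, ← h3, map_zero, add_neg_cancel]
    have h5 : m₁ = 0 := by
      ext j
      have := congrFun h4 j
      simp only [Pi.add_apply, Pi.zero_apply] at this ⊢
      linarith [hm₁ j, hm₂ j]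
    rw [h5, map_zero] at h2
    exact (hr.isReal.isRoot hreg).1 h2
  | cons w l ih =>
    have hl' : IsReflectionWord x l := fun w hw => hl w (List.mem_cons_of_mem _ hw)
    obtain ⟨δ, hδ⟩ := hl w List.mem_cons_self
    have hreal := hr.isReal.apply hl'.prod_mem
    -- If the tail leaves `γ` positive, the letter `w` is what makes it negative. Then `l.prod γ` is
    -- the simple root of `w`, so `w` is the conjugate of `r` by the tail and can be deleted.
    -- Otherwise the deletion happens in the tail.
    rcases (hreal.isRoot hreg).isPos_or x with hpos | hneg'
    · rw [List.prod_cons, LinearEquiv.mul_apply] at hneg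
      have h1 := hreal.eq_of_isPos_neg hreg hδ hpos hneg
      refine ⟨l, hl', ?_, rfl⟩
      obtain ⟨-, -, -, -, hrr⟩ := hr
      have h2 := hrr.conj (componentWeylGroup_le_liftable hreg x hl'.prod_mem)
      rw [h1] at h2
      have h3 : w = l.prod * r * l.prod⁻¹ := by
        obtain ⟨y, -, i, rfl, hw⟩ := hδ
        rw [y.eq_reflection hw, y.eq_reflection h2]
      rw [List.prod_cons, h3, inv_mul_cancel_right, mul_assoc, hrr.mul_self, mul_one]
    · obtain ⟨l', h1, h2, h3⟩ := ih hl' hneg'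
      refine ⟨w :: l', ?_, ?_, ?_⟩
      · intro w' hw'
        rcases List.mem_cons.1 hw' with rfl | hw'
        · exact ⟨δ, hδ⟩
        · exact h1 w' hw'
      · rw [List.prod_cons, List.prod_cons, h2, mul_assoc]
      · simp only [List.length_cons, h3]

/-- The last letter negates its root `γ`, and the whole word fixes `γ`, so the rest of the word
makes `γ` negative. The exchange condition replaces the word by one that is two letters shorter, and
the induction continues. -/
theorem IsReflectionWord.prod_eq_one (hreg : IsRegularLSA D R) {x : OrderedRootBase D R} (N : ℕ) :
    ∀ l : List (Module.Dual ℂ h ≃ₗ[ℂ] Module.Dual ℂ h), l.length = N → IsReflectionWord x l →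
      (∀ m, l.prod (x.ev m) = x.ev m) → l.prod = 1 := by
  induction N using Nat.strong_induction_on with
  | _ N ih =>
    intro l hlN hl hfix
    rcases List.eq_nil_or_concat l with rfl | ⟨l₁, r, rfl⟩
    · rfl
    rw [List.concat_eq_append] at *
    have hl₁ : IsReflectionWord x l₁ := fun w hw => hl w (List.mem_append_left _ hw)
    obtain ⟨γ, hr⟩ := hl r (by simp)
    obtain ⟨m, hm, hγ⟩ := hr.isPos hreg
    have hrγ : r γ = -γ := by
      obtain ⟨-, -, -, -, hrr⟩ := hr
      exact hrr.apply_self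
    have h1 := hfix m
    rw [List.prod_append, List.prod_singleton, LinearEquiv.mul_apply, ← hγ, hrγ, map_neg] at h1
    obtain ⟨l', h2, h3, h4⟩ := hl₁.exchange hreg hr l₁ (by rw [h1]; exact hr.isPos hreg)
    have h5 : (l₁ ++ [r]).prod = l'.prod := by
      rw [List.prod_append, List.prod_singleton, h3]
    rw [h5] at hfix ⊢
    refine ih l'.length ?_ l' rfl h2 hfix
    rw [← hlN, List.length_append, List.length_singleton]
    omega

/-- The Weyl group of the component acts faithfully on the root lattice. -/
theorem eq_one_of_fixes_lattice (hreg : IsRegularLSA D R) {x : OrderedRootBase D R}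
    {w : Module.Dual ℂ h ≃ₗ[ℂ] Module.Dual ℂ h} (hw : w ∈ componentWeylGroup D R x)
    (hfix : ∀ m, w (x.ev m) = x.ev m) : w = 1 := by
  have hw' : w ∈ (componentWeylGroup D R x).toSubmonoid := hw
  rw [componentWeylGroup, Subgroup.closure_toSubmonoid] at hw'
  obtain ⟨l, hl, rfl⟩ := Submonoid.exists_list_of_mem_closure hw'
  refine IsReflectionWord.prod_eq_one hreg l.length l rfl (fun w hw => ?_) hfix
  have key : ∀ w, (∃ y ∈ component D R x, ∃ i, y.datum.B i i ≠ 0 ∧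
      IsReflection D R (y.root i) w) → ∃ γ, IsSimpleReflection x γ w := by
    rintro w ⟨y, hy, i, -, hw⟩
    exact ⟨_, y, hy, i, rfl, hw⟩
  rcases hl w hw with h1 | h1
  · exact key w h1
  · obtain ⟨γ, hγ⟩ := key _ h1
    -- Reflections are involutions, so inverses of generators are again letters.
    have h2 : w⁻¹ = w := by
      obtain ⟨-, -, -, -, h3⟩ := hγ
      have := h3.mul_self
      rw [mul_eq_one_iff_eq_inv, inv_inv] at this
      exact this
    rw [h2] at hγ
    exact ⟨γ, hγ⟩

end Faithful

/-! ### Automorphism groups in the Weyl groupoid -/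

section Automorphisms

variable {n : ℕ} {h : Type u} [AddCommGroup h] [Module ℂ h] {D : CartanDatum n}
  {R : MinimalRealization D.B h}

/-- An element of the Weyl group is sent to its matrix in the simple roots of `x`. Injectivity is
faithfulness on the root lattice; surjectivity says that every automorphism comes from the group. -/
theorem exists_mulEquiv_aut (hreg : IsRegularLSA D R) (x : WeylGroupoid (cartanGraph D R)) :
    Nonempty (CategoryTheory.Aut x ≃* componentWeylGroup D R x.vertex) := by
  let b : OrderedRootBase D R := x.vertex
  have hv : ∀ w : componentWeylGroup D R b, ∃ v, IsMorphism (cartanGraph D R) b b v ∧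
      ∀ m, b.ev (v m) = w.1 (b.ev m) := fun w => exists_isMorphism hreg w.2
  choose v hv hv' using hv
  let φ : componentWeylGroup D R b →* CategoryTheory.Aut x :=
    MonoidHom.mk' (fun w => ⟨⟨v w, hv w⟩, ⟨(v w).symm, (hv w).inv⟩,
      Subtype.ext (LinearEquiv.self_trans_symm _), Subtype.ext (LinearEquiv.symm_trans_self _)⟩) (by
      intro w₁ w₂
      refine CategoryTheory.Iso.ext (Subtype.ext (LinearEquiv.ext fun m => b.ev_injective ?_))
      -- Multiplication in `Aut` applies the right factor first, as composition of maps does, so no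
      -- opposite group appears.
      change b.ev (v (w₁ * w₂) m) = b.ev (v w₁ (v w₂ m))
      rw [hv', hv', hv', Subgroup.coe_mul, LinearEquiv.mul_apply])
  refine ⟨(MulEquiv.ofBijective φ ⟨?_, fun g => ?_⟩).symm⟩
  · rw [injective_iff_map_eq_one]
    intro w hw
    refine Subtype.ext (eq_one_of_fixes_lattice hreg w.2 fun m => ?_)
    have h1 : v w m = m := congrArg (fun g : CategoryTheory.Aut x => g.hom.1 m) hw
    rw [← hv', h1]
  · obtain ⟨w, hw, hw'⟩ := (g.hom.2.exists_mem hreg).2 b Relation.ReflTransGen.refl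
    refine ⟨⟨w, hw⟩, CategoryTheory.Iso.ext (Subtype.ext (LinearEquiv.ext fun m =>
      b.ev_injective ?_))⟩
    change b.ev (v ⟨w, hw⟩ m) = b.ev (g.hom.1 m)
    rw [hv']
    exact (hw' m).symm

theorem OrderedRootBase.isEvenRoot (y : OrderedRootBase D R) {i : Fin n}
    (hp : y.datum.τ i = 0) : IsEvenRoot D R (y.root i) := by
  refine ⟨(y.isRoot i).1, fun hbot => ?_⟩
  have h1 : y.gens.e i ∈ rootSpace D R (y.root i) ⊓ part 0 :=
    ⟨y.gens.e_mem i, (show y.gens.parity i = 0 from hp) ▸ y.gens.e_parity i⟩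
  rw [hbot, Submodule.mem_bot] at h1
  have h2 := y.gens.bracket_self i
  rw [h1, map_zero, LinearMap.zero_apply, eq_comm,
    map_eq_zero_iff _ (G.ofH_injective D.τ R)] at h2
  exact y.coroot_linearIndependent.ne_zero i h2

/-- An even simple root is itself principal, and for an odd non-isotropic one its double is
principal with the same reflection. -/
theorem componentWeylGroup_le_weylGroup (x : OrderedRootBase D R) :
    componentWeylGroup D R x ≤ weylGroup D R := by
  rw [componentWeylGroup, Subgroup.closure_le]
  rintro w ⟨y, -, i, hi, hw⟩
  rcases parity_cases (y.datum.τ i) with hp | hp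
  · exact Subgroup.subset_closure ⟨y.root i, ⟨y.isEvenRoot hp, y, i, Or.inl rfl⟩, hw⟩
  · obtain ⟨h1, h2⟩ := y.isReflection_double hp hi
    refine Subgroup.subset_closure ⟨(2 : ℂ) • y.root i, ⟨h1, y, i, Or.inr ?_⟩, ?_⟩
    · rw [smul_smul]
      norm_num
    · rw [y.eq_reflection hw]
      exact h2

/-- Conjugation by `w` turns the reflection at `α` into the one at `w α`, which is a simple root in
the component or twice one; both give a generator. -/
theorem weylGroup_le_componentWeylGroup (hreg : IsRegularLSA D R) (x : OrderedRootBase D R)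
    (hx : ∀ α, IsPrincipalEvenRoot D R α → ∃ w ∈ componentWeylGroup D R x,
      ∃ y ∈ component D R x, OccursIn D R (w α) y) :
    weylGroup D R ≤ componentWeylGroup D R x := by
  rw [weylGroup, Subgroup.closure_le]
  rintro r ⟨α, hα, hr⟩
  obtain ⟨w, hw, y, hy, i, hi⟩ := hx α hα
  have h1 := hr.conj (componentWeylGroup_le_liftable hreg x hw)
  have h2 : IsReflection D R (y.root i) (w * r * w⁻¹) := by
    rcases hi with hi | hi
    · rwa [hi]
    · refine y.isReflection_of_double ?_
      rw [hi, smul_smul]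
      norm_num
      exact h1
  have h3 : w * r * w⁻¹ ∈ componentWeylGroup D R x :=
    Subgroup.subset_closure ⟨y, hy, i, (y.apply_of_isReflection h2).1, h2⟩
  have h4 := mul_mem (mul_mem (inv_mem hw) h3) hw
  simpa [mul_assoc] using h4

theorem exists_mulEquiv_aut_weylGroup (hreg : IsRegularLSA D R)
    (x : WeylGroupoid (cartanGraph D R))
    (hx : ∀ α, IsPrincipalEvenRoot D R α → ∃ w ∈ componentWeylGroup D R x.vertex,
      ∃ y ∈ component D R x.vertex, OccursIn D R (w α) y) :
    Nonempty (CategoryTheory.Aut x ≃* weylGroup D R) := by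
  obtain ⟨φ⟩ := exists_mulEquiv_aut hreg x
  exact ⟨φ.trans (MulEquiv.subgroupCongr (le_antisymm (componentWeylGroup_le_weylGroup _)
    (weylGroup_le_componentWeylGroup hreg _ hx)))⟩

end Automorphisms

end ContragredientLSA

end

open ContragredientLSA in
theorem mainTheorem6 {n : ℕ} {h : Type u} [AddCommGroup h] [Module ℂ h]
    (D : CartanDatum n) (R : MinimalRealization D.B h)
    (hsymm : D.IsSymmetrizable) (hreg : IsRegularLSA D R)
    (x : WeylGroupoid (cartanGraph D R)) :
    Nonempty (CategoryTheory.Aut x ≃* componentWeylGroup D R x.vertex) ∧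
    ((∀ α, IsEvenRoot D R α → ∃ y ∈ component D R x.vertex, OccursIn D R α y) →
      Nonempty (CategoryTheory.Aut x ≃* weylGroup D R)) ∧
    ((∀ α, IsPrincipalEvenRoot D R α → ∃ w ∈ componentWeylGroup D R x.vertex,
        ∃ y ∈ component D R x.vertex, OccursIn D R (w α) y) →
      Nonempty (CategoryTheory.Aut x ≃* weylGroup D R)) :=
  ⟨exists_mulEquiv_aut hreg x,
    -- Principal even roots are even, so this is the last claim with `w = 1`.
    fun hx => exists_mulEquiv_aut_weylGroup hreg x fun α hα => ⟨1, one_mem _, hx α hα.1⟩,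
    exists_mulEquiv_aut_weylGroup hreg x⟩
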